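/- **Setting.** Let $\varphi_\ell(t)=e^{-t/2}\sum_{j=0}^{\ell}(-1)^j\binom{\ell}{j}\frac{t^j}{j!}$, $\ell\ge 0$, be the Laguerre functions on $\mathbb R_+$. For $h\in L^2(\mathbb R_+)$ write $h_\ell=\langle h,\varphi_\ell\rangle$ and $h^\ell=(h_0,\dots,h_\ell)$. For $s>0$ and $M\ge 0$ let $\mathcal W^s(M)$ be the set of $f\in L^2(\mathbb R_+)$ with $\sum_{\ell\ge0}\big((\ell+\tfrac12)^{s}f_\ell\big)^2\le M^2$. For $g\in L^2(\mathbb R_+)$ let $Kh(t)=\int_0^t h(t-\tau)g(\tau)\,d\tau$ and let $K^\ell=(\langle K\varphi_j,\varphi_i\rangle)_{0\le i,j\le \ell}$ be its Galerkin matrix. Put $\dot g_0=g_0$, $\dot g_\ell=g_\ell-g_{\ell-1}$ for $\ell\ge1$, and $\dot g(z)=\sum_\ell \dot g_\ell z^\ell$. For $\nu,Q_1,Q_2>0$ and $Q=(Q_1,Q_2)$, let $\mathcal G_\nu(Q)$ be the set of $g\in L^2(\mathbb R_+)$ with $g_0\ne0$ such that the coefficients $\gamma_k$ of the power series $1/\dot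 g(z)=\sum_k\gamma_kz^k$ satisfy, for all $\ell\ge 0$, $$\sum_{k=0}^{\ell}\gamma_k^2\le Q_2(\ell\vee1)^{2\nu-1},\qquad \sum_{k=0}^{\ell}\sum_{n=0}^{k}\gamma_n^2\ge Q_1(\ell\vee1)^{2\nu}.$$ **Observations.** Let $0\le t_1\le\dots\le t_n\le T$ be design points with $n\ge 1$ and $T>0$, let $\sigma>0$, and set $\varepsilon=\sigma\sqrt{T/n}$. Let $G_\ell=\big(\sum_{i=1}^n\varphi_k(t_i)\varphi_m(t_i)\big)_{0\le k,m\le\ell}$ and $\Omega_\ell=\frac nT G_\ell^{-1}$. For $\delta>0$ one observes $$y^\ell=K^\ell f^\ell+\varepsilon\,\xi_\ell,\qquad K^\ell_\delta=K^\ell+\delta B^\ell,$$ where $\xi_\ell\sim\mathcal N(0,\Omega_\ell)$, $B^\ell$ is the lower triangular Toeplitz matrix with first column $(b_0,\dots,b_\ell)$, the $b_k$ are i.i.d. standard Gaussian, and each $\xi_\ell$ is independent of $(b_k)_{k\ge0}$. **Algorithm II.** Let $\|\cdot\|_{\rm op}$ be the spectral norm and $\|A\|_{\rm HS}=\sqrt{\operatorname{Tr}({}^tAA)}$.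 For $\lambda>0$ and constants $\kappa,\tau_{sig},\tau_{op}>0$ put $$L^{\mathbf{II}}=\lambda\big(\varepsilon\sqrt{|\log\varepsilon|}\vee\delta|\log\delta|\big)^{-1},\qquad O_{\ell,\delta}=\kappa\big((\ell\vee1)\log(\ell\vee2)\big)^{1/2}\delta\sqrt{|\log\delta|}.$$ If $\|(K^\ell_\delta)^{-1}\|_{\rm op}<O_{\ell,\delta}^{-1}$, let $\zeta_\ell$ be the coordinate of index $\ell$ of $(K^\ell_\delta)^{-1}y^\ell$ and $$S_\ell=\|(K^\ell_\delta)^{-1}\|_{\rm HS}(\ell\vee1)^{-1/2}\big(\tau_{sig}\,\varepsilon\sqrt{|\log\varepsilon|}\vee\tau_{op}\,\delta|\log\delta|\big);$$ otherwise let $\zeta_\ell=0$ and $S_\ell=+\infty$. The estimator is $\widetilde f^{\mathbf{II}}=\sum_{\ell\le L^{\mathbf{II}}}\zeta_\ell\mathbf 1_{\{|\zeta_\ell|>S_\ell\}}\varphi_\ell$. **Theorem.** Let $M\ge0$, $\nu>0$, $Q_1,Q_2>0$, $s>1/2$ and $\lambda>0$. Suppose that there is $C\ge 0$ such that, for all $\ell\le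 L^{\mathbf{II}}$, $G_\ell$ is invertible and all eigenvalues of $\Omega_\ell$ are at most $C$. Then, for $\kappa,\tau_{sig},\tau_{op}$ sufficiently large (how large may depend on $C,\lambda,s,M,\nu,Q_1,Q_2$), and for all sufficiently small $\varepsilon$ and $\delta$, $$\sup_{f\in\mathcal W^s(M),\ g\in\mathcal G_\nu(Q)}\mathbb E\|\widetilde f^{\mathbf{II}}-f\|_{L^2(\mathbb R_+)}\le A\Big[\big(\delta|\log\delta|\big)^{\frac{s}{s+\nu}}\vee\big(\varepsilon\sqrt{|\log\varepsilon|}\big)^{\frac{s}{s+\nu}}\Big],$$ where $A$, and how small $\varepsilon$ and $\delta$ have to be, depend only on $\lambda,\kappa,\tau_{sig},\tau_{op},s,M,\nu,Q_1,Q_2$. -/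

import Mathlib

open MeasureTheory ProbabilityTheory
open scoped Matrix

noncomputable section

namespace LaplaceDeconv

/-! ### Laguerre functions on the half line -/

/-- Lebesgue measure on the half line `ℝ₊`. -/
def halfLine : Measure ℝ := volume.restrict (Set.Ioi 0)

/-- The Laguerre polynomial `L_ℓ(t) = ∑_{j ≤ ℓ} (-1)^j (ℓ choose j) t^j / j!`. -/
def laguerrePoly (l : ℕ) (t : ℝ) : ℝ :=
  ∑ j ∈ Finset.range (l + 1), (-1) ^ j * (l.choose j : ℝ) * (t ^ j / (j.factorial : ℝ))

/-- The Laguerre function `φ_ℓ(t) = √(2a) e^{-a t} L_ℓ(2 a t)` with `a = 1/2`. -/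
def laguerreFun (l : ℕ) (t : ℝ) : ℝ := Real.exp (-t / 2) * laguerrePoly l t

/-- The Laguerre coefficient `⟨h, φ_ℓ⟩` in `L²(ℝ₊)`. -/
def coeff (h : ℝ → ℝ) (l : ℕ) : ℝ := ∫ t, h t * laguerreFun l t ∂halfLine

/-- The vector `h^ℓ` of the first `ℓ + 1` Laguerre coefficients. -/
def coeffVec (h : ℝ → ℝ) (l : ℕ) : Fin (l + 1) → ℝ := fun k => coeff h k

/-- The Laguerre-Sobolev ball `W^s(M)`. -/
def sobolevBall (s M : ℝ) : Set (ℝ → ℝ) :=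
  {f | MemLp f 2 halfLine ∧
    Summable (fun l : ℕ => (((l : ℝ) + 1 / 2) ^ s * coeff f l) ^ 2) ∧
    ∑' l : ℕ, (((l : ℝ) + 1 / 2) ^ s * coeff f l) ^ 2 ≤ M ^ 2}

/-! ### The convolution operator, its Galerkin matrices, and its ill-posedness -/

/-- Laplace convolution: `(K h)(t) = ∫_0^t h(t - τ) g(τ) dτ`. -/
def convOp (g h : ℝ → ℝ) (t : ℝ) : ℝ := ∫ τ in (0 : ℝ)..t, h (t - τ) * g τ

/-- The Galerkin matrix `K^ℓ`, with entries `⟨K φ_j, φ_i⟩` for `i, j ≤ ℓ`. -/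
def galerkin (g : ℝ → ℝ) (l : ℕ) : Matrix (Fin (l + 1)) (Fin (l + 1)) ℝ :=
  Matrix.of fun i j => coeff (convOp g (laguerreFun j)) i

/-- The lower triangular Toeplitz matrix `T_ℓ(a)` of a sequence `a`. -/
def toeplitz (a : ℕ → ℝ) (l : ℕ) : Matrix (Fin (l + 1)) (Fin (l + 1)) ℝ :=
  Matrix.of fun i j => if (j : ℕ) ≤ (i : ℕ) then a ((i : ℕ) - (j : ℕ)) else 0

/-- The Laguerre coefficients of `ġ`: `g_0` for `ℓ = 0` and `g_ℓ - g_{ℓ-1}` for `ℓ ≥ 1`. -/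
def dotCoeff (g : ℝ → ℝ) : ℕ → ℝ
  | 0 => coeff g 0
  | l + 1 => coeff g (l + 1) - coeff g l

/-- The coefficients `γ_k` of the power series `1 / ġ(z)`, where `ġ(z) = ∑ ġ_k z^k`. -/
def invCoeff (g : ℝ → ℝ) (k : ℕ) : ℝ :=
  PowerSeries.coeff k (PowerSeries.mk (dotCoeff g))⁻¹

/-- The class `G_ν(Q₁, Q₂)` of kernels with second kind degree of ill-posedness `ν`. The condition
`g_0 ≠ 0` says that the power series `ġ(z)` is invertible. -/
def illPosedClass (ν Q₁ Q₂ : ℝ) : Set (ℝ → ℝ) :=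
  {g | MemLp g 2 halfLine ∧ coeff g 0 ≠ 0 ∧ ∀ l : ℕ,
    ∑ k ∈ Finset.range (l + 1), invCoeff g k ^ 2 ≤ Q₂ * (max (l : ℝ) 1) ^ (2 * ν - 1) ∧
    Q₁ * (max (l : ℝ) 1) ^ (2 * ν) ≤
      ∑ k ∈ Finset.range (l + 1), ∑ n ∈ Finset.range (k + 1), invCoeff g n ^ 2}

/-! ### The design -/

/-- A design: `n ≥ 1` observation times `0 ≤ t_1 ≤ ... ≤ t_n ≤ T`. -/
structure Design where
  n : ℕ
  n_pos : 0 < n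
  T : ℝ
  T_pos : 0 < T
  t : Fin n → ℝ
  t_mono : Monotone t
  t_nonneg : ∀ i, 0 ≤ t i
  t_le : ∀ i, t i ≤ T

/-- The signal noise level `ε = σ √(T / n)`. -/
def Design.noiseLevel (D : Design) (σ : ℝ) : ℝ := σ * Real.sqrt (D.T / D.n)

/-- The Gram matrix of the design, with entries `∑_i φ_k(t_i) φ_m(t_i)` for `k, m ≤ ℓ`. -/
def Design.gram (D : Design) (l : ℕ) : Matrix (Fin (l + 1)) (Fin (l + 1)) ℝ :=
  Matrix.of fun k m => ∑ i, laguerreFun k (D.t i) * laguerreFun m (D.t i)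

/-- The matrix `Ω_ℓ = (n / T) (Gram matrix)⁻¹`. -/
def Design.Omega (D : Design) (l : ℕ) : Matrix (Fin (l + 1)) (Fin (l + 1)) ℝ :=
  ((D.n : ℝ) / D.T) • (D.gram l)⁻¹

/-- The design is well conditioned up to level `L`, with constant `C`: for all `ℓ ≤ L` the matrix
`Ω_ℓ` exists and its eigenvalues are at most `C`. -/
def Design.WellConditioned (D : Design) (L : ℕ) (C : ℝ) : Prop :=
  ∀ l ≤ L, IsUnit (D.gram l).det ∧ ∀ x ∈ spectrum ℝ (D.Omega l), x ≤ C

/-! ### The observations -/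

/-- The noises up to level `L`: `b` is a Gaussian white noise (given by its coefficients, which are
independent standard Gaussian variables); for every `ℓ ≤ L`, `ξ_ℓ ∼ N(0, Ω_ℓ)` is independent
of `b`. Nothing is required of the joint law of the `ξ_ℓ`. -/
structure NoiseModel (D : Design) (L : ℕ) {Ω : Type*} [MeasurableSpace Ω] (P : Measure Ω)
    (b : ℕ → Ω → ℝ) (ξ : (l : ℕ) → Ω → EuclideanSpace ℝ (Fin (l + 1))) : Prop where
  b_law : ∀ k, HasLaw (b k) (gaussianReal 0 1) P
  b_indep : iIndepFun b P
  xi_law : ∀ l ≤ L, HasLaw (ξ l) (multivariateGaussian 0 (D.Omega l)) P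
  xi_indep : ∀ l ≤ L, IndepFun (ξ l) (fun ω k => b k ω) P

/-- The observed signal `y^ℓ = K^ℓ f^ℓ + ε ξ_ℓ`. -/
def obsSignal (g f : ℝ → ℝ) (ε : ℝ) {Ω : Type*} (ξ : (l : ℕ) → Ω → EuclideanSpace ℝ (Fin (l + 1)))
    (ω : Ω) (l : ℕ) : Fin (l + 1) → ℝ :=
  fun i => (galerkin g l *ᵥ coeffVec f l) i + ε * ξ l ω i

/-- The observed operator `K_δ^ℓ = K^ℓ + δ B^ℓ`, with `B^ℓ = T_ℓ(b)`. -/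
def obsOperator (g : ℝ → ℝ) (δ : ℝ) {Ω : Type*} (b : ℕ → Ω → ℝ) (ω : Ω) (l : ℕ) :
    Matrix (Fin (l + 1)) (Fin (l + 1)) ℝ :=
  galerkin g l + δ • toeplitz (fun k => b k ω) l

/-! ### Algorithm II -/

/-- The spectral norm of a matrix. -/
def opNorm {m : ℕ} (A : Matrix (Fin m) (Fin m) ℝ) : ℝ := ‖Matrix.toEuclideanCLM (𝕜 := ℝ) A‖

/-- The Hilbert-Schmidt norm `√(Tr(ᵗA A))` of a matrix. -/
def hsNorm {m : ℕ} (A : Matrix (Fin m) (Fin m) ℝ) : ℝ := Real.sqrt (Aᵀ * A).trace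

/-- The maximal level `λ (ε √|log ε| ∨ δ |log δ|)⁻¹`. -/
def maxLevel (lam ε δ : ℝ) : ℝ :=
  lam * (max (ε * Real.sqrt |Real.log ε|) (δ * |Real.log δ|))⁻¹

/-- The operator threshold `O_{ℓ,δ} = κ ((ℓ ∨ 1) log(ℓ ∨ 2))^{1/2} δ √|log δ|`. -/
def opLevel (κ δ : ℝ) (l : ℕ) : ℝ :=
  κ * Real.sqrt (max (l : ℝ) 1 * Real.log (max (l : ℝ) 2)) * δ * Real.sqrt |Real.log δ|

/-- The signal threshold: `‖(K_δ^ℓ)⁻¹‖_HS (ℓ ∨ 1)^{-1/2} (τ_sig ε √|log ε| ∨ τ_op δ |log δ|)` if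
`‖(K_δ^ℓ)⁻¹‖_op < O_{ℓ,δ}⁻¹`, and `+∞` otherwise. -/
def signalLevel (κ τsig τop ε δ : ℝ) (Kδ : (l : ℕ) → Matrix (Fin (l + 1)) (Fin (l + 1)) ℝ)
    (l : ℕ) : EReal :=
  if opNorm (Kδ l)⁻¹ < (opLevel κ δ l)⁻¹ then
    ((hsNorm (Kδ l)⁻¹ * (max (l : ℝ) 1) ^ (-(1 / 2) : ℝ) *
      max (τsig * (ε * Real.sqrt |Real.log ε|)) (τop * (δ * |Real.log δ|)) : ℝ) : EReal)
  else ⊤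

/-- The statistic `ζ_ℓ`: the coordinate of index `ℓ` of `(K_δ^ℓ)⁻¹ y^ℓ` if
`‖(K_δ^ℓ)⁻¹‖_op < O_{ℓ,δ}⁻¹`, and `0` otherwise. If `K_δ^ℓ` is singular, the inverse is `0` by
convention; then `ζ_ℓ = 0` too, as if the norm of the inverse were infinite. -/
def zeta (κ δ : ℝ) (Kδ : (l : ℕ) → Matrix (Fin (l + 1)) (Fin (l + 1)) ℝ)
    (y : (l : ℕ) → Fin (l + 1) → ℝ) (l : ℕ) : ℝ :=
  if opNorm (Kδ l)⁻¹ < (opLevel κ δ l)⁻¹ then ((Kδ l)⁻¹ *ᵥ y l) (Fin.last l) else 0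

/-- The estimator of Algorithm II, `∑_{ℓ ≤ L} ζ_ℓ 1{|ζ_ℓ| > S_ℓ} φ_ℓ`, as a function of the
observations `(K_δ^ℓ)_ℓ` and `(y^ℓ)_ℓ`, where `L` is the maximal level. -/
def estimatorII (lam κ τsig τop ε δ : ℝ) (Kδ : (l : ℕ) → Matrix (Fin (l + 1)) (Fin (l + 1)) ℝ)
    (y : (l : ℕ) → Fin (l + 1) → ℝ) (x : ℝ) : ℝ :=
  ∑ l ∈ Finset.range (⌊maxLevel lam ε δ⌋₊ + 1),
    (if signalLevel κ τsig τop ε δ Kδ l < ((|zeta κ δ Kδ y l| : ℝ) : EReal) then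
      zeta κ δ Kδ y l else 0) * laguerreFun l x

/-- The risk `E ‖f̃ - f‖` of Algorithm II, with the norm of `L²(ℝ₊)`, as an extended nonnegative
real. -/
def riskII (lam κ τsig τop ε δ : ℝ) (f g : ℝ → ℝ) {Ω : Type*} [MeasurableSpace Ω] (P : Measure Ω)
    (b : ℕ → Ω → ℝ) (ξ : (l : ℕ) → Ω → EuclideanSpace ℝ (Fin (l + 1))) : ENNReal :=
  ∫⁻ ω, eLpNorm (fun x => estimatorII lam κ τsig τop ε δ (obsOperator g δ b ω)
    (obsSignal g f ε ξ ω) x - f x) 2 halfLine ∂P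

end LaplaceDeconv

end

open LaplaceDeconv

/-! In the Laguerre basis a causal convolution is a lower triangular Toeplitz matrix
(`galerkin_eq_toeplitz`), so operators, inverses and signals become truncated real power series. Let
`A` be the series of the operator, `f` that of the signal, `W` that of the operator noise, and `P =
(A + δW)⁻¹`. The statistic of level `l` is the `l`-th coefficient of `f`, plus the operator error,
which is minus the `l`-th coefficient of `P δW f`, plus `ε` times a linear form in `ξ_l` whose
weights are the coefficients of `P` (`rawEst_eq`). By completeness and Parseval (`hasSum_coeff_sq`)
the squared loss is a sum over levels plus the tail of `f`, so each level is treated alone.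

If the operator error is below a quarter of the threshold `S`, thresholding costs the minimum of
`f_l²` and `S²`, up to a constant, plus a truncated Gaussian moment (`threshold_sq_le`).
Conditionally on `b` the signal error is Gaussian, with variance of order `u²`, where `u = l2 l
A⁻¹`, and the ill-posedness class makes the normalized Hilbert-Schmidt norm in `S` at least of order
`u` (`l2_inv_le_normalized_tzHS`).

The crux is that the operator error must be of order `δ|log δ| u`, without any power of `l`,
although `P` depends on the very noise it multiplies. The error is `-δ ∑ b_k c_k(b)`, with `c_k` the
coefficients of `P f`. In an even moment, one factor is expanded in this way, and `b_k` is replaced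
by `-b_k`, which preserves the law. Only the variation of `c_k` and of the error under a change of
one sign survives: this is a discrete integration by parts. A sign change perturbs `A + δW` by a
monomial, so the variations are explicit by the resolvent identity, and their sums over `k` are
bounded (`sum_incr_sq_le`, `sum_abs_coeff_sub_le`). The moment then controls itself (`moment_le`),
and Markov's inequality at an order proportional to `|log δ|` gives exceptional probabilities of
order `δ ^ 10`. The argument needs a bound for the spectral norm of `W`, obtained by circulant
embedding and a union bound over frequencies (`gaussVec_tzOp_gt`). Its logarithmic factor in `l` is
strong enough to absorb the powers of `l` created where a sign change leaves the truncation set.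

On the exceptional event, acceptance of the noisy inverse gives a crude bound that is polynomial in
the noise (`levelEst_sub_sq_le`), harmless against `δ ^ 10`. What remains is a bias-variance
balance. With `r` the total noise level, all levels up to `r ^ (-1/(s+ν))` are accepted, because `s
> 1/2` (`two_mul_tzOp_lt`), and contribute the variance. The higher ones contribute at most the
bias. Both are of order `r ^ (2s/(s+ν))`. -/

namespace LaplaceDeconv

/-! ### Laguerre functions: derivatives, addition formula, orthonormality. -/

section Laguerre

lemma laguerrePoly_zero (t : ℝ) : laguerrePoly 0 t = 1 := by simp [laguerrePoly]

lemma laguerrePoly_apply_zero (l : ℕ) : laguerrePoly l 0 = 1 := by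
  unfold laguerrePoly
  rw [Finset.sum_eq_single 0]
  · simp
  · intro j _ hj; simp [hj]
  · simp

/-- Pascal's rule. In this form the constant term is absent and differentiating term by term gives
back `-laguerrePoly l`. -/
lemma laguerrePoly_succ_sub (l : ℕ) (t : ℝ) :
    laguerrePoly (l + 1) t - laguerrePoly l t =
      ∑ j ∈ Finset.range (l + 1),
        (-1) ^ (j + 1) * (l.choose j : ℝ) * (t ^ (j + 1) / ((j + 1).factorial : ℝ)) := by
  have h2 : laguerrePoly l t =
      ∑ j ∈ Finset.range (l + 1 + 1), (-1) ^ j * (l.choose j : ℝ) * (t ^ j / (j.factorial : ℝ)) := by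
    rw [Finset.sum_range_succ]; simp [laguerrePoly]
  rw [h2, laguerrePoly, Finset.sum_range_succ', Finset.sum_range_succ' _ (l + 1)]
  simp only [Nat.choose_zero_right, add_sub_add_right_eq_sub]
  rw [← Finset.sum_sub_distrib]
  refine Finset.sum_congr rfl fun j _ => ?_
  rw [Nat.choose_succ_succ]; push_cast; ring

/-- The difference `L_n - L_{n-1}` of consecutive Laguerre polynomials. -/
noncomputable def laguerreDiff : ℕ → ℝ → ℝ
  | 0, _ => 1
  | n + 1, t => laguerrePoly (n + 1) t - laguerrePoly n t

lemma hasDerivAt_laguerreDiff_succ (n : ℕ) (t : ℝ) :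
    HasDerivAt (laguerreDiff (n + 1)) (-laguerrePoly n t) t := by
  have h1 : laguerreDiff (n + 1) = fun t => ∑ j ∈ Finset.range (n + 1),
      (-1) ^ (j + 1) * (n.choose j : ℝ) * (t ^ (j + 1) / ((j + 1).factorial : ℝ)) := by
    funext t; exact laguerrePoly_succ_sub n t
  rw [h1, laguerrePoly, ← Finset.sum_neg_distrib]
  refine HasDerivAt.fun_sum fun j _ => ?_
  have h := (((hasDerivAt_pow (j + 1) t).div_const ((j + 1).factorial : ℝ)).const_mul
    ((-1 : ℝ) ^ (j + 1) * (n.choose j : ℝ)))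
  refine h.congr_deriv ?_
  have : (j.factorial : ℝ) ≠ 0 := by positivity
  rw [Nat.factorial_succ]; push_cast
  field_simp
  ring_nf

lemma laguerreDiff_apply_zero (n : ℕ) : laguerreDiff (n + 1) 0 = 0 := by
  simp [laguerreDiff, laguerrePoly_apply_zero]

lemma sum_laguerreDiff (n : ℕ) (t : ℝ) :
    ∑ k ∈ Finset.range (n + 1), laguerreDiff k t = laguerrePoly n t := by
  induction n with
  | zero => simp [laguerreDiff, laguerrePoly_zero]
  | succ n ih => rw [Finset.sum_range_succ, ih]; simp [laguerreDiff]

lemma hasDerivAt_laguerrePoly (n : ℕ) (t : ℝ) :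
    HasDerivAt (laguerrePoly n) (-∑ k ∈ Finset.range n, laguerrePoly k t) t := by
  induction n with
  | zero =>
    have : laguerrePoly 0 = fun _ => (1 : ℝ) := by funext t; simp [laguerrePoly_zero]
    rw [this]; simpa using hasDerivAt_const t (1 : ℝ)
  | succ n ih =>
    have h : laguerrePoly (n + 1) = fun t => laguerrePoly n t + laguerreDiff (n + 1) t := by
      funext t; simp [laguerreDiff]
    rw [h, Finset.sum_range_succ, neg_add]
    exact ih.add (hasDerivAt_laguerreDiff_succ n t)

lemma hasDerivAt_laguerreDiff (n : ℕ) (t : ℝ) :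
    HasDerivAt (laguerreDiff n) (-∑ k ∈ Finset.range n, laguerreDiff k t) t := by
  cases n with
  | zero =>
    have : laguerreDiff 0 = fun _ => (1 : ℝ) := by funext t; rfl
    rw [this]; simpa using hasDerivAt_const t (1 : ℝ)
  | succ n => rw [sum_laguerreDiff]; exact hasDerivAt_laguerreDiff_succ n t

/-- The addition formula for Laguerre polynomials. -/
lemma laguerrePoly_add (n : ℕ) (x y : ℝ) :
    laguerrePoly n (x + y) =
      ∑ m ∈ Finset.range (n + 1), laguerrePoly m x * laguerreDiff (n - m) y := by
  induction n using Nat.strong_induction_on generalizing y with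
  | _ n ih =>
  -- By the induction hypothesis both sides have the same derivative in `y`, and they agree at `y =
  -- 0`.
  set B : ℝ → ℝ := fun y => ∑ m ∈ Finset.range (n + 1), laguerrePoly m x * laguerreDiff (n - m) y
  have hA : ∀ y, HasDerivAt (fun y => laguerrePoly n (x + y))
      (-∑ k ∈ Finset.range n, laguerrePoly k (x + y)) y := fun y =>
    HasDerivAt.comp_const_add x y (hasDerivAt_laguerrePoly n (x + y))
  have hB : ∀ y, HasDerivAt B (-∑ k ∈ Finset.range n, laguerrePoly k (x + y)) y := fun y => by
    have h : HasDerivAt B (∑ m ∈ Finset.range (n + 1),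
        laguerrePoly m x * (-∑ k ∈ Finset.range (n - m), laguerreDiff k y)) y :=
      HasDerivAt.fun_sum fun m _ => (hasDerivAt_laguerreDiff (n - m) y).const_mul _
    refine h.congr_deriv ?_
    rw [Finset.sum_congr rfl fun k hk => ih k (Finset.mem_range.1 hk) y, Finset.sum_range_succ]
    simp only [mul_neg, Finset.sum_neg_distrib, Nat.sub_self, Finset.range_zero, Finset.sum_empty,
      neg_zero, add_zero, neg_inj, mul_zero]
    simp_rw [Finset.mul_sum]
    rw [Finset.sum_sigma', Finset.sum_sigma']
    refine Finset.sum_bij' (fun p _ => ⟨p.1 + p.2, p.1⟩) (fun p _ => ⟨p.2, p.1 - p.2⟩) ?_ ?_ ?_ ?_ ?_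
    · simp only [Finset.mem_sigma, Finset.mem_range]; intro p hp; omega
    · simp only [Finset.mem_sigma, Finset.mem_range]; intro p hp; omega
    · rintro ⟨p, q⟩ hp; simp
    · rintro ⟨p, q⟩ hp
      simp only [Finset.mem_sigma, Finset.mem_range] at hp
      simp only [Sigma.mk.injEq, heq_eq_eq, and_true]; omega
    · rintro ⟨p, q⟩ hp; simp
  have h0 : laguerrePoly n (x + 0) = B 0 := by
    simp only [B, add_zero]
    rw [Finset.sum_range_succ, Finset.sum_eq_zero]
    · simp [laguerreDiff]
    · intro m hm
      obtain ⟨k, hk⟩ : ∃ k, n - m = k + 1 := ⟨n - m - 1, by have := Finset.mem_range.1 hm; omega⟩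
      rw [hk, laguerreDiff_apply_zero, mul_zero]
  have hd : ∀ y, HasDerivAt (fun y => laguerrePoly n (x + y) - B y) 0 y := fun y => by
    simpa using (hA y).fun_sub (hB y)
  have hc := is_const_of_deriv_eq_zero (fun y => (hd y).differentiableAt) (fun y => (hd y).deriv) y 0
  linarith

lemma continuous_laguerrePoly (l : ℕ) : Continuous (laguerrePoly l) := by
  unfold laguerrePoly; fun_prop

lemma continuous_laguerreFun (l : ℕ) : Continuous (laguerreFun l) := by
  have := continuous_laguerrePoly l
  unfold laguerreFun; fun_prop

/-- Bound each `t ^ j / j!` by `c⁻¹ ^ j * exp (c t)` and sum with the binomial theorem. Any growth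
rate `c > 0` is allowed, so half of the decay of `φ_l` can be kept. -/
lemma abs_laguerrePoly_le (l : ℕ) {t c : ℝ} (ht : 0 ≤ t) (hc : 0 < c) :
    |laguerrePoly l t| ≤ (1 + c⁻¹) ^ l * Real.exp (c * t) := by
  unfold laguerrePoly
  refine (Finset.abs_sum_le_sum_abs _ _).trans ?_
  rw [add_comm (1 : ℝ), add_pow, Finset.sum_mul]
  refine Finset.sum_le_sum fun j _ => ?_
  have h := Real.pow_div_factorial_le_exp (c * t) (by positivity) j
  rw [abs_mul, abs_mul, abs_pow, abs_neg, abs_one, one_pow, one_mul, one_pow, mul_one, Nat.abs_cast,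
    abs_of_nonneg (by positivity)]
  have h2 : t ^ j / (j.factorial : ℝ) = c⁻¹ ^ j * ((c * t) ^ j / (j.factorial : ℝ)) := by
    rw [mul_pow, inv_pow]; field_simp
  rw [h2]
  calc (l.choose j : ℝ) * (c⁻¹ ^ j * ((c * t) ^ j / (j.factorial : ℝ)))
      ≤ (l.choose j : ℝ) * (c⁻¹ ^ j * Real.exp (c * t)) := by gcongr
    _ = _ := by ring

lemma abs_laguerreFun_le (l : ℕ) {t : ℝ} (ht : 0 ≤ t) :
    |laguerreFun l t| ≤ 5 ^ l * Real.exp (-t / 4) := by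
  have h := abs_laguerrePoly_le l ht (c := 1 / 4) (by norm_num)
  rw [laguerreFun, abs_mul, abs_of_pos (Real.exp_pos _)]
  calc Real.exp (-t / 2) * |laguerrePoly l t|
      ≤ Real.exp (-t / 2) * ((1 + (1 / 4)⁻¹) ^ l * Real.exp (1 / 4 * t)) := by gcongr
    _ = (1 + (1 / 4)⁻¹) ^ l * (Real.exp (-t / 2) * Real.exp (1 / 4 * t)) := by ring
    _ = _ := by rw [← Real.exp_add]; norm_num; ring_nf

lemma integrableOn_exp_neg_mul {c : ℝ} (hc : 0 < c) :
    Integrable (fun t => Real.exp (-c * t)) halfLine :=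
  (exp_neg_integrableOn_Ioi 0 hc)

lemma integrable_laguerreFun_mul (i j : ℕ) :
    Integrable (fun t => laguerreFun i t * laguerreFun j t) halfLine := by
  refine Integrable.mono' ((integrableOn_exp_neg_mul (c := 1 / 2) (by norm_num)).const_mul
    (5 ^ i * 5 ^ j)) ?_ ?_
  · exact ((continuous_laguerreFun i).mul (continuous_laguerreFun j)).aestronglyMeasurable
  · refine (ae_restrict_iff' measurableSet_Ioi).2 (Filter.Eventually.of_forall fun t ht => ?_)
    have ht' : (0 : ℝ) ≤ t := le_of_lt ht
    rw [Real.norm_eq_abs, abs_mul]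
    calc _ ≤ (5 ^ i * Real.exp (-t / 4)) * (5 ^ j * Real.exp (-t / 4)) :=
          mul_le_mul (abs_laguerreFun_le i ht') (abs_laguerreFun_le j ht') (abs_nonneg _)
            (by positivity)
      _ = 5 ^ i * 5 ^ j * (Real.exp (-t / 4) * Real.exp (-t / 4)) := by ring
      _ = _ := by rw [← Real.exp_add]; ring_nf

lemma laguerreFun_mul (i j : ℕ) (t : ℝ) :
    laguerreFun i t * laguerreFun j t = Real.exp (-t) * (laguerrePoly i t * laguerrePoly j t) := by
  unfold laguerreFun
  rw [show -t = -t / 2 + -t / 2 by ring, Real.exp_add]; ring_nf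

lemma tendsto_laguerreFun_mul (i j : ℕ) :
    Filter.Tendsto (fun t => laguerreFun i t * laguerreFun j t) Filter.atTop (nhds 0) := by
  have h : Filter.Tendsto (fun t : ℝ => (5 : ℝ) ^ i * 5 ^ j * Real.exp (-(1 / 2 * t)))
      Filter.atTop (nhds 0) := by
    have := (Real.tendsto_exp_neg_atTop_nhds_zero.comp
      (Filter.tendsto_id.const_mul_atTop (show (0 : ℝ) < 1 / 2 by norm_num))).const_mul
      ((5 : ℝ) ^ i * 5 ^ j)
    simpa using this
  refine squeeze_zero_norm' ?_ h
  filter_upwards [Filter.eventually_ge_atTop 0] with t ht'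
  rw [Real.norm_eq_abs, abs_mul]
  calc _ ≤ (5 ^ i * Real.exp (-t / 4)) * (5 ^ j * Real.exp (-t / 4)) :=
        mul_le_mul (abs_laguerreFun_le i ht') (abs_laguerreFun_le j ht') (abs_nonneg _)
          (by positivity)
    _ = 5 ^ i * 5 ^ j * (Real.exp (-t / 4) * Real.exp (-t / 4)) := by ring
    _ = _ := by rw [← Real.exp_add]; ring_nf

/-- The difference of the integrands is, up to sign, the derivative of `exp (-t)` times the product
of the two `laguerreDiff`, which vanishes at `0` and at infinity. -/
lemma integral_laguerreFun_succ_succ (i j : ℕ) :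
    ∫ t, laguerreFun (i + 1) t * laguerreFun (j + 1) t ∂halfLine =
      ∫ t, laguerreFun i t * laguerreFun j t ∂halfLine := by
  set F : ℝ → ℝ := fun t => Real.exp (-t) * (laguerreDiff (i + 1) t * laguerreDiff (j + 1) t)
  have hF : ∀ t, HasDerivAt F (laguerreFun i t * laguerreFun j t -
      laguerreFun (i + 1) t * laguerreFun (j + 1) t) t := fun t => by
    have h := ((Real.hasDerivAt_exp (-t)).comp t (hasDerivAt_neg t)).mul
      ((hasDerivAt_laguerreDiff_succ i t).mul (hasDerivAt_laguerreDiff_succ j t))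
    refine h.congr_deriv ?_
    simp only [laguerreFun_mul, laguerreDiff, Function.comp, Pi.mul_apply]
    ring
  have hlim : Filter.Tendsto F Filter.atTop (nhds 0) := by
    have h := (((tendsto_laguerreFun_mul (i + 1) (j + 1)).sub (tendsto_laguerreFun_mul i (j + 1))).sub
      (tendsto_laguerreFun_mul (i + 1) j)).add (tendsto_laguerreFun_mul i j)
    simp only [sub_zero, add_zero] at h
    refine h.congr fun t => ?_
    simp only [laguerreFun_mul, laguerreDiff, F]; ring
  have hint := (integrable_laguerreFun_mul i j).sub (integrable_laguerreFun_mul (i + 1) (j + 1))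
  have key := integral_Ioi_of_hasDerivAt_of_tendsto (a := 0) (hF 0).continuousAt.continuousWithinAt
    (fun t _ => hF t) hint hlim
  have h0 : F 0 = 0 := by simp [F, laguerreDiff_apply_zero]
  rw [h0, sub_zero] at key
  have := integral_sub (integrable_laguerreFun_mul i j) (integrable_laguerreFun_mul (i + 1) (j + 1))
  rw [halfLine] at this ⊢
  linarith

lemma integral_laguerreFun_succ_zero (i : ℕ) :
    ∫ t, laguerreFun (i + 1) t * laguerreFun 0 t ∂halfLine = 0 := by
  set F : ℝ → ℝ := fun t => -(Real.exp (-t) * laguerreDiff (i + 1) t)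
  have hF : ∀ t, HasDerivAt F (laguerreFun (i + 1) t * laguerreFun 0 t) t := fun t => by
    have h := (((Real.hasDerivAt_exp (-t)).comp t (hasDerivAt_neg t)).mul
      (hasDerivAt_laguerreDiff_succ i t)).neg
    refine h.congr_deriv ?_
    simp only [laguerreFun_mul, laguerreDiff, Function.comp, laguerrePoly_zero]
    ring
  have hlim : Filter.Tendsto F Filter.atTop (nhds 0) := by
    have h := (tendsto_laguerreFun_mul i 0).sub (tendsto_laguerreFun_mul (i + 1) 0)
    simp only [sub_zero] at h
    refine h.congr fun t => ?_
    simp only [laguerreFun_mul, laguerreDiff, F, laguerrePoly_zero]; ring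
  have key := integral_Ioi_of_hasDerivAt_of_tendsto (a := 0) (hF 0).continuousAt.continuousWithinAt
    (fun t _ => hF t) (integrable_laguerreFun_mul (i + 1) 0) hlim
  have h0 : F 0 = 0 := by simp [F, laguerreDiff_apply_zero]
  rw [h0, sub_zero] at key
  exact key

/-- The Laguerre functions are orthonormal in `L²(ℝ₊)`. -/
lemma integral_laguerreFun_mul (i j : ℕ) :
    ∫ t, laguerreFun i t * laguerreFun j t ∂halfLine = if i = j then 1 else 0 := by
  induction i generalizing j with
  | zero =>
    cases j with
    | zero =>
      simp only [laguerreFun_mul, laguerrePoly_zero, mul_one, if_true]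
      rw [halfLine]; simpa using integral_exp_neg_Ioi_zero
    | succ j =>
      simp_rw [mul_comm (laguerreFun 0 _)]
      rw [integral_laguerreFun_succ_zero]; simp
  | succ i ih =>
    cases j with
    | zero => rw [integral_laguerreFun_succ_zero]; simp
    | succ j => rw [integral_laguerreFun_succ_succ, ih]; simp

lemma memLp_laguerreFun (l : ℕ) : MemLp (laguerreFun l) 2 halfLine := by
  rw [memLp_two_iff_integrable_sq (continuous_laguerreFun l).aestronglyMeasurable]
  simpa [sq] using integrable_laguerreFun_mul l l

end Laguerre

/-! ### The Galerkin matrix of a convolution is lower triangular Toeplitz. -/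

section Galerkin

lemma ae_halfLine_of_pos {p : ℝ → Prop} (h : ∀ t, 0 < t → p t) : ∀ᵐ t ∂halfLine, p t :=
  (ae_restrict_iff' measurableSet_Ioi).2 (Filter.Eventually.of_forall fun t ht => h t ht)

instance : SFinite halfLine := by unfold halfLine; infer_instance

instance : IsLocallyFiniteMeasure halfLine := by unfold halfLine; infer_instance

lemma integrable_mul_laguerreFun {h : ℝ → ℝ} (hh : MemLp h 2 halfLine) (l : ℕ) :
    Integrable (fun t => h t * laguerreFun l t) halfLine :=
  hh.integrable_mul (memLp_laguerreFun l)

lemma memLp_exp_neg {c : ℝ} (hc : 0 < c) : MemLp (fun t => Real.exp (-c * t)) 2 halfLine := by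
  rw [memLp_two_iff_integrable_sq (by fun_prop)]
  refine (integrableOn_exp_neg_mul (c := 2 * c) (by positivity)).congr (ae_of_all _ fun t => ?_)
  simp only []
  rw [← Real.exp_nat_mul]; push_cast; ring_nf

/-- `φ_n - φ_{n-1}`. -/
lemma exp_mul_laguerreDiff_succ (n : ℕ) (t : ℝ) : Real.exp (-t / 2) * laguerreDiff (n + 1) t =
    laguerreFun (n + 1) t - laguerreFun n t := by
  simp only [laguerreFun, laguerreDiff]; ring

lemma integral_mul_exp_laguerreDiff {g : ℝ → ℝ} (hg : MemLp g 2 halfLine) (n : ℕ) :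
    ∫ t, g t * (Real.exp (-t / 2) * laguerreDiff n t) ∂halfLine = dotCoeff g n := by
  cases n with
  | zero => simp only [dotCoeff, coeff, laguerreFun, laguerreDiff, laguerrePoly_zero]
  | succ n =>
    simp_rw [exp_mul_laguerreDiff_succ, mul_sub]
    rw [integral_sub (integrable_mul_laguerreFun hg _) (integrable_mul_laguerreFun hg _)]
    rfl

lemma laguerreFun_add (i : ℕ) (u τ : ℝ) : laguerreFun i (u + τ) =
    ∑ m ∈ Finset.range (i + 1), laguerreFun m u * (Real.exp (-τ / 2) * laguerreDiff (i - m) τ) := by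
  unfold laguerreFun
  rw [laguerrePoly_add, Finset.mul_sum]
  refine Finset.sum_congr rfl fun m _ => ?_
  rw [show -(u + τ) / 2 = -u / 2 + -τ / 2 by ring, Real.exp_add]; ring

/-- The addition formula expands the shifted function in the `φ_m`, and orthonormality selects `m =
j`. The dependence on `i - j` alone is the Toeplitz structure. -/
lemma integral_laguerreFun_mul_shift (i j : ℕ) (τ : ℝ) :
    ∫ u, laguerreFun j u * laguerreFun i (u + τ) ∂halfLine =
      if j ≤ i then Real.exp (-τ / 2) * laguerreDiff (i - j) τ else 0 := by
  simp_rw [laguerreFun_add, Finset.mul_sum, ← mul_assoc]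
  rw [integral_finsetSum]
  · simp_rw [mul_assoc, ← mul_assoc (laguerreFun j _), integral_mul_const, integral_laguerreFun_mul]
    simp only [ite_mul, one_mul, zero_mul, Finset.sum_ite_eq, Finset.mem_range, Nat.lt_succ_iff]
  · intro m _
    exact ((integrable_laguerreFun_mul j m).mul_const _).mul_const _

/-- The Galerkin matrix of the Laplace convolution is Toeplitz in the Laguerre basis. -/
lemma galerkin_eq_toeplitz {g : ℝ → ℝ} (hg : MemLp g 2 halfLine) (l : ℕ) :
    galerkin g l = toeplitz (dotCoeff g) l := by
  ext i j
  simp only [galerkin, toeplitz, Matrix.of_apply]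
  generalize (i : ℕ) = i
  generalize (j : ℕ) = j
  -- The causal constraint `τ < t` is put into an indicator, so that Fubini applies on the whole
  -- quadrant and the inner integral becomes a shift.
  set F : ℝ → ℝ → ℝ := fun t τ =>
    (Set.Ioi τ).indicator (fun t => laguerreFun j (t - τ)) t * g τ * laguerreFun i t with hF
  have hmeas : AEStronglyMeasurable (Function.uncurry F) (halfLine.prod halfLine) := by
    have h1 : Measurable fun p : ℝ × ℝ =>
        (Set.Ioi p.2).indicator (fun t => laguerreFun j (t - p.2)) p.1 := by
      have : (fun p : ℝ × ℝ => (Set.Ioi p.2).indicator (fun t => laguerreFun j (t - p.2)) p.1) =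
          {p : ℝ × ℝ | p.2 < p.1}.indicator (fun p => laguerreFun j (p.1 - p.2)) := by
        funext p; simp [Set.indicator]
      rw [this]
      refine Measurable.indicator ?_ (measurableSet_lt measurable_snd measurable_fst)
      have := continuous_laguerreFun j
      exact (by fun_prop : Continuous fun p : ℝ × ℝ => laguerreFun j (p.1 - p.2)).measurable
    have h2 : AEStronglyMeasurable (fun p : ℝ × ℝ => g p.2) (halfLine.prod halfLine) :=
      hg.1.comp_snd
    have h3 : Measurable fun p : ℝ × ℝ => laguerreFun i p.1 :=
      (continuous_laguerreFun i).measurable.comp measurable_fst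
    exact (h1.aestronglyMeasurable.mul h2).mul h3.aestronglyMeasurable
  have hint : Integrable (Function.uncurry F) (halfLine.prod halfLine) := by
    have hb1 : Integrable (fun t => (5 : ℝ) ^ j * 5 ^ i * Real.exp (-(1 / 8) * t)) halfLine :=
      (integrableOn_exp_neg_mul (by norm_num)).const_mul _
    have hb2 : Integrable (fun τ => |g τ| * Real.exp (-(1 / 8) * τ)) halfLine :=
      (hg.norm.integrable_mul (memLp_exp_neg (c := 1 / 8) (by norm_num)))
    refine Integrable.mono' (hb1.mul_prod hb2) hmeas ?_
    have hpos : ∀ᵐ p ∂(halfLine.prod halfLine), 0 < p.1 ∧ 0 < p.2 := by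
      rw [halfLine, Measure.prod_restrict]
      exact (ae_restrict_iff' (measurableSet_Ioi.prod measurableSet_Ioi)).2
        (Filter.Eventually.of_forall fun p hp => hp)
    filter_upwards [hpos] with p hp
    obtain ⟨t, τ⟩ := p
    obtain ⟨ht, hτ⟩ := hp
    simp only [Function.uncurry, hF, Real.norm_eq_abs, Set.indicator, Set.mem_Ioi] at *
    split_ifs with h
    · rw [abs_mul, abs_mul]
      have e1 := abs_laguerreFun_le j (sub_nonneg.2 h.le)
      have e2 := abs_laguerreFun_le i ht.le
      -- Because `τ < t`, part of the decay in `t` can be transferred to `τ`. The function `g`, only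
      -- square integrable, needs a decaying factor to be integrable.
      have e3 : Real.exp (-(t - τ) / 4) * Real.exp (-t / 4) ≤
          Real.exp (-(1 / 8) * t) * Real.exp (-(1 / 8) * τ) := by
        rw [← Real.exp_add, ← Real.exp_add]; apply Real.exp_le_exp.2; linarith
      calc |laguerreFun j (t - τ)| * |g τ| * |laguerreFun i t|
          ≤ (5 ^ j * Real.exp (-(t - τ) / 4)) * |g τ| * (5 ^ i * Real.exp (-t / 4)) := by gcongr
        _ = 5 ^ j * 5 ^ i * |g τ| * (Real.exp (-(t - τ) / 4) * Real.exp (-t / 4)) := by ring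
        _ ≤ 5 ^ j * 5 ^ i * |g τ| * (Real.exp (-(1 / 8) * t) * Real.exp (-(1 / 8) * τ)) := by gcongr
        _ = _ := by ring
    · simp only [zero_mul, abs_zero]; positivity
  have hL : coeff (convOp g (laguerreFun j)) i = ∫ t, ∫ τ, F t τ ∂halfLine ∂halfLine := by
    rw [coeff]
    refine integral_congr_ae (ae_halfLine_of_pos fun t ht => ?_)
    simp only [hF, convOp]
    rw [integral_mul_const, intervalIntegral.integral_of_le ht.le, integral_Ioc_eq_integral_Ioo]
    congr 1
    rw [halfLine, ← integral_indicator measurableSet_Ioo, ← integral_indicator measurableSet_Ioi]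
    refine integral_congr_ae (ae_of_all _ fun τ => ?_)
    simp only [Set.indicator, Set.mem_Ioo, Set.mem_Ioi]
    by_cases h1 : 0 < τ <;> by_cases h2 : τ < t <;> simp [h1, h2]
  have hR : ∀ τ, 0 < τ → ∫ t, F t τ ∂halfLine =
      g τ * (if j ≤ i then Real.exp (-τ / 2) * laguerreDiff (i - j) τ else 0) := fun τ hτ => by
    rw [← integral_laguerreFun_mul_shift, halfLine, ← integral_indicator measurableSet_Ioi,
      ← integral_indicator measurableSet_Ioi, ← integral_const_mul,
      ← integral_add_right_eq_self _ τ]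
    refine integral_congr_ae (ae_of_all _ fun u => ?_)
    simp only [Set.indicator, Set.mem_Ioi, hF, add_sub_cancel_right, lt_add_iff_pos_left]
    by_cases h1 : 0 < u
    · simp only [h1, if_true, show 0 < u + τ by linarith]; ring
    · simp [h1]
  rw [hL, integral_integral_swap hint, integral_congr_ae (ae_halfLine_of_pos hR)]
  split_ifs with hij
  · exact integral_mul_exp_laguerreDiff hg _
  · simp

end Galerkin

/-! ### Completeness of the Laguerre functions. -/

section Completeness

lemma memLp_exp_neg_mul_pow {c : ℝ} (hc : 0 < c) (k : ℕ) :
    MemLp (fun t => Real.exp (-c * t) * t ^ k) 2 halfLine := by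
  refine MemLp.mono ((memLp_exp_neg (c := c / 2) (by positivity)).const_mul
    ((2 / c) ^ k * k.factorial)) (by fun_prop) (ae_halfLine_of_pos fun t ht => ?_)
  have h := Real.pow_div_factorial_le_exp (c / 2 * t) (by positivity) k
  rw [Real.norm_of_nonneg (by positivity), Real.norm_of_nonneg (by positivity)]
  have h1 : t ^ k = (2 / c) ^ k * k.factorial * ((c / 2 * t) ^ k / k.factorial) := by
    have : (k.factorial : ℝ) ≠ 0 := by positivity
    field_simp
    rw [← mul_pow]; field_simp
  calc Real.exp (-c * t) * t ^ k
      = (2 / c) ^ k * k.factorial * (Real.exp (-c * t) * ((c / 2 * t) ^ k / k.factorial)) := by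
        rw [h1]; ring
    _ ≤ (2 / c) ^ k * k.factorial * (Real.exp (-c * t) * Real.exp (c / 2 * t)) := by gcongr
    _ = _ := by rw [← Real.exp_add]; ring_nf

/-- Triangularity: the leading coefficient of the `k`-th Laguerre polynomial is not zero, and the
lower powers are handled by induction. -/
lemma integral_exp_mul_pow_eq_zero {h : ℝ → ℝ} (hh : MemLp h 2 halfLine)
    (h0 : ∀ l, coeff h l = 0) (k : ℕ) :
    ∫ t, h t * (Real.exp (-(1 / 2) * t) * t ^ k) ∂halfLine = 0 := by
  induction k using Nat.strong_induction_on with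
  | _ k ih =>
  have hint : ∀ j, Integrable (fun t => h t * (Real.exp (-(1 / 2) * t) * t ^ j)) halfLine :=
    fun j => hh.integrable_mul (memLp_exp_neg_mul_pow (by norm_num) j)
  set c : ℕ → ℝ := fun j => (-1) ^ j * (k.choose j : ℝ) / (j.factorial : ℝ) with hc
  have e : ∀ t, h t * laguerreFun k t =
      ∑ j ∈ Finset.range (k + 1), c j * (h t * (Real.exp (-(1 / 2) * t) * t ^ j)) := fun t => by
    rw [laguerreFun, laguerrePoly, Finset.mul_sum, Finset.mul_sum]
    refine Finset.sum_congr rfl fun j _ => ?_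
    rw [show -t / 2 = -(1 / 2) * t by ring]; simp only [hc]; ring
  have h1 := h0 k
  rw [coeff, integral_congr_ae (ae_of_all _ e), integral_finsetSum _
    (fun j _ => (hint j).const_mul _), Finset.sum_range_succ, Finset.sum_eq_zero, zero_add,
    integral_const_mul] at h1
  · refine (mul_eq_zero.1 h1).resolve_left ?_
    simp only [hc, Nat.choose_self]
    positivity
  · intro j hj
    rw [integral_const_mul, ih j (Finset.mem_range.1 hj), mul_zero]

/-- Each further factor `exp (-t/8)` is expanded in its Taylor series and integrated term by term.
The rate `1/8` is small enough for the series of absolute values, which sums to `exp (t/8)`, to be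
dominated by the factor `exp (-c t)` with `c ≥ 1/2`. -/
lemma integral_exp_shift_mul_pow_eq_zero {h : ℝ → ℝ} (hh : MemLp h 2 halfLine)
    (h0 : ∀ l, coeff h l = 0) (n k : ℕ) :
    ∫ t, h t * (Real.exp (-(1 / 2 + n / 8) * t) * t ^ k) ∂halfLine = 0 := by
  induction n generalizing k with
  | zero => simpa using integral_exp_mul_pow_eq_zero hh h0 k
  | succ n ih =>
    set c : ℝ := 1 / 2 + n / 8 with hc
    have hcpos : 1 / 2 ≤ c := by rw [hc]; have : (0 : ℝ) ≤ n / 8 := by positivity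
                                 linarith
    have hsum : ∀ x : ℝ, HasSum (fun j : ℕ => x ^ j / (j.factorial : ℝ)) (Real.exp x) := fun x => by
      rw [Real.exp_eq_exp_ℝ]; exact NormedSpace.expSeries_div_hasSum_exp x
    set F : ℕ → ℝ → ℝ := fun j t =>
      (-(1 / 8)) ^ j / (j.factorial : ℝ) * (h t * (Real.exp (-c * t) * t ^ (k + j)))
    have key := hasSum_integral_of_dominated_convergence (μ := halfLine) (F := F)
      (f := fun t => h t * (Real.exp (-(1 / 2 + (n + 1 : ℕ) / 8) * t) * t ^ k))
      (fun j t => |h t| * (Real.exp (-c * t) * t ^ k) * ((t / 8) ^ j / (j.factorial : ℝ)))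
      (fun j => ?_) (fun j => ?_) ?_ ?_ ?_
    · have hz : ∀ j, ∫ t, F j t ∂halfLine = 0 := fun j => by
        simp only [F]; rw [integral_const_mul, ih, mul_zero]
      simp only [hz] at key
      exact key.unique hasSum_zero
    · exact ((hh.1.mul (by fun_prop : Continuous fun t : ℝ =>
        Real.exp (-c * t) * t ^ (k + j)).aestronglyMeasurable).const_mul _)
    · refine ae_halfLine_of_pos fun t ht => le_of_eq ?_
      simp only [F, norm_mul, norm_div, norm_pow, norm_neg, Real.norm_eq_abs]
      rw [abs_of_pos (Real.exp_pos _), abs_of_pos ht, Nat.abs_cast, pow_add, abs_one,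
        abs_of_pos (show (0 : ℝ) < 8 by norm_num), div_pow, div_pow]
      ring
    · refine ae_halfLine_of_pos fun t ht => ?_
      exact ((hsum (t / 8)).mul_left _).summable
    · have hi : Integrable (fun t => |h t| * (Real.exp (-(c - 1 / 8) * t) * t ^ k)) halfLine :=
        hh.norm.integrable_mul (memLp_exp_neg_mul_pow (by linarith) k)
      refine hi.congr (ae_halfLine_of_pos fun t ht => ?_)
      simp only []
      rw [((hsum (t / 8)).mul_left _).tsum_eq,
        show -(c - 1 / 8) * t = -c * t + t / 8 by ring, Real.exp_add]
      ring
    · refine ae_halfLine_of_pos fun t ht => ?_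
      have := (hsum (-(1 / 8) * t)).mul_left (h t * (Real.exp (-c * t) * t ^ k))
      have e1 : (fun j => F j t) =
          fun j => h t * (Real.exp (-c * t) * t ^ k) * ((-(1 / 8) * t) ^ j / j.factorial) := by
        funext j; simp only [F, pow_add, mul_pow]; ring
      have e2 : h t * (Real.exp (-(1 / 2 + ((n + 1 : ℕ) : ℝ) / 8) * t) * t ^ k) =
          h t * (Real.exp (-c * t) * t ^ k) * Real.exp (-(1 / 8) * t) := by
        rw [show -(1 / 2 + ((n + 1 : ℕ) : ℝ) / 8) * t = -c * t + -(1 / 8) * t by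
          rw [hc]; push_cast; ring, Real.exp_add]
        ring
      rw [e1, e2]; exact this

/-- The Laguerre functions are complete in `L²(ℝ₊)`. -/
lemma ae_eq_zero_of_coeff_eq_zero {h : ℝ → ℝ} (hh : MemLp h 2 halfLine)
    (h0 : ∀ l, coeff h l = 0) : h =ᵐ[halfLine] 0 := by
  have hw : Integrable (fun t => h t * Real.exp (-(1 / 2) * t)) halfLine :=
    hh.integrable_mul (memLp_exp_neg (by norm_num))
  have hpoly : ∀ p : Polynomial ℝ,
      Integrable (fun t => h t * Real.exp (-(1 / 2) * t) * p.eval (Real.exp (-(1 / 8) * t))) halfLine ∧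
      ∫ t, h t * Real.exp (-(1 / 2) * t) * p.eval (Real.exp (-(1 / 8) * t)) ∂halfLine = 0 := by
    intro p
    induction p using Polynomial.induction_on' with
    | add p q hp hq =>
      simp only [Polynomial.eval_add, mul_add]
      exact ⟨hp.1.add hq.1, by rw [integral_add hp.1 hq.1, hp.2, hq.2, add_zero]⟩
    | monomial n a =>
      have e : ∀ t, h t * Real.exp (-(1 / 2) * t) * (Polynomial.monomial n a).eval
          (Real.exp (-(1 / 8) * t)) = a * (h t * (Real.exp (-(1 / 2 + n / 8) * t) * t ^ 0)) :=
        fun t => by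
          rw [Polynomial.eval_monomial, ← Real.exp_nat_mul, pow_zero, mul_one,
            show -(1 / 2 + (n : ℝ) / 8) * t = -(1 / 2) * t + n * (-(1 / 8) * t) by ring,
            Real.exp_add]
          ring
      simp only [e]
      refine ⟨(hh.integrable_mul (memLp_exp_neg_mul_pow (by positivity) 0)).const_mul a, ?_⟩
      rw [integral_const_mul, integral_exp_shift_mul_pow_eq_zero hh h0, mul_zero]
  have hloc : LocallyIntegrableOn h (Set.Ioi 0) volume := by
    refine locallyIntegrableOn_of_locallyIntegrable_restrict ?_
    exact hh.locallyIntegrable (by norm_num)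
  have := isOpen_Ioi.ae_eq_zero_of_integral_contDiff_smul_eq_zero hloc ?_
  · exact (ae_restrict_iff' measurableSet_Ioi).2 this
  intro g hg hgs hgt
  have hg0 : g 0 = 0 := image_eq_zero_of_notMem_tsupport fun h => lt_irrefl (0 : ℝ) (hgt h)
  set G : ℝ → ℝ := fun t => g t * Real.exp (1 / 2 * t)
  have hGc : Continuous G := by have := hg.continuous; fun_prop
  -- The substitution `x = exp (-t/8)` turns polynomials in `exp (-t/8)` into polynomials on `[0,
  -- 1]`, where Weierstrass applies. Continuity at `0` holds since `G` has compact support; the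
  -- value there is also zero, because `Real.log 0 = 0` and `g 0 = 0`.
  set ψ : ℝ → ℝ := fun x => G (-8 * Real.log x)
  have hψ : Continuous ψ := by
    rw [continuous_iff_continuousAt]
    intro x
    by_cases hx : x = 0
    · subst hx
      rw [continuousAt_iff_punctured_nhds]
      have h1 : Filter.Tendsto (fun x : ℝ => -8 * Real.log x) (nhdsWithin 0 {0}ᶜ) Filter.atTop :=
        Real.tendsto_log_nhdsNE_zero.const_mul_atBot_of_neg (by norm_num)
      have h2 : ∀ᶠ t in Filter.atTop, G t = 0 := by
        have : ∀ᶠ t in Filter.cocompact ℝ, g t = 0 := by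
          have := hgs.compl_mem_cocompact
          filter_upwards [this] with t ht using image_eq_zero_of_notMem_tsupport ht
        filter_upwards [atTop_le_cocompact this] with t ht
        simp [G, ht]
      have h3 : ψ 0 = 0 := by simp [ψ, G, hg0]
      rw [h3]
      exact tendsto_const_nhds.congr' ((h1.eventually h2).mono fun x hx => hx.symm)
    · exact ContinuousAt.comp (f := fun x => -8 * Real.log x) hGc.continuousAt
        (continuousAt_const.mul (Real.continuousAt_log hx))
  have hgψ : ∀ t, g t * h t = h t * Real.exp (-(1 / 2) * t) * ψ (Real.exp (-(1 / 8) * t)) :=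
    fun t => by
      simp only [ψ, G, Real.log_exp]
      rw [show -8 * (-(1 / 8) * t) = t by ring,
        show g t * h t = h t * (Real.exp (-(1 / 2) * t) * Real.exp (1 / 2 * t)) * g t by
          rw [← Real.exp_add]; ring_nf; simp]
      ring
  have hset : ∫ t, g t • h t = ∫ t, g t * h t ∂halfLine := by
    rw [halfLine, setIntegral_eq_integral_of_forall_compl_eq_zero]
    · rfl
    · intro t ht
      rw [image_eq_zero_of_notMem_tsupport fun h => ht (hgt h), zero_mul]
  rw [hset]
  set I := ∫ t, |h t * Real.exp (-(1 / 2) * t)| ∂halfLine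
  have hI : 0 ≤ I := integral_nonneg fun t => abs_nonneg _
  refine abs_eq_zero.1 (le_antisymm (le_of_forall_pos_le_add fun η hη => ?_) (abs_nonneg _))
  obtain ⟨p, hp⟩ := exists_polynomial_near_of_continuousOn 0 1 ψ hψ.continuousOn
    (η / (I + 1)) (by positivity)
  have hgi : Integrable (fun t => g t * h t) halfLine := by
    have : MemLp g 2 halfLine := (hg.continuous.memLp_of_hasCompactSupport hgs).restrict _
    exact this.integrable_mul hh
  have hsub : ∫ t, g t * h t ∂halfLine = ∫ t, (g t * h t -
      h t * Real.exp (-(1 / 2) * t) * p.eval (Real.exp (-(1 / 8) * t))) ∂halfLine := by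
    rw [integral_sub hgi (hpoly p).1, (hpoly p).2, sub_zero]
  rw [hsub, zero_add]
  refine (abs_integral_le_integral_abs).trans ?_
  calc _ ≤ ∫ t, |h t * Real.exp (-(1 / 2) * t)| * (η / (I + 1)) ∂halfLine := by
        refine integral_mono_of_nonneg (ae_of_all _ fun t => abs_nonneg _) (hw.abs.mul_const _)
          (ae_halfLine_of_pos fun t ht => ?_)
        simp only []
        rw [hgψ, ← mul_sub, abs_mul]
        gcongr
        rw [abs_sub_comm]
        refine (hp _ ⟨(Real.exp_pos _).le, ?_⟩).le
        rw [Real.exp_le_one_iff]; linarith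
    _ = I * (η / (I + 1)) := integral_mul_const _ _
    _ ≤ η := by
        rw [mul_div_assoc', div_le_iff₀ (by positivity)]; nlinarith

end Completeness

/-! ### Parseval's identity. -/

section Parseval

/-- Parseval's identity for the Laguerre functions. -/
lemma hasSum_coeff_sq {h : ℝ → ℝ} (hh : MemLp h 2 halfLine) :
    HasSum (fun l => coeff h l ^ 2) ((eLpNorm h 2 halfLine).toReal ^ 2) := by
  set v : ℕ → Lp ℝ 2 halfLine := fun l => (memLp_laguerreFun l).toLp
  have hin : ∀ (u : ℝ → ℝ) (hu : MemLp u 2 halfLine) (l : ℕ),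
      inner ℝ (v l) hu.toLp = coeff u l := fun u hu l => by
    rw [L2.inner_def, coeff]
    refine integral_congr_ae ?_
    filter_upwards [hu.coeFn_toLp, (memLp_laguerreFun l).coeFn_toLp] with t h1 h2
    rw [h1, h2]; simp
  have hv : Orthonormal ℝ v := by
    rw [orthonormal_iff_ite]
    intro i j
    rw [hin, coeff, integral_laguerreFun_mul]; simp [eq_comm]
  have hbot : (Submodule.span ℝ (Set.range v))ᗮ = ⊥ := by
    rw [Submodule.eq_bot_iff]
    intro x hx
    have hx2 : MemLp x 2 halfLine := Lp.memLp x
    have hx3 : hx2.toLp = x := Lp.toLp_coeFn x hx2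
    have : (x : ℝ → ℝ) =ᵐ[halfLine] 0 := by
      refine ae_eq_zero_of_coeff_eq_zero hx2 fun l => ?_
      rw [← hin _ hx2, hx3]
      exact (Submodule.mem_orthogonal _ _).1 hx _ (Submodule.subset_span ⟨l, rfl⟩)
    exact (Lp.eq_zero_iff_ae_eq_zero).2 this
  set b := HilbertBasis.mkOfOrthogonalEqBot hv hbot
  have hb := b.hasSum_inner_mul_inner hh.toLp hh.toLp
  have hbv : ∀ l, b l = v l := fun l => by
    simp only [b, HilbertBasis.coe_mkOfOrthogonalEqBot]
  simp only [hbv, hin, real_inner_self_eq_norm_sq, Lp.norm_toLp] at hb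
  have e : (fun l => coeff h l ^ 2) = fun l => inner ℝ hh.toLp (v l) * coeff h l := by
    funext l; rw [sq, real_inner_comm, hin]
  rw [e]; exact hb

end Parseval

/-! ### Spectral and Hilbert-Schmidt norms. -/

section MatrixNorms

variable {m : ℕ} (A B : Matrix (Fin m) (Fin m) ℝ)

lemma opNorm_nonneg : 0 ≤ opNorm A := norm_nonneg _

lemma opNorm_mul_le : opNorm (A * B) ≤ opNorm A * opNorm B := by
  unfold opNorm; rw [map_mul]; exact norm_mul_le _ _

lemma opNorm_add_le : opNorm (A + B) ≤ opNorm A + opNorm B := by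
  unfold opNorm; rw [map_add]; exact norm_add_le _ _

lemma opNorm_smul (c : ℝ) : opNorm (c • A) = |c| * opNorm A := by
  unfold opNorm; rw [map_smul, norm_smul, Real.norm_eq_abs]

lemma norm_toLp_mulVec_le (v : Fin m → ℝ) :
    ‖WithLp.toLp 2 (A *ᵥ v)‖ ≤ opNorm A * ‖WithLp.toLp 2 v‖ :=
  (Matrix.toEuclideanCLM (𝕜 := ℝ) A).le_opNorm (WithLp.toLp 2 v)

lemma opNorm_le_of_forall {c : ℝ} (hc : 0 ≤ c)
    (h : ∀ v : Fin m → ℝ, ‖WithLp.toLp 2 (A *ᵥ v)‖ ≤ c * ‖WithLp.toLp 2 v‖) : opNorm A ≤ c :=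
  ContinuousLinearMap.opNorm_le_bound _ hc fun v => h v.ofLp

lemma continuous_opNorm : Continuous (opNorm : Matrix (Fin m) (Fin m) ℝ → ℝ) := by
  unfold opNorm
  exact continuous_norm.comp
    (LinearMap.continuous_of_finiteDimensional
      (Matrix.toEuclideanCLM (𝕜 := ℝ) (n := Fin m)).toAlgEquiv.toLinearMap)

lemma hsNorm_eq_norm : hsNorm A =
    ‖(WithLp.toLp 2 (fun p : Fin m × Fin m => A p.1 p.2) : EuclideanSpace ℝ (Fin m × Fin m))‖ := by
  rw [hsNorm, EuclideanSpace.norm_eq, Fintype.sum_prod_type_right]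
  simp [Matrix.trace, Matrix.mul_apply, sq]

lemma hsNorm_nonneg : 0 ≤ hsNorm A := Real.sqrt_nonneg _

lemma hsNorm_add_le : hsNorm (A + B) ≤ hsNorm A + hsNorm B := by
  simp only [hsNorm_eq_norm]
  exact norm_add_le (WithLp.toLp 2 (fun p : Fin m × Fin m => A p.1 p.2))
    (WithLp.toLp 2 (fun p : Fin m × Fin m => B p.1 p.2))

lemma hsNorm_smul (c : ℝ) : hsNorm (c • A) = |c| * hsNorm A := by
  simp only [hsNorm_eq_norm]
  rw [← Real.norm_eq_abs, ← norm_smul]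
  rfl

lemma hsNorm_sq : hsNorm A ^ 2 = ∑ j, ‖WithLp.toLp 2 (fun i => A i j)‖ ^ 2 := by
  rw [hsNorm_eq_norm, EuclideanSpace.real_norm_sq_eq, Fintype.sum_prod_type_right]
  refine Finset.sum_congr rfl fun j _ => ?_
  rw [EuclideanSpace.real_norm_sq_eq]

/-- The squared Hilbert-Schmidt norm is the sum of the squared norms of the columns, and `A` acts on
each column of `B`. -/
lemma hsNorm_mul_le : hsNorm (A * B) ≤ opNorm A * hsNorm B := by
  refine abs_le_of_sq_le_sq' ?_ (mul_nonneg (opNorm_nonneg A) (hsNorm_nonneg B)) |>.2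
  rw [mul_pow, hsNorm_sq, hsNorm_sq, Finset.mul_sum]
  refine Finset.sum_le_sum fun j _ => ?_
  rw [← mul_pow]
  exact pow_le_pow_left₀ (norm_nonneg _) (norm_toLp_mulVec_le A (fun i => B i j)) 2

lemma opNorm_le_hsNorm : opNorm A ≤ hsNorm A := by
  refine opNorm_le_of_forall A (hsNorm_nonneg A) fun v => ?_
  refine abs_le_of_sq_le_sq' ?_ (mul_nonneg (hsNorm_nonneg A) (norm_nonneg _)) |>.2
  rw [mul_pow, EuclideanSpace.real_norm_sq_eq, EuclideanSpace.real_norm_sq_eq, hsNorm_eq_norm,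
    EuclideanSpace.real_norm_sq_eq, Fintype.sum_prod_type, Finset.sum_mul]
  refine Finset.sum_le_sum fun i _ => ?_
  exact Finset.sum_mul_sq_le_sq_mul_sq Finset.univ (fun j => A i j) v

end MatrixNorms

/-! ### Toeplitz matrices as truncated power series; perturbation of inverses. -/

section Toeplitz

open PowerSeries

/-- The lower triangular Toeplitz matrix of the coefficients of a power series. -/
noncomputable def tz (l : ℕ) (p : ℝ⟦X⟧) : Matrix (Fin (l + 1)) (Fin (l + 1)) ℝ :=
  toeplitz (fun k => PowerSeries.coeff k p) l

/-- The vector of the first `l + 1` coefficients of a power series. -/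
noncomputable def coeffTrunc (l : ℕ) (p : ℝ⟦X⟧) : EuclideanSpace ℝ (Fin (l + 1)) :=
  WithLp.toLp 2 fun k => PowerSeries.coeff (k : ℕ) p

/-- The spectral norm of the Toeplitz matrix of a power series. -/
noncomputable def tzOp (l : ℕ) (p : ℝ⟦X⟧) : ℝ := opNorm (tz l p)

/-- The Hilbert-Schmidt norm of the Toeplitz matrix of a power series. -/
noncomputable def tzHS (l : ℕ) (p : ℝ⟦X⟧) : ℝ := hsNorm (tz l p)

/-- The Euclidean norm of the first `l + 1` coefficients of a power series. -/
noncomputable def l2 (l : ℕ) (p : ℝ⟦X⟧) : ℝ := ‖coeffTrunc l p‖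

variable (l : ℕ) (p q : ℝ⟦X⟧)

lemma tzOp_nonneg : 0 ≤ tzOp l p := opNorm_nonneg _
lemma tzHS_nonneg : 0 ≤ tzHS l p := hsNorm_nonneg _
lemma l2_nonneg : 0 ≤ l2 l p := norm_nonneg _

lemma l2_sq : l2 l p ^ 2 = ∑ k ∈ Finset.range (l + 1), PowerSeries.coeff k p ^ 2 := by
  rw [l2, EuclideanSpace.real_norm_sq_eq]
  exact Fin.sum_univ_eq_sum_range (fun k => PowerSeries.coeff k p ^ 2) (l + 1)

lemma tz_mulVec : tz l p *ᵥ (fun k : Fin (l + 1) => PowerSeries.coeff (k : ℕ) q) =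
    fun k : Fin (l + 1) => PowerSeries.coeff (k : ℕ) (p * q) := by
  funext i
  simp only [Matrix.mulVec, dotProduct, tz, toeplitz, Matrix.of_apply]
  rw [Fin.sum_univ_eq_sum_range
    (fun j => (if j ≤ (i : ℕ) then PowerSeries.coeff ((i : ℕ) - j) p else 0) * PowerSeries.coeff j q) (l + 1), mul_comm p q,
    PowerSeries.coeff_mul, Finset.Nat.sum_antidiagonal_eq_sum_range_succ
      (fun a b => PowerSeries.coeff a q * PowerSeries.coeff b p)]
  symm
  refine Finset.sum_subset_zero_on_sdiff (fun j hj => ?_) (fun j hj => ?_) (fun j hj => ?_)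
  · simp only [Finset.mem_range] at *; omega
  · simp only [Finset.mem_sdiff, Finset.mem_range, not_lt] at hj
    rw [if_neg (by omega), zero_mul]
  · simp only [Finset.mem_range] at hj
    rw [if_pos (by omega), mul_comm]

/-- Column `j` of a Toeplitz matrix is the truncation of the series times `X ^ j`, so the product
can be read column by column from `tz_mulVec`. Inverses and products of the matrices thus become
operations in a commutative ring. -/
lemma tz_mul : tz l (p * q) = tz l p * tz l q := by
  ext i j
  have h := congrFun (tz_mulVec l p (q * X ^ (j : ℕ))) i
  have hc : ∀ (r : ℝ⟦X⟧) (a : Fin (l + 1)), tz l r a j = PowerSeries.coeff (a : ℕ) (r * X ^ (j : ℕ)) := by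
    intro r a
    rw [PowerSeries.coeff_mul_X_pow', tz, toeplitz, Matrix.of_apply]
  rw [Matrix.mul_apply, hc, mul_assoc, ← h, Matrix.mulVec, dotProduct]
  simp_rw [hc]

lemma tz_one : tz l 1 = 1 := by
  ext i j
  simp only [tz, toeplitz, Matrix.of_apply, PowerSeries.coeff_one, Matrix.one_apply, Fin.ext_iff]
  split_ifs <;> first | rfl | omega

lemma tz_add : tz l (p + q) = tz l p + tz l q := by
  ext i j
  simp only [tz, toeplitz, Matrix.of_apply, map_add, Matrix.add_apply]
  split_ifs <;> simp

lemma tz_smul (c : ℝ) : tz l (c • p) = c • tz l p := by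
  ext i j
  simp only [tz, toeplitz, Matrix.of_apply, Matrix.smul_apply, PowerSeries.coeff_smul]
  split_ifs <;> simp

lemma tz_zero : tz l 0 = 0 := by
  ext i j; simp [tz, toeplitz]

/-- When the constant coefficient vanishes, the matrix is singular and both inverses are `0` by
convention, so no hypothesis is needed. -/
lemma tz_inv : (tz l p)⁻¹ = tz l p⁻¹ := by
  by_cases h : constantCoeff p = 0
  · rw [PowerSeries.inv_eq_zero.2 h, tz_zero]
    refine Matrix.nonsing_inv_apply_not_isUnit _ ?_
    have hdet : (tz l p).det = ∏ i, tz l p i i := by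
      refine Matrix.det_of_isLowerTriangular (tz l p) fun i j hij => ?_
      rw [tz, toeplitz, Matrix.of_apply, if_neg]
      simpa using hij
    rw [hdet, Finset.prod_eq_zero (Finset.mem_univ 0)]
    · simp
    · simp [tz, toeplitz, h]
  · refine Matrix.inv_eq_right_inv ?_
    rw [← tz_mul, PowerSeries.mul_inv_cancel _ h, tz_one]

lemma tzOp_mul_le : tzOp l (p * q) ≤ tzOp l p * tzOp l q := by
  unfold tzOp; rw [tz_mul]; exact opNorm_mul_le _ _

lemma tzOp_add_le : tzOp l (p + q) ≤ tzOp l p + tzOp l q := by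
  unfold tzOp; rw [tz_add]; exact opNorm_add_le _ _

lemma tzOp_smul (c : ℝ) : tzOp l (c • p) = |c| * tzOp l p := by
  unfold tzOp; rw [tz_smul]; exact opNorm_smul _ _

lemma tzOp_neg : tzOp l (-p) = tzOp l p := by
  rw [← neg_one_smul ℝ, tzOp_smul]; simp

lemma tzOp_sub_le : tzOp l (p - q) ≤ tzOp l p + tzOp l q := by
  rw [sub_eq_add_neg, ← tzOp_neg l q]; exact tzOp_add_le _ _ _

lemma tzHS_add_le : tzHS l (p + q) ≤ tzHS l p + tzHS l q := by
  unfold tzHS; rw [tz_add]; exact hsNorm_add_le _ _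

lemma tzHS_neg : tzHS l (-p) = tzHS l p := by
  rw [← neg_one_smul ℝ, tzHS, tz_smul, hsNorm_smul]; simp [tzHS]

lemma tzHS_mul_le : tzHS l (p * q) ≤ tzOp l p * tzHS l q := by
  unfold tzHS tzOp; rw [tz_mul]; exact hsNorm_mul_le _ _

lemma tzOp_le_tzHS : tzOp l p ≤ tzHS l p := opNorm_le_hsNorm _

lemma l2_add_le : l2 l (p + q) ≤ l2 l p + l2 l q := by
  have : coeffTrunc l (p + q) = coeffTrunc l p + coeffTrunc l q := by
    ext k; simp [coeffTrunc]
  unfold l2; rw [this]; exact norm_add_le _ _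

lemma l2_smul (c : ℝ) : l2 l (c • p) = |c| * l2 l p := by
  have : coeffTrunc l (c • p) = c • coeffTrunc l p := by
    ext k; simp [coeffTrunc]
  unfold l2; rw [this, norm_smul, Real.norm_eq_abs]

lemma l2_neg : l2 l (-p) = l2 l p := by
  rw [← neg_one_smul ℝ, l2_smul]; simp

lemma l2_mul_le : l2 l (p * q) ≤ tzOp l p * l2 l q := by
  have h := norm_toLp_mulVec_le (tz l p) (fun k : Fin (l + 1) => PowerSeries.coeff (k : ℕ) q)
  rwa [tz_mulVec] at h

lemma l2_one : l2 l 1 = 1 := by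
  have h : l2 l 1 ^ 2 = 1 := by
    rw [l2_sq, Finset.sum_range_succ', Finset.sum_eq_zero]
    · simp
    · intro k _; simp [PowerSeries.coeff_one]
  exact (pow_eq_one_iff_of_nonneg (l2_nonneg _ _) two_ne_zero).1 h

lemma l2_le_tzOp : l2 l p ≤ tzOp l p := by
  simpa [l2_one] using l2_mul_le l p 1

lemma tzOp_one : tzOp l 1 = 1 := by
  refine le_antisymm ?_ ?_
  · rw [tzOp, tz_one, opNorm, map_one]; exact ContinuousLinearMap.norm_id_le
  · rw [← l2_one l]; exact l2_le_tzOp l 1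

lemma abs_coeff_le_l2 {k : ℕ} (hk : k ≤ l) : |PowerSeries.coeff k p| ≤ l2 l p := by
  refine abs_le_of_sq_le_sq (l2_sq l p ▸ ?_) (l2_nonneg _ _)
  exact Finset.single_le_sum (f := fun k => PowerSeries.coeff k p ^ 2) (fun _ _ => sq_nonneg _)
    (Finset.mem_range.2 (Nat.lt_succ_of_le hk))

lemma abs_coeff_mul_le {k : ℕ} (hk : k ≤ l) : |PowerSeries.coeff k (p * q)| ≤ l2 l p * l2 l q := by
  refine abs_le_of_sq_le_sq ?_ (mul_nonneg (l2_nonneg _ _) (l2_nonneg _ _))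
  rw [mul_pow, l2_sq, l2_sq, PowerSeries.coeff_mul,
    Finset.Nat.sum_antidiagonal_eq_sum_range_succ (fun a b => PowerSeries.coeff a p * PowerSeries.coeff b q)]
  refine (Finset.sum_mul_sq_le_sq_mul_sq _ _ _).trans ?_
  have hsub : Finset.range (k + 1) ⊆ Finset.range (l + 1) := Finset.range_subset_range.2 (by omega)
  have e : ∑ i ∈ Finset.range (k + 1), PowerSeries.coeff (k - i) q ^ 2 =
      ∑ i ∈ Finset.range (k + 1), PowerSeries.coeff i q ^ 2 :=
    Finset.sum_range_reflect (fun j => PowerSeries.coeff j q ^ 2) (k + 1)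
  rw [Nat.succ_eq_add_one, e]
  gcongr

/-- Row `k` of the matrix contains exactly the first `k + 1` coefficients. The double sum is the one
that `illPosedClass` bounds from below. -/
lemma tzHS_sq : tzHS l p ^ 2 =
    ∑ k ∈ Finset.range (l + 1), ∑ n ∈ Finset.range (k + 1), PowerSeries.coeff n p ^ 2 := by
  rw [tzHS, hsNorm_eq_norm, EuclideanSpace.real_norm_sq_eq, Fintype.sum_prod_type]
  simp only [tz, toeplitz, Matrix.of_apply]
  rw [Fin.sum_univ_eq_sum_range (fun i => ∑ j : Fin (l + 1),
    (if (j : ℕ) ≤ i then PowerSeries.coeff (i - j) p else 0) ^ 2) (l + 1)]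
  refine Finset.sum_congr rfl fun i hi => ?_
  rw [Fin.sum_univ_eq_sum_range (fun j => (if j ≤ i then PowerSeries.coeff (i - j) p else 0) ^ 2) (l + 1),
    ← Finset.sum_range_reflect (fun j => PowerSeries.coeff j p ^ 2) (i + 1)]
  symm
  have hi' := Finset.mem_range.1 hi
  refine Finset.sum_subset_zero_on_sdiff (fun j hj => ?_) (fun j hj => ?_) (fun j hj => ?_)
  · simp only [Finset.mem_range] at *; omega
  · simp only [Finset.mem_sdiff, Finset.mem_range, not_lt] at hj
    rw [if_neg (by omega)]; simp
  · simp only [Finset.mem_range] at hj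
    rw [if_pos (by omega)]; congr 2

lemma tzOp_X_le : tzOp l X ≤ 1 := by
  refine opNorm_le_of_forall _ zero_le_one fun v => ?_
  set q : ℝ⟦X⟧ := PowerSeries.mk fun k => if h : k < l + 1 then v ⟨k, h⟩ else 0
  have hv : v = fun k : Fin (l + 1) => PowerSeries.coeff (k : ℕ) q := by
    funext k; simp only [q, PowerSeries.coeff_mk, k.2, dif_pos]
  rw [one_mul, hv, tz_mulVec]
  change l2 l (X * q) ≤ l2 l q
  refine abs_le_of_sq_le_sq' ?_ (l2_nonneg _ _) |>.2
  rw [l2_sq, l2_sq, Finset.sum_range_succ', Finset.sum_range_succ]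
  simp only [PowerSeries.coeff_succ_X_mul, PowerSeries.coeff_zero_X_mul]
  nlinarith [sq_nonneg (PowerSeries.coeff l q)]

lemma tzOp_X_pow_le (k : ℕ) : tzOp l (X ^ k) ≤ 1 := by
  induction k with
  | zero => simp [tzOp_one]
  | succ k ih =>
    rw [pow_succ]
    exact (tzOp_mul_le _ _ _).trans (mul_le_one₀ ih (tzOp_nonneg _ _) (tzOp_X_le l))

lemma tz_eq_sum : tz l p = ∑ k ∈ Finset.range (l + 1), PowerSeries.coeff k p • tz l (X ^ k) := by
  ext i j
  rw [Matrix.sum_apply]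
  simp only [Matrix.smul_apply, tz, toeplitz, Matrix.of_apply, PowerSeries.coeff_X_pow, smul_eq_mul]
  split_ifs with h
  · rw [Finset.sum_eq_single_of_mem ((i : ℕ) - j) (Finset.mem_range.2 (by omega))]
    · simp
    · intro b _ hb; rw [if_neg (Ne.symm hb), mul_zero]
  · simp

/-- Young's inequality for convolutions: the matrix is a combination of powers of the shift, which
is a contraction. It lets the signal act as a bounded operator as soon as its coefficients are
summable. -/
lemma tzOp_le_sum_abs : tzOp l p ≤ ∑ k ∈ Finset.range (l + 1), |PowerSeries.coeff k p| := by
  rw [tzOp, tz_eq_sum, opNorm, map_sum]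
  refine (norm_sum_le _ _).trans (Finset.sum_le_sum fun k _ => ?_)
  rw [map_smul, norm_smul, Real.norm_eq_abs]
  exact mul_le_of_le_one_right (abs_nonneg _) (tzOp_X_pow_le l k)

/-- Stability of the inverse of a power series under a small perturbation. -/
structure InvPerturb (l : ℕ) (A V : ℝ⟦X⟧) : Prop where
  const_ne : constantCoeff A ≠ 0
  small : tzOp l A⁻¹ * tzOp l V ≤ 1 / 2

namespace InvPerturb

variable {l} {A V : ℝ⟦X⟧} (h : InvPerturb l A V)
include h

/-- Otherwise `A⁻¹ * V` would have constant coefficient `-1`, whereas every coefficient is at most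
the spectral norm, here at most `1/2`. -/
lemma const_add_ne : constantCoeff (A + V) ≠ 0 := by
  intro h0
  have h1 : constantCoeff (A⁻¹ * V) = -1 := by
    rw [map_mul, PowerSeries.constantCoeff_inv]
    rw [map_add] at h0
    have := h.const_ne
    field_simp; linarith
  have h2 : |PowerSeries.coeff 0 (A⁻¹ * V)| ≤ 1 / 2 :=
    ((abs_coeff_le_l2 l _ (Nat.zero_le _)).trans (l2_le_tzOp _ _)).trans
      ((tzOp_mul_le _ _ _).trans h.small)
  rw [PowerSeries.coeff_zero_eq_constantCoeff_apply, h1] at h2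
  norm_num at h2

/-- The resolvent identity. In each of the following norm bounds the last term has at most half the
size of the perturbed inverse and is absorbed. -/
lemma inv_eq : (A + V)⁻¹ = A⁻¹ - A⁻¹ * V * (A + V)⁻¹ := by
  have h1 := PowerSeries.mul_inv_cancel _ h.const_add_ne
  have h2 := PowerSeries.inv_mul_cancel _ h.const_ne
  calc (A + V)⁻¹ = A⁻¹ * A * (A + V)⁻¹ := by rw [h2, one_mul]
    _ = A⁻¹ * ((A + V) * (A + V)⁻¹) - A⁻¹ * V * (A + V)⁻¹ := by ring
    _ = _ := by rw [h1, mul_one]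

lemma inv_mul_eq : (A + V)⁻¹ * A = 1 - (A + V)⁻¹ * V := by
  have h1 := PowerSeries.inv_mul_cancel _ h.const_add_ne
  rw [← h1]; ring

lemma tzOp_inv_le : tzOp l (A + V)⁻¹ ≤ 2 * tzOp l A⁻¹ := by
  have h1 : tzOp l (A + V)⁻¹ ≤ tzOp l A⁻¹ + 1 / 2 * tzOp l (A + V)⁻¹ := by
    conv_lhs => rw [h.inv_eq]
    refine (tzOp_sub_le _ _ _).trans (add_le_add le_rfl ?_)
    refine (tzOp_mul_le _ _ _).trans (mul_le_mul_of_nonneg_right ?_ (tzOp_nonneg _ _))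
    exact (tzOp_mul_le _ _ _).trans h.small
  linarith

lemma l2_inv_le : l2 l (A + V)⁻¹ ≤ 2 * l2 l A⁻¹ := by
  have h1 : l2 l (A + V)⁻¹ ≤ l2 l A⁻¹ + 1 / 2 * l2 l (A + V)⁻¹ := by
    conv_lhs => rw [h.inv_eq, sub_eq_add_neg]
    refine (l2_add_le _ _ _).trans (add_le_add le_rfl ?_)
    rw [l2_neg]
    refine (l2_mul_le _ _ _).trans (mul_le_mul_of_nonneg_right ?_ (l2_nonneg _ _))
    exact (tzOp_mul_le _ _ _).trans h.small
  linarith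

lemma tzHS_inv_le : tzHS l (A + V)⁻¹ ≤ 2 * tzHS l A⁻¹ := by
  have h1 : tzHS l (A + V)⁻¹ ≤ tzHS l A⁻¹ + 1 / 2 * tzHS l (A + V)⁻¹ := by
    conv_lhs => rw [h.inv_eq, sub_eq_add_neg]
    refine (tzHS_add_le _ _ _).trans (add_le_add le_rfl ?_)
    rw [tzHS_neg]
    refine (tzHS_mul_le _ _ _).trans (mul_le_mul_of_nonneg_right ?_ (tzHS_nonneg _ _))
    exact (tzOp_mul_le _ _ _).trans h.small
  linarith

lemma tzHS_le : tzHS l A⁻¹ ≤ 3 / 2 * tzHS l (A + V)⁻¹ := by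
  have e : A⁻¹ = (A + V)⁻¹ + A⁻¹ * V * (A + V)⁻¹ := by
    conv_rhs => arg 1; rw [h.inv_eq]
    ring
  have h1 : tzHS l A⁻¹ ≤ tzHS l (A + V)⁻¹ + 1 / 2 * tzHS l (A + V)⁻¹ := by
    conv_lhs => rw [e]
    refine (tzHS_add_le _ _ _).trans (add_le_add le_rfl ?_)
    refine (tzHS_mul_le _ _ _).trans (mul_le_mul_of_nonneg_right ?_ (tzHS_nonneg _ _))
    exact (tzOp_mul_le _ _ _).trans h.small
  linarith

/-- An absolute constant, where bounding the two factors separately would cost the condition number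
of the operator. -/
lemma tzOp_inv_mul_le : tzOp l ((A + V)⁻¹ * A) ≤ 2 := by
  rw [h.inv_mul_eq]
  have h1 : tzOp l ((A + V)⁻¹ * V) ≤ 1 :=
    calc _ ≤ tzOp l (A + V)⁻¹ * tzOp l V := tzOp_mul_le _ _ _
      _ ≤ 2 * tzOp l A⁻¹ * tzOp l V :=
        mul_le_mul_of_nonneg_right h.tzOp_inv_le (tzOp_nonneg _ _)
      _ ≤ 1 := by linarith [h.small]
  have := tzOp_sub_le l 1 ((A + V)⁻¹ * V)
  rw [tzOp_one] at this
  linarith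

end InvPerturb

/-- If the inverse of the perturbed series is small enough, so is the inverse of the series. -/
lemma tzOp_inv_le_of_perturbed {A V : ℝ⟦X⟧}
    (hAV : constantCoeff (A + V) ≠ 0) (h : tzOp l (A + V)⁻¹ * tzOp l V ≤ 1 / 2) :
    tzOp l A⁻¹ ≤ 2 * tzOp l (A + V)⁻¹ := by
  have h' : InvPerturb l (A + V) (-V) := ⟨hAV, by rwa [tzOp_neg]⟩
  simpa using h'.tzOp_inv_le

end Toeplitz

/-! ### Spectral norm by circulant embedding. -/

section Circulant

open PowerSeries

lemma sum_range_pow_eq_ite {n : ℕ} {ω : ℂ} (hω : IsPrimitiveRoot ω n) (hn : 0 < n) {j k : ℕ}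
    (hj : j < n) (hk : k < n) :
    ∑ t ∈ Finset.range n, (ω ^ t) ^ j * (starRingEnd ℂ) ((ω ^ t) ^ k) = if j = k then (n : ℂ) else 0 := by
  have hnorm : ‖ω‖ = 1 := hω.norm'_eq_one hn.ne'
  have hinv : (starRingEnd ℂ) ω = ω⁻¹ := (Complex.inv_eq_conj hnorm).symm
  have hω0 : ω ≠ 0 := hω.ne_zero hn.ne'
  set ζ : ℂ := ω ^ j * (ω⁻¹) ^ k with hζ
  have e : ∀ t, (ω ^ t) ^ j * (starRingEnd ℂ) ((ω ^ t) ^ k) = ζ ^ t := fun t => by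
    rw [map_pow, map_pow, hinv, hζ, mul_pow, ← pow_mul, ← pow_mul, ← pow_mul, ← pow_mul,
      mul_comm t j, mul_comm t k]
  simp_rw [e]
  split_ifs with h
  · have : ζ = 1 := by rw [hζ, h, inv_pow, mul_inv_cancel₀ (pow_ne_zero _ hω0)]
    simp [this]
  · have hne : ζ ≠ 1 := fun h1 => h (hω.pow_inj hj hk (by
      rw [hζ, inv_pow] at h1
      field_simp at h1
      exact h1))
    have hn1 : ζ ^ n = 1 := by
      rw [hζ, mul_pow, ← pow_mul, ← pow_mul, mul_comm j, mul_comm k, pow_mul, pow_mul, inv_pow,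
        hω.pow_eq_one]; simp
    have := mul_neg_geom_sum ζ n
    rw [hn1, sub_self] at this
    exact (mul_eq_zero.1 this).resolve_left (sub_ne_zero.2 hne.symm)

/-- Parseval's identity for the discrete Fourier transform of a real polynomial. -/
lemma sum_norm_eval_sq {n : ℕ} {ω : ℂ} (hω : IsPrimitiveRoot ω n) (hn : 0 < n) (c : ℕ → ℝ) :
    ∑ t ∈ Finset.range n, ‖∑ k ∈ Finset.range n, (c k : ℂ) * (ω ^ t) ^ k‖ ^ 2 =
      n * ∑ k ∈ Finset.range n, c k ^ 2 := by
  have h : (∑ t ∈ Finset.range n, ((‖∑ k ∈ Finset.range n, (c k : ℂ) * (ω ^ t) ^ k‖ ^ 2 : ℝ) : ℂ)) =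
      ((n * ∑ k ∈ Finset.range n, c k ^ 2 : ℝ) : ℂ) := by
    have e : ∀ t, ((‖∑ k ∈ Finset.range n, (c k : ℂ) * (ω ^ t) ^ k‖ ^ 2 : ℝ) : ℂ) =
        ∑ j ∈ Finset.range n, ∑ k ∈ Finset.range n, (c j : ℂ) * c k *
          ((ω ^ t) ^ j * (starRingEnd ℂ) ((ω ^ t) ^ k)) := fun t => by
      rw [Complex.ofReal_pow, ← Complex.mul_conj', map_sum, Finset.sum_mul_sum]
      refine Finset.sum_congr rfl fun j _ => Finset.sum_congr rfl fun k _ => ?_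
      rw [map_mul, Complex.conj_ofReal]; ring
    simp_rw [e]
    rw [Finset.sum_comm]
    simp_rw [Finset.sum_comm (s := Finset.range n) (t := Finset.range n)
      (f := fun t k => _ * _ * ((ω ^ t) ^ _ * (starRingEnd ℂ) ((ω ^ t) ^ k))), ← Finset.mul_sum]
    push_cast
    rw [Finset.mul_sum]
    refine Finset.sum_congr rfl fun j hj => ?_
    rw [Finset.sum_eq_single_of_mem j hj]
    · rw [sum_range_pow_eq_ite hω hn (Finset.mem_range.1 hj) (Finset.mem_range.1 hj), if_pos rfl]
      ring
    · intro k hk hkj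
      rw [sum_range_pow_eq_ite hω hn (Finset.mem_range.1 hj) (Finset.mem_range.1 hk),
        if_neg hkj.symm, mul_zero]
  exact_mod_cast h

/-- The spectral norm of a triangular Toeplitz matrix is at most the largest modulus of the discrete
Fourier transform of its first column, padded with zeros to twice its length. -/
lemma tzOp_le_of_dft {l : ℕ} {ω : ℂ} (hω : IsPrimitiveRoot ω (2 * (l + 1))) (p : ℝ⟦X⟧) {c : ℝ}
    (hc : ∀ t < 2 * (l + 1),
      ‖∑ k ∈ Finset.range (l + 1), ((PowerSeries.coeff k p : ℝ) : ℂ) * (ω ^ t) ^ k‖ ≤ c) :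
    tzOp l p ≤ c := by
  set n := 2 * (l + 1) with hn
  have hc0 : 0 ≤ c := (norm_nonneg _).trans (hc 0 (by omega))
  refine opNorm_le_of_forall _ hc0 fun v => ?_
  set q : ℝ⟦X⟧ := PowerSeries.mk fun k => if h : k < l + 1 then v ⟨k, h⟩ else 0 with hq
  have hv : v = fun k : Fin (l + 1) => PowerSeries.coeff (k : ℕ) q := by
    funext k; simp only [q, PowerSeries.coeff_mk, k.2, dif_pos]
  rw [hv, tz_mulVec]
  change l2 l (p * q) ≤ c * l2 l q
  refine abs_le_of_sq_le_sq' ?_ (mul_nonneg hc0 (l2_nonneg _ _)) |>.2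
  -- The product of the truncations has degree less than `2 * (l + 1)`, so the discrete Fourier
  -- transform of this length sees no wrap-around: the convolution is a pointwise product on the
  -- frequencies, with Parseval on both sides.
  set P : Polynomial ℝ := trunc (l + 1) p
  set Q : Polynomial ℝ := trunc (l + 1) q
  have hPQ : (P * Q).natDegree < n := by
    have h1 : P.natDegree < l + 1 := natDegree_trunc_lt p l
    have h2 : Q.natDegree < l + 1 := natDegree_trunc_lt q l
    have := Polynomial.natDegree_mul_le (p := P) (q := Q)
    omega
  have heval : ∀ (R : Polynomial ℝ) (m : ℕ), R.natDegree < m → ∀ z : ℂ,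
      ∑ k ∈ Finset.range m, (R.coeff k : ℂ) * z ^ k = Polynomial.aeval z R := fun R m hR z => by
    rw [Polynomial.aeval_eq_sum_range' hR]; simp
  have hcoef : ∀ k ∈ Finset.range (l + 1), PowerSeries.coeff k (p * q) = (P * Q).coeff k := by
    intro k hk
    rw [PowerSeries.coeff_mul, Polynomial.coeff_mul]
    refine Finset.sum_congr rfl fun x hx => ?_
    have hx' := Finset.HasAntidiagonal.mem_antidiagonal.1 hx
    have hk' := Finset.mem_range.1 hk
    rw [coeff_trunc, coeff_trunc, if_pos (by omega), if_pos (by omega)]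
  have hP : ∀ z : ℂ, ∑ k ∈ Finset.range (l + 1), ((PowerSeries.coeff k p : ℝ) : ℂ) * z ^ k =
      Polynomial.aeval z P := fun z => by
    rw [← heval P (l + 1) (natDegree_trunc_lt p l)]
    refine Finset.sum_congr rfl fun k hk => ?_
    rw [coeff_trunc, if_pos (Finset.mem_range.1 hk)]
  have hnpos : (0 : ℝ) < n := by rw [hn]; positivity
  have hQsum : ∑ k ∈ Finset.range n, Q.coeff k ^ 2 = l2 l q ^ 2 := by
    rw [l2_sq]
    symm
    refine Finset.sum_subset_zero_on_sdiff (Finset.range_subset_range.2 (by omega))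
      (fun k hk => ?_) (fun k hk => ?_)
    · simp only [Finset.mem_sdiff, Finset.mem_range, not_lt] at hk
      rw [coeff_trunc, if_neg (by omega)]; simp
    · rw [coeff_trunc, if_pos (Finset.mem_range.1 hk)]
  have hD := sum_norm_eval_sq hω (by omega) (fun k => (P * Q).coeff k)
  have hDQ := sum_norm_eval_sq hω (by omega) (fun k => Q.coeff k)
  have h1 : ∑ k ∈ Finset.range n, (P * Q).coeff k ^ 2 ≤ c ^ 2 * l2 l q ^ 2 := by
    refine le_of_mul_le_mul_left ?_ hnpos
    rw [← hD, ← hQsum, mul_left_comm, ← hDQ, Finset.mul_sum]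
    refine Finset.sum_le_sum fun t ht => ?_
    rw [heval _ _ hPQ, heval Q n ((natDegree_trunc_lt q l).trans_le (by omega)), map_mul, norm_mul,
      mul_pow, ← hP]
    have := hc t (Finset.mem_range.1 ht)
    gcongr
  rw [mul_pow, l2_sq]
  refine le_trans ?_ h1
  rw [Finset.sum_congr rfl fun k hk => by rw [hcoef k hk]]
  exact Finset.sum_le_sum_of_subset_of_nonneg (Finset.range_subset_range.2 (by omega))
    fun _ _ _ => sq_nonneg _

end Circulant

/-! ### Gaussian tails for the operator noise. -/

section GaussianVector

/-- The standard Gaussian law of the first `l + 1` coefficients of the operator noise. -/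
noncomputable def gaussVec (l : ℕ) : Measure (Fin (l + 1) → ℝ) :=
  Measure.pi fun _ => gaussianReal 0 1

instance (l : ℕ) : IsProbabilityMeasure (gaussVec l) := by unfold gaussVec; infer_instance

/-- The power series with prescribed first coefficients. -/
noncomputable def ser (l : ℕ) (b : Fin (l + 1) → ℝ) : PowerSeries ℝ :=
  PowerSeries.mk fun k => if h : k < l + 1 then b ⟨k, h⟩ else 0

lemma coeff_ser {l : ℕ} (b : Fin (l + 1) → ℝ) (k : Fin (l + 1)) :
    PowerSeries.coeff (k : ℕ) (ser l b) = b k := by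
  simp only [ser, PowerSeries.coeff_mk, k.2, dif_pos]

lemma hasSubgaussianMGF_linear {l : ℕ} (c : Fin (l + 1) → ℝ) (v : NNReal) (hv : ∑ k, c k ^ 2 ≤ v) :
    HasSubgaussianMGF (fun b : Fin (l + 1) → ℝ => ∑ k, c k * b k) v (gaussVec l) := by
  have h1 : ∀ k, HasSubgaussianMGF (fun b : Fin (l + 1) → ℝ => b k) 1 (gaussVec l) := fun k => by
    have hm : (gaussVec l).map (fun b : Fin (l + 1) → ℝ => b k) = gaussianReal 0 1 :=
      (measurePreserving_eval (fun _ : Fin (l + 1) => gaussianReal 0 1) k).map_eq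
    refine ⟨fun t => ?_, fun t => ?_⟩
    · have := integrable_exp_mul_gaussianReal (μ := 0) (v := 1) t
      rw [← hm] at this
      exact this.comp_measurable (measurable_pi_apply k)
    · rw [mgf_gaussianReal hm]; simp
  have hind : iIndepFun (fun (k : Fin (l + 1)) (b : Fin (l + 1) → ℝ) => c k * b k) (gaussVec l) :=
    iIndepFun_pi (X := fun k x => c k * x) fun k => by fun_prop
  have h2 := HasSubgaussianMGF.sum_of_iIndepFun hind (s := Finset.univ)
    (fun k _ => (h1 k).const_mul (c k))
  refine ⟨h2.integrable_exp_mul, fun t => (h2.mgf_le t).trans (Real.exp_le_exp.2 ?_)⟩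
  gcongr
  rw [← NNReal.coe_le_coe, NNReal.coe_sum]
  exact (le_of_eq (Finset.sum_congr rfl fun k _ => mul_one (c k ^ 2))).trans hv

lemma gaussVec_abs_linear_ge {l : ℕ} (c : Fin (l + 1) → ℝ) {v : ℝ} (hv : ∑ k, c k ^ 2 ≤ v)
    {y : ℝ} (hy : 0 ≤ y) :
    (gaussVec l).real {b | y ≤ |∑ k, c k * b k|} ≤ 2 * Real.exp (-y ^ 2 / (2 * v)) := by
  have hv0 : 0 ≤ v := (Finset.sum_nonneg fun k _ => sq_nonneg (c k)).trans hv
  have h := hasSubgaussianMGF_linear c ⟨v, hv0⟩ hv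
  have h1 := h.measure_ge_le hy
  have h2 := h.neg.measure_ge_le hy
  have hsub : {b : Fin (l + 1) → ℝ | y ≤ |∑ k, c k * b k|} ⊆
      {b | y ≤ ∑ k, c k * b k} ∪ {b | y ≤ (-fun b : Fin (l + 1) → ℝ => ∑ k, c k * b k) b} :=
    fun b hb => by
      simp only [Set.mem_union, Set.mem_ofPred_eq, Pi.neg_apply] at *
      exact le_abs.1 hb
  refine (measureReal_mono hsub).trans ((measureReal_union_le _ _).trans ?_)
  rw [two_mul]
  exact add_le_add h1 h2

/-- Tail bound for the spectral norm of a Gaussian triangular Toeplitz matrix. -/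
lemma gaussVec_tzOp_gt (l : ℕ) {x : ℝ} (hx : 0 ≤ x) :
    (gaussVec l).real {b | x < tzOp l (ser l b)} ≤
      8 * (l + 1) * Real.exp (-x ^ 2 / (4 * (l + 1))) := by
  set n := 2 * (l + 1) with hn
  set ω : ℂ := Complex.exp (2 * Real.pi * Complex.I / n)
  have hω : IsPrimitiveRoot ω n := Complex.isPrimitiveRoot_exp n (by omega)
  -- A complex number of modulus larger than `x` has real or imaginary part at least `x / √2` in
  -- absolute value.
  set y : ℝ := x / Real.sqrt 2
  have hy : 0 ≤ y := by positivity
  have hy2 : y ^ 2 = x ^ 2 / 2 := by rw [div_pow, Real.sq_sqrt (by norm_num)]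
  have hnorm : ∀ t k : ℕ, ‖(ω ^ t) ^ k‖ = 1 := fun t k => by
    rw [norm_pow, norm_pow, hω.norm'_eq_one (by omega), one_pow, one_pow]
  set Sre : ℕ → Set (Fin (l + 1) → ℝ) := fun t => {b | y ≤ |∑ k : Fin (l + 1), ((ω ^ t) ^ (k : ℕ)).re * b k|}
  set Sim : ℕ → Set (Fin (l + 1) → ℝ) := fun t => {b | y ≤ |∑ k : Fin (l + 1), ((ω ^ t) ^ (k : ℕ)).im * b k|}
  have hvar : ∀ t (g : ℂ → ℝ), (∀ z, |g z| ≤ ‖z‖) →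
      ∑ k : Fin (l + 1), g ((ω ^ t) ^ (k : ℕ)) ^ 2 ≤ (l + 1 : ℝ) := fun t g hg => by
    calc _ ≤ ∑ k : Fin (l + 1), (1 : ℝ) := Finset.sum_le_sum fun k _ => by
          rw [← sq_abs]
          exact pow_le_one₀ (abs_nonneg _) ((hg _).trans (hnorm t k).le)
      _ = _ := by simp
  have hexp : Real.exp (-y ^ 2 / (2 * (l + 1 : ℝ))) = Real.exp (-x ^ 2 / (4 * (l + 1))) := by
    congr 1
    rw [hy2]; field_simp; ring
  have hre : ∀ t, (gaussVec l).real (Sre t) ≤ 2 * Real.exp (-x ^ 2 / (4 * (l + 1))) := fun t => by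
    rw [← hexp]
    exact gaussVec_abs_linear_ge _ (hvar t Complex.re Complex.abs_re_le_norm) hy
  have him : ∀ t, (gaussVec l).real (Sim t) ≤ 2 * Real.exp (-x ^ 2 / (4 * (l + 1))) := fun t => by
    rw [← hexp]
    exact gaussVec_abs_linear_ge _ (hvar t Complex.im Complex.abs_im_le_norm) hy
  have hsub : {b | x < tzOp l (ser l b)} ⊆ ⋃ t ∈ Finset.range n, (Sre t ∪ Sim t) := by
    intro b hb
    by_contra hcon
    simp only [Set.mem_iUnion, not_exists, Set.mem_union, not_or, Sre, Sim, Set.mem_ofPred_eq,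
      not_le] at hcon
    refine absurd (tzOp_le_of_dft hω (ser l b) (c := x) fun t ht => ?_) (not_le.2 hb)
    obtain ⟨h1, h2⟩ := hcon t (Finset.mem_range.2 ht)
    rw [← Fin.sum_univ_eq_sum_range
      (fun k => ((PowerSeries.coeff k (ser l b) : ℝ) : ℂ) * (ω ^ t) ^ k) (l + 1)]
    simp_rw [coeff_ser]
    refine abs_le_of_sq_le_sq' ?_ hx |>.2
    rw [Complex.sq_norm, Complex.normSq_apply]
    simp only [Complex.re_sum, Complex.im_sum, Complex.re_ofReal_mul, Complex.im_ofReal_mul]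
    simp_rw [mul_comm (b _)]
    have e1 := sq_le_sq' (abs_le.1 h1.le).1 (abs_le.1 h1.le).2
    have e2 := sq_le_sq' (abs_le.1 h2.le).1 (abs_le.1 h2.le).2
    rw [hy2] at e1 e2
    nlinarith
  refine (measureReal_mono hsub (measure_ne_top _ _)).trans ((measureReal_biUnion_finset_le _ _).trans ?_)
  -- The prefactor `8 (l + 1)`: `2 (l + 1)` frequencies, two parts for each, and a two-sided tail
  -- for each part.
  calc _ ≤ ∑ t ∈ Finset.range n, (4 * Real.exp (-x ^ 2 / (4 * (l + 1)))) :=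
        Finset.sum_le_sum fun t _ => by
          refine (measureReal_union_le _ _).trans ?_
          linarith [hre t, him t]
    _ = _ := by
      rw [Finset.sum_const, Finset.card_range, nsmul_eq_mul, hn]; push_cast; ring

lemma gaussVec_abs_apply_gt (l : ℕ) {a : ℝ} (ha : 0 ≤ a) :
    (gaussVec l).real {b | ∃ k, a < |b k|} ≤ 2 * (l + 1) * Real.exp (-a ^ 2 / 2) := by
  have hsub : {b : Fin (l + 1) → ℝ | ∃ k, a < |b k|} ⊆
      ⋃ k ∈ Finset.univ, {b | a ≤ |∑ j, (Pi.single k (1 : ℝ) : Fin (l + 1) → ℝ) j * b j|} := by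
    rintro b ⟨k, hk⟩
    refine Set.mem_biUnion (Finset.mem_univ k) ?_
    simp only [Set.mem_ofPred_eq, Pi.single_apply, ite_mul, one_mul, zero_mul, Finset.sum_ite_eq',
      Finset.mem_univ, if_true]
    exact hk.le
  refine (measureReal_mono hsub (measure_ne_top _ _)).trans ((measureReal_biUnion_finset_le _ _).trans ?_)
  calc _ ≤ ∑ k : Fin (l + 1), (2 * Real.exp (-a ^ 2 / 2)) :=
        Finset.sum_le_sum fun k _ => by
          have := gaussVec_abs_linear_ge (l := l) (Pi.single k 1) (v := 1) (by
            simp [Pi.single_apply]) ha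
          simpa using this
    _ = _ := by rw [Finset.sum_const, Finset.card_univ, Fintype.card_fin, nsmul_eq_mul]; push_cast; ring

end GaussianVector

/-! ### Sign changes of one coordinate of the noise. -/

section Flip

open PowerSeries

/-- Change of sign of the coordinate of index `k`. -/
def flip {l : ℕ} (k : Fin (l + 1)) (b : Fin (l + 1) → ℝ) : Fin (l + 1) → ℝ :=
  fun j => if j = k then -b j else b j

variable {l : ℕ} (k : Fin (l + 1)) (b : Fin (l + 1) → ℝ)

lemma flip_flip : flip k (flip k b) = b := by
  funext j; by_cases h : j = k <;> simp [flip, h]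

lemma flip_apply_self : flip k b k = -b k := by simp [flip]

lemma abs_flip (j : Fin (l + 1)) : |flip k b j| = |b j| := by
  by_cases h : j = k <;> simp [flip, h]

lemma measurePreserving_flip : MeasurePreserving (flip k) (gaussVec l) (gaussVec l) := by
  have h : ∀ j : Fin (l + 1), MeasurePreserving (fun x : ℝ => if j = k then -x else x)
      (gaussianReal 0 1) (gaussianReal 0 1) := fun j => by
    by_cases h : j = k
    · simp only [h, if_true]
      exact ⟨by fun_prop, by rw [gaussianReal_map_neg, neg_zero]⟩
    · simp only [h, if_false]
      exact MeasurePreserving.id _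
  exact measurePreserving_pi _ _ h

lemma ser_flip : ser l (flip k b) = ser l b - (2 * b k) • (X : ℝ⟦X⟧) ^ (k : ℕ) := by
  ext n
  by_cases hn : n < l + 1
  · have h1 := coeff_ser (flip k b) ⟨n, hn⟩
    have h2 := coeff_ser b ⟨n, hn⟩
    simp only at h1 h2
    rw [map_sub, PowerSeries.coeff_smul, PowerSeries.coeff_X_pow, h1, h2]
    by_cases h : n = k
    · have : (⟨n, hn⟩ : Fin (l + 1)) = k := Fin.ext h
      rw [this, flip_apply_self, if_pos h]; simp; ring
    · have : (⟨n, hn⟩ : Fin (l + 1)) ≠ k := fun h' => h (by rw [← h'])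
      simp [flip, this, h]
  · have : n ≠ k := fun h => hn (h ▸ k.2)
    simp [ser, show ¬ n ≤ l by omega, PowerSeries.coeff_X_pow, this]

/-- A sign change subtracts a monomial, whose matrix is a multiple of a contraction. The perturbed
inverse therefore stays controlled after the change when the coordinates are truncated. -/
lemma tzOp_ser_flip_le : tzOp l (ser l (flip k b)) ≤ tzOp l (ser l b) + 2 * |b k| := by
  rw [ser_flip]
  refine (tzOp_sub_le _ _ _).trans (add_le_add le_rfl ?_)
  rw [tzOp_smul, abs_mul, abs_two]
  exact mul_le_of_le_one_right (by positivity) (tzOp_X_pow_le _ _)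

end Flip

/-! ### Sums of coefficients of shifted series. -/

section Sums

open PowerSeries

variable (l : ℕ) (p : ℝ⟦X⟧)

lemma sum_coeff_rev_sq :
    ∑ k : Fin (l + 1), PowerSeries.coeff (l - k) p ^ 2 = l2 l p ^ 2 := by
  rw [Fin.sum_univ_eq_sum_range (fun k => PowerSeries.coeff (l - k) p ^ 2) (l + 1), l2_sq]
  exact Finset.sum_range_reflect (fun j => PowerSeries.coeff j p ^ 2) (l + 1)

/-- The summand is the square of the coefficient of `p` of index `l - 2k`, or zero, and these
indices are distinct. -/
lemma sum_coeff_X_pow_mul_sq_le :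
    ∑ k : Fin (l + 1), PowerSeries.coeff (l - k) (X ^ (k : ℕ) * p) ^ 2 ≤ l2 l p ^ 2 := by
  rw [Fin.sum_univ_eq_sum_range (fun k => PowerSeries.coeff (l - k) (X ^ k * p) ^ 2) (l + 1), l2_sq]
  have e : ∀ k, PowerSeries.coeff (l - k) (X ^ k * p) ^ 2 =
      if k ≤ l - k then PowerSeries.coeff (l - k - k) p ^ 2 else 0 := fun k => by
    rw [PowerSeries.coeff_X_pow_mul']; split_ifs <;> simp
  simp_rw [e]
  rw [← Finset.sum_filter]
  have hinj : Set.InjOn (fun k => l - k - k)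
      (Finset.filter (fun k => k ≤ l - k) (Finset.range (l + 1)) : Set ℕ) := by
    intro x hx y hy hxy
    simp only [Finset.coe_filter, Finset.mem_range, Set.mem_ofPred_eq] at hx hy hxy
    omega
  rw [← Finset.sum_image (f := fun j => PowerSeries.coeff j p ^ 2) hinj]
  refine Finset.sum_le_sum_of_subset_of_nonneg (fun j hj => ?_) fun _ _ _ => sq_nonneg _
  simp only [Finset.mem_image, Finset.mem_filter, Finset.mem_range] at hj ⊢
  omega

lemma sum_abs_coeff_X_pow_mul_le :
    ∑ k : Fin (l + 1), |PowerSeries.coeff (l - k) (X ^ (k : ℕ) * p)| ≤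
      Real.sqrt (l + 1) * l2 l p := by
  refine abs_le_of_sq_le_sq' ?_ (mul_nonneg (Real.sqrt_nonneg _) (l2_nonneg _ _)) |>.2
  have h := sq_sum_le_card_mul_sum_sq (s := (Finset.univ : Finset (Fin (l + 1))))
    (f := fun k : Fin (l + 1) => |PowerSeries.coeff (l - k) (X ^ (k : ℕ) * p)|)
  rw [mul_pow, Real.sq_sqrt (by positivity)]
  refine h.trans ?_
  rw [Finset.card_univ, Fintype.card_fin]
  push_cast
  simp_rw [sq_abs]
  exact mul_le_mul_of_nonneg_left (sum_coeff_X_pow_mul_sq_le l p) (by positivity)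

lemma abs_coeff_X_pow_mul_le {m : ℕ} (hm : m ≤ l) (j : ℕ) (q : ℝ⟦X⟧) :
    |PowerSeries.coeff m (X ^ j * (p * q))| ≤ l2 l p * l2 l q := by
  rw [PowerSeries.coeff_X_pow_mul']
  split_ifs
  · exact abs_coeff_mul_le l p q (by omega)
  · simpa using mul_nonneg (l2_nonneg _ _) (l2_nonneg _ _)

end Sums

/-! ### Deterministic bounds for the operator error and its sign increments. -/

section Deterministic

open PowerSeries

/-- The data of the concentration argument: `A` is the series of the operator, `f` that of the
signal, `F` bounds its `ℓ¹` norm, `a` truncates the noise and `β` its spectral norm. -/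
structure NoiseBounds (l : ℕ) (A f : ℝ⟦X⟧) (δ F a β : ℝ) : Prop where
  const_ne : constantCoeff A ≠ 0
  δ_pos : 0 < δ
  a_pos : 0 < a
  F_pos : 0 < F
  sum_le : ∑ k ∈ Finset.range (l + 1), |PowerSeries.coeff k f| ≤ F
  small : tzOp l A⁻¹ * (δ * (2 * β)) ≤ 1 / 2
  a_le : 2 * a ≤ β
  x_le : δ * a * tzOp l A⁻¹ * Real.sqrt (l + 1) ≤ 1 / 16

/-- The inverse of the noisy operator series. -/
noncomputable def noisyInv (l : ℕ) (A : ℝ⟦X⟧) (δ : ℝ) (b : Fin (l + 1) → ℝ) : ℝ⟦X⟧ :=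
  (A + δ • ser l b)⁻¹

/-- The error due to the operator noise. -/
noncomputable def opErr (l : ℕ) (A f : ℝ⟦X⟧) (δ : ℝ) (b : Fin (l + 1) → ℝ) : ℝ :=
  -PowerSeries.coeff l (noisyInv l A δ b * (δ • ser l b) * f)

/-- The noises with bounded coordinates and spectral norm. -/
def boundedNoise (l : ℕ) (a β : ℝ) : Set (Fin (l + 1) → ℝ) :=
  {b | (∀ k, |b k| ≤ a) ∧ tzOp l (ser l b) ≤ β}

/-- The error is a linear form in the noise, but with coefficients that depend on the noise through
the inverse. All the later work is to show that this dependence is weak. -/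
lemma opErr_eq_sum (l : ℕ) (A f : ℝ⟦X⟧) (δ : ℝ) (b : Fin (l + 1) → ℝ) :
    opErr l A f δ b =
      -(δ * ∑ k : Fin (l + 1), b k * PowerSeries.coeff (l - k) (noisyInv l A δ b * f)) := by
  rw [opErr, show noisyInv l A δ b * (δ • ser l b) * f = δ • (ser l b * (noisyInv l A δ b * f)) by
    rw [mul_smul_comm, smul_mul_assoc]; congr 1; ring]
  rw [PowerSeries.coeff_smul, PowerSeries.coeff_mul, Finset.Nat.sum_antidiagonal_eq_sum_range_succ
    (fun i j => PowerSeries.coeff i (ser l b) * PowerSeries.coeff j (noisyInv l A δ b * f)),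
    Nat.succ_eq_add_one, ← Fin.sum_univ_eq_sum_range (fun i => PowerSeries.coeff i (ser l b) *
      PowerSeries.coeff (l - i) (noisyInv l A δ b * f))]
  simp_rw [coeff_ser]
  rfl

namespace NoiseBounds

variable {l : ℕ} {A f : ℝ⟦X⟧} {δ F a β : ℝ} (S : NoiseBounds l A f δ F a β)
  {b : Fin (l + 1) → ℝ}
include S

lemma β_pos : 0 < β := by linarith [S.a_le, S.a_pos]

lemma tzOp_f_le : tzOp l f ≤ F := (tzOp_le_sum_abs l f).trans S.sum_le

lemma u_pos : 0 < l2 l A⁻¹ := by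
  have h0 : PowerSeries.coeff 0 A⁻¹ ≠ 0 := by
    rw [PowerSeries.coeff_zero_eq_constantCoeff_apply, PowerSeries.constantCoeff_inv]
    exact inv_ne_zero S.const_ne
  exact (abs_pos.2 h0).trans_le (abs_coeff_le_l2 l _ (Nat.zero_le _))

lemma invPerturb (hb : tzOp l (ser l b) ≤ 2 * β) : InvPerturb l A (δ • ser l b) := by
  refine ⟨S.const_ne, ?_⟩
  rw [tzOp_smul, abs_of_pos S.δ_pos]
  refine le_trans (mul_le_mul_of_nonneg_left ?_ (tzOp_nonneg _ _)) S.small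
  exact mul_le_mul_of_nonneg_left hb S.δ_pos.le

lemma mem_two (hb : b ∈ boundedNoise l a β) : tzOp l (ser l b) ≤ 2 * β := by
  linarith [hb.2, S.β_pos]

lemma flip_two (hb : b ∈ boundedNoise l a β) (k : Fin (l + 1)) :
    tzOp l (ser l (flip k b)) ≤ 2 * β := by
  linarith [tzOp_ser_flip_le k b, hb.2, hb.1 k, S.a_le]

/-- The resolvent identity for a perturbation by a multiple of `X ^ k`. Used once it gives
increments, used twice it replaces the flipped inverse by the original one up to second order. -/
lemma noisyInv_sub_flip (hb : b ∈ boundedNoise l a β) (k : Fin (l + 1)) :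
    noisyInv l A δ (flip k b) = noisyInv l A δ b +
      (2 * δ * b k) • (X ^ (k : ℕ) * (noisyInv l A δ b * noisyInv l A δ (flip k b))) := by
  have h1 := PowerSeries.mul_inv_cancel _ (S.invPerturb (S.mem_two hb)).const_add_ne
  have h2 := PowerSeries.mul_inv_cancel _ (S.invPerturb (S.flip_two hb k)).const_add_ne
  have h3 : δ • ser l (flip k b) = δ • ser l b - (2 * δ * b k) • (X : ℝ⟦X⟧) ^ (k : ℕ) := by
    rw [ser_flip, smul_sub, smul_smul]; congr 2; ring
  simp only [noisyInv]
  set P := (A + δ • ser l b)⁻¹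
  set P' := (A + δ • ser l (flip k b))⁻¹
  have h4 : (A + δ • ser l b) - (A + δ • ser l (flip k b)) = (2 * δ * b k) • (X : ℝ⟦X⟧) ^ (k : ℕ) := by
    rw [h3]; ring
  rw [← smul_mul_assoc, ← h4]
  calc P' = P + (((A + δ • ser l b) * P) * P' - ((A + δ • ser l (flip k b)) * P') * P) := by
        rw [h1, h2]; ring
    _ = _ := by ring

/-- Bound on the coefficients in the expansion of the error. -/
lemma sum_coeff_sq_le (hb : tzOp l (ser l b) ≤ 2 * β) :
    ∑ k : Fin (l + 1), PowerSeries.coeff (l - k) (noisyInv l A δ b * f) ^ 2 ≤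
      (2 * l2 l A⁻¹ * F) ^ 2 := by
  rw [sum_coeff_rev_sq]
  refine pow_le_pow_left₀ (l2_nonneg _ _) ?_ 2
  rw [mul_comm (noisyInv l A δ b)]
  refine (l2_mul_le _ _ _).trans ?_
  rw [mul_comm (2 * _)]
  exact mul_le_mul S.tzOp_f_le (S.invPerturb hb).l2_inv_le (l2_nonneg _ _) S.F_pos.le

lemma abs_coeff_le (hb : tzOp l (ser l b) ≤ 2 * β) (k : Fin (l + 1)) :
    |PowerSeries.coeff (l - k) (noisyInv l A δ b * f)| ≤ 2 * l2 l A⁻¹ * F := by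
  refine abs_le_of_sq_le_sq ((Finset.single_le_sum (f := fun k : Fin (l + 1) =>
    PowerSeries.coeff (l - k) (noisyInv l A δ b * f) ^ 2) (fun _ _ => sq_nonneg _)
    (Finset.mem_univ k)).trans (S.sum_coeff_sq_le hb)) ?_
  have := S.u_pos; have := S.F_pos
  positivity

/-- Cauchy-Schwarz, losing a factor `√(l + 1)`. It serves only for integrability and where a sign
change leaves the truncation set. -/
lemma abs_opErr_le (hb : b ∈ boundedNoise l a β) :
    |opErr l A f δ b| ≤ 2 * Real.sqrt (l + 1) * (δ * a * l2 l A⁻¹ * F) := by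
  have hu := S.u_pos; have hF := S.F_pos; have ha := S.a_pos; have hδ := S.δ_pos
  rw [opErr_eq_sum, abs_neg, abs_mul, abs_of_pos hδ]
  have h : |∑ k : Fin (l + 1), b k * PowerSeries.coeff (l - k) (noisyInv l A δ b * f)| ≤
      Real.sqrt (l + 1) * a * (2 * l2 l A⁻¹ * F) := by
    refine abs_le_of_sq_le_sq ?_ (by positivity)
    refine (Finset.sum_mul_sq_le_sq_mul_sq _ _ _).trans ?_
    rw [mul_pow]
    refine mul_le_mul ?_ (S.sum_coeff_sq_le (S.mem_two hb)) (Finset.sum_nonneg fun _ _ => sq_nonneg _)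
      (sq_nonneg _)
    rw [mul_pow, Real.sq_sqrt (by positivity)]
    calc ∑ k, b k ^ 2 ≤ ∑ k : Fin (l + 1), a ^ 2 := Finset.sum_le_sum fun k _ => by
          rw [← sq_abs]; exact pow_le_pow_left₀ (abs_nonneg _) (hb.1 k) 2
      _ = _ := by rw [Finset.sum_const, Finset.card_univ, Fintype.card_fin, nsmul_eq_mul]; push_cast; ring
  calc _ ≤ δ * (Real.sqrt (l + 1) * a * (2 * l2 l A⁻¹ * F)) := mul_le_mul_of_nonneg_left h hδ.le
    _ = _ := by ring

omit S in
/-- The coefficient of the increment of the error under a change of sign. -/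
noncomputable def incr (l : ℕ) (A f : ℝ⟦X⟧) (δ : ℝ) (b : Fin (l + 1) → ℝ) (k : Fin (l + 1)) : ℝ :=
  PowerSeries.coeff (l - k) (noisyInv l A δ b * noisyInv l A δ (flip k b) * A * f)

lemma opErr_eq (hb : tzOp l (ser l b) ≤ 2 * β) :
    opErr l A f δ b = PowerSeries.coeff l (noisyInv l A δ b * A * f - f) := by
  rw [opErr, noisyInv, (S.invPerturb hb).inv_mul_eq, ← map_neg]
  congr 1; ring

/-- Writing the error as a coefficient of `P A f - f` keeps a factor `A` next to the two inverses,
so that one of them is absorbed by the bound for `P A`. -/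
lemma opErr_flip_sub (hb : b ∈ boundedNoise l a β) (k : Fin (l + 1)) :
    opErr l A f δ (flip k b) - opErr l A f δ b = 2 * δ * b k * incr l A f δ b k := by
  rw [S.opErr_eq (S.mem_two hb), S.opErr_eq (S.flip_two hb k), ← map_sub]
  have e : noisyInv l A δ (flip k b) * A * f - f - (noisyInv l A δ b * A * f - f) =
      (2 * δ * b k) • (X ^ (k : ℕ) * (noisyInv l A δ b * noisyInv l A δ (flip k b) * A * f)) := by
    conv_lhs => rw [S.noisyInv_sub_flip hb k]
    simp only [add_mul, smul_mul_assoc]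
    rw [show ∀ x y : ℝ⟦X⟧, x + y - f - (x - f) = y by intro x y; ring]
    congr 1; ring
  rw [e, PowerSeries.coeff_smul, PowerSeries.coeff_X_pow_mul', if_pos (Nat.lt_succ_iff.1 k.2), incr,
    smul_eq_mul]

/-- To first order the flipped inverse is `P` itself, and the coefficients of the fixed series `P (P
A f)` sum in squares to at most `(4uF)²`. Each second-order term is at most `s`, and `x_le` makes
`(l + 1) s²` at most `(uF)²`. The constant is `2 · 16 + 2`. -/
lemma sum_incr_sq_le (hb : b ∈ boundedNoise l a β) :
    ∑ k : Fin (l + 1), incr l A f δ b k ^ 2 ≤ 34 * (l2 l A⁻¹ * F) ^ 2 := by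
  have hu := S.u_pos; have hF := S.F_pos; have ha := S.a_pos; have hδ := S.δ_pos
  set u := l2 l A⁻¹
  set N := tzOp l A⁻¹
  have hN : 0 ≤ N := tzOp_nonneg _ _
  set P := noisyInv l A δ b with hP
  have hI := S.invPerturb (S.mem_two hb)
  have hPu : l2 l P ≤ 2 * u := hI.l2_inv_le
  have hPA : tzOp l (P * A) ≤ 2 := hI.tzOp_inv_mul_le
  have hPAf : tzOp l (P * A * f) ≤ 2 * F :=
    (tzOp_mul_le _ _ _).trans (mul_le_mul hPA S.tzOp_f_le (tzOp_nonneg _ _) (by norm_num))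
  set s : ℝ := 16 * (δ * a * N) * (u * F)
  have hs0 : 0 ≤ s := by positivity
  have key : ∀ k : Fin (l + 1), incr l A f δ b k ^ 2 ≤
      2 * PowerSeries.coeff (l - k) (P * (P * A * f)) ^ 2 + 2 * s ^ 2 := fun k => by
    set P' := noisyInv l A δ (flip k b) with hP'
    have hP'N : tzOp l P' ≤ 2 * N := (S.invPerturb (S.flip_two hb k)).tzOp_inv_le
    have e : P * P' * A * f = P * (P * A * f) +
        (2 * δ * b k) • (X ^ (k : ℕ) * (P * (P' * (P * A * f)))) := by
      conv_lhs => rw [hP', S.noisyInv_sub_flip hb k, ← hP, ← hP']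
      simp only [add_mul, mul_add, smul_mul_assoc, mul_smul_comm]
      congr 1
      · ring
      · congr 1; ring
    have hsec : |2 * δ * b k * PowerSeries.coeff (l - k) (X ^ (k : ℕ) * (P * (P' * (P * A * f))))| ≤ s := by
      rw [abs_mul, abs_mul, abs_mul, abs_two, abs_of_pos hδ]
      have h1 := abs_coeff_X_pow_mul_le l P (Nat.sub_le l k) k (P' * (P * A * f))
      have h2 : l2 l (P' * (P * A * f)) ≤ 2 * N * (2 * F) :=
        (l2_le_tzOp _ _).trans ((tzOp_mul_le _ _ _).trans
          (mul_le_mul hP'N hPAf (tzOp_nonneg _ _) (by positivity)))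
      have h3 := mul_le_mul hPu h2 (l2_nonneg _ _) (by positivity)
      calc _ ≤ 2 * δ * a * (2 * u * (2 * N * (2 * F))) := by
            gcongr
            · exact hb.1 k
            · exact h1.trans h3
        _ = s := by simp only [s]; ring
    rw [incr, ← hP, ← hP', e, map_add, PowerSeries.coeff_smul, smul_eq_mul]
    set x := PowerSeries.coeff (l - k) (P * (P * A * f))
    set y := 2 * δ * b k * PowerSeries.coeff (l - k) (X ^ (k : ℕ) * (P * (P' * (P * A * f))))
    have hy : y ^ 2 ≤ s ^ 2 := sq_le_sq' (abs_le.1 hsec).1 (abs_le.1 hsec).2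
    nlinarith [sq_nonneg (x - y)]
  refine (Finset.sum_le_sum fun k _ => key k).trans ?_
  rw [Finset.sum_add_distrib, ← Finset.mul_sum, sum_coeff_rev_sq, Finset.sum_const, Finset.card_univ,
    Fintype.card_fin, nsmul_eq_mul]
  have h1 : l2 l (P * (P * A * f)) ≤ 4 * (u * F) := by
    rw [mul_comm P]
    refine (l2_mul_le _ _ _).trans ?_
    calc _ ≤ 2 * F * (2 * u) := mul_le_mul hPAf hPu (l2_nonneg _ _) (by positivity)
      _ = _ := by ring
  have h1' := pow_le_pow_left₀ (l2_nonneg _ _) h1 2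
  have h2 : ((l + 1 : ℕ) : ℝ) * s ^ 2 ≤ (u * F) ^ 2 := by
    have hx := S.x_le
    have hx' := pow_le_pow_left₀ (by positivity) hx 2
    rw [mul_pow, Real.sq_sqrt (by positivity)] at hx'
    have : ((l + 1 : ℕ) : ℝ) * s ^ 2 =
        256 * ((δ * a * N) ^ 2 * (l + 1)) * (u * F) ^ 2 := by
      simp only [s]; push_cast; ring
    rw [this]
    have : 256 * ((δ * a * N) ^ 2 * (l + 1)) ≤ 1 := by linarith
    exact mul_le_of_le_one_left (sq_nonneg _) this
  nlinarith

/-- The first-order increment is a coefficient of index `l - 2k` of the fixed series `P P f`.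
Cauchy-Schwarz costs `√(l + 1)`, and with `x = δ a N √(l + 1)`, where `N` is the spectral norm of
the inverse, the total is `(8x + 32x²) uF`. The hypothesis `x_le` makes the factor at most one. -/
lemma sum_abs_coeff_sub_le (hb : b ∈ boundedNoise l a β) :
    ∑ k : Fin (l + 1), |PowerSeries.coeff (l - k) (noisyInv l A δ b * f) -
      PowerSeries.coeff (l - k) (noisyInv l A δ (flip k b) * f)| ≤ l2 l A⁻¹ * F := by
  have hu := S.u_pos; have hF := S.F_pos; have ha := S.a_pos; have hδ := S.δ_pos
  set u := l2 l A⁻¹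
  set N := tzOp l A⁻¹
  have hN : 0 ≤ N := tzOp_nonneg _ _
  set P := noisyInv l A δ b with hP
  have hI := S.invPerturb (S.mem_two hb)
  have hPu : l2 l P ≤ 2 * u := hI.l2_inv_le
  have hPN : tzOp l P ≤ 2 * N := hI.tzOp_inv_le
  set s : ℝ := 16 * δ * a * u * N ^ 2 * F
  have key : ∀ k : Fin (l + 1), |PowerSeries.coeff (l - k) (P * f) -
      PowerSeries.coeff (l - k) (noisyInv l A δ (flip k b) * f)| ≤
      2 * δ * a * (|PowerSeries.coeff (l - k) (X ^ (k : ℕ) * (P * P * f))| + s) := fun k => by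
    set P' := noisyInv l A δ (flip k b) with hP'
    have hP'N : tzOp l P' ≤ 2 * N := (S.invPerturb (S.flip_two hb k)).tzOp_inv_le
    have e1 : P' * f = P * f + (2 * δ * b k) • (X ^ (k : ℕ) * (P * P' * f)) := by
      conv_lhs => rw [hP', S.noisyInv_sub_flip hb k, ← hP, ← hP']
      simp only [add_mul, smul_mul_assoc]
      congr 2; ring
    have e2 : X ^ (k : ℕ) * (P * P' * f) = X ^ (k : ℕ) * (P * P * f) +
        (2 * δ * b k) • (X ^ ((k : ℕ) + k) * (P * (P * P' * f))) := by
      conv_lhs => rw [hP', S.noisyInv_sub_flip hb k, ← hP, ← hP']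
      simp only [add_mul, mul_add, smul_mul_assoc, mul_smul_comm]
      congr 2; ring
    have hsec : |2 * δ * b k * PowerSeries.coeff (l - k) (X ^ ((k : ℕ) + k) * (P * (P * P' * f)))| ≤ s := by
      rw [abs_mul, abs_mul, abs_mul, abs_two, abs_of_pos hδ]
      have h1 := abs_coeff_X_pow_mul_le l P (Nat.sub_le l k) (k + k) (P * P' * f)
      have h2 : l2 l (P * P' * f) ≤ 2 * N * (2 * N) * F := by
        refine (l2_le_tzOp _ _).trans ((tzOp_mul_le _ _ _).trans
          (mul_le_mul ?_ S.tzOp_f_le (tzOp_nonneg _ _) (by positivity)))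
        exact (tzOp_mul_le _ _ _).trans (mul_le_mul hPN hP'N (tzOp_nonneg _ _) (by positivity))
      have h3 := mul_le_mul hPu h2 (l2_nonneg _ _) (by positivity)
      calc _ ≤ 2 * δ * a * (2 * u * (2 * N * (2 * N) * F)) := by
            gcongr
            · exact hb.1 k
            · exact h1.trans h3
        _ = s := by simp only [s]; ring
    rw [e1, map_add, PowerSeries.coeff_smul, e2, map_add, PowerSeries.coeff_smul, smul_eq_mul,
      smul_eq_mul, sub_add_cancel_left, abs_neg, abs_mul, abs_mul, abs_mul, abs_two, abs_of_pos hδ]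
    gcongr
    · exact hb.1 k
    · exact (abs_add_le _ _).trans (add_le_add le_rfl hsec)
  refine (Finset.sum_le_sum fun k _ => key k).trans ?_
  rw [← Finset.mul_sum, Finset.sum_add_distrib, Finset.sum_const, Finset.card_univ, Fintype.card_fin,
    nsmul_eq_mul]
  have h1 := sum_abs_coeff_X_pow_mul_le l (P * P * f)
  have h2 : l2 l (P * P * f) ≤ 4 * (N * (u * F)) := by
    rw [show P * P * f = (P * f) * P by ring]
    refine (l2_mul_le _ _ _).trans ?_
    calc _ ≤ 2 * N * F * (2 * u) := mul_le_mul ((tzOp_mul_le _ _ _).trans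
          (mul_le_mul hPN S.tzOp_f_le (tzOp_nonneg _ _) (by positivity))) hPu (l2_nonneg _ _)
          (by positivity)
      _ = _ := by ring
  have h3 := mul_le_mul_of_nonneg_left h2 (Real.sqrt_nonneg ((l : ℝ) + 1))
  have hx := S.x_le
  set r := Real.sqrt ((l : ℝ) + 1) with hr
  have hr0 : 0 ≤ r := Real.sqrt_nonneg _
  have hr2 : ((l + 1 : ℕ) : ℝ) = r ^ 2 := by rw [hr, Real.sq_sqrt (by positivity)]; push_cast; ring
  set x := δ * a * N * r with hxdef
  have hx0 : 0 ≤ x := by positivity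
  calc _ ≤ 2 * δ * a * (r * (4 * (N * (u * F))) + ((l + 1 : ℕ) : ℝ) * s) := by
        gcongr; exact h1.trans h3
    _ = (8 * x + 32 * x ^ 2) * (u * F) := by rw [hr2, hxdef]; simp only [s]; ring
    _ ≤ 1 * (u * F) := by
        refine mul_le_mul_of_nonneg_right ?_ (by positivity)
        nlinarith
    _ = _ := one_mul _

end NoiseBounds

end Deterministic

/-! ### Measurability of random power series. -/

section Measurability

open PowerSeries

variable {Ω : Type*} [MeasurableSpace Ω]

/-- A random power series with measurable coefficients. -/
def CoeffMeasurable (p : Ω → ℝ⟦X⟧) : Prop := ∀ n, Measurable fun ω => PowerSeries.coeff n (p ω)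

lemma CoeffMeasurable.const (p : ℝ⟦X⟧) : CoeffMeasurable fun _ : Ω => p := fun _ =>
  measurable_const

lemma CoeffMeasurable.add {p q : Ω → ℝ⟦X⟧} (hp : CoeffMeasurable p) (hq : CoeffMeasurable q) :
    CoeffMeasurable fun ω => p ω + q ω := fun n => by
  simp only [map_add]; exact (hp n).add (hq n)

lemma CoeffMeasurable.smul {p : Ω → ℝ⟦X⟧} (hp : CoeffMeasurable p) (c : ℝ) :
    CoeffMeasurable fun ω => c • p ω := fun n => by
  simpa only [PowerSeries.coeff_smul, smul_eq_mul] using (hp n).const_mul c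

lemma CoeffMeasurable.mul {p q : Ω → ℝ⟦X⟧} (hp : CoeffMeasurable p) (hq : CoeffMeasurable q) :
    CoeffMeasurable fun ω => p ω * q ω := fun n => by
  simp only [PowerSeries.coeff_mul]
  exact Finset.measurable_sum _ fun x _ => (hp x.1).mul (hq x.2)

/-- The coefficients of the inverse satisfy a recursion on lower ones; the case of a vanishing
constant coefficient is included, the inverse of `0` being `0`. -/
lemma CoeffMeasurable.inv {p : Ω → ℝ⟦X⟧} (hp : CoeffMeasurable p) :
    CoeffMeasurable fun ω => (p ω)⁻¹ := fun n => by
  have h0 : Measurable fun ω => constantCoeff (p ω) := by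
    simpa only [PowerSeries.coeff_zero_eq_constantCoeff_apply] using hp 0
  induction n using Nat.strong_induction_on with
  | _ n ih =>
  have e := funext fun ω => PowerSeries.coeff_inv n (p ω)
  by_cases hn : n = 0
  · simp only [hn, if_true] at e; rw [hn, e]; exact h0.inv
  · simp only [hn, if_false] at e
    rw [e]
    refine h0.inv.neg.mul (Finset.measurable_sum _ fun x _ => ?_)
    by_cases hx : x.2 < n
    · simp only [hx, if_true]; exact (hp x.1).mul (ih x.2 hx)
    · simp only [hx, if_false]; exact measurable_const

lemma coeffMeasurable_ser (l : ℕ) : CoeffMeasurable (ser l) := fun n => by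
  simp only [ser, PowerSeries.coeff_mk]
  split_ifs
  · exact measurable_pi_apply _
  · exact measurable_const

lemma CoeffMeasurable.tz_apply {p : Ω → ℝ⟦X⟧} (hp : CoeffMeasurable p) (l : ℕ) (i j : Fin (l + 1)) :
    Measurable fun ω => tz l (p ω) i j := by
  simp only [tz, toeplitz, Matrix.of_apply]
  split_ifs
  · exact hp _
  · exact measurable_const

lemma CoeffMeasurable.tzOp {p : Ω → ℝ⟦X⟧} (hp : CoeffMeasurable p) (l : ℕ) :
    Measurable fun ω => tzOp l (p ω) := by
  have h1 : Continuous fun M : Fin (l + 1) → Fin (l + 1) → ℝ => opNorm (Matrix.of M) :=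
    continuous_opNorm.comp continuous_id
  have h2 : Measurable fun ω => fun i j => tz l (p ω) i j :=
    measurable_pi_lambda _ fun i => measurable_pi_lambda _ fun j => hp.tz_apply l i j
  exact h1.measurable.comp h2

lemma coeffMeasurable_noisyInv (l : ℕ) (A : ℝ⟦X⟧) (δ : ℝ) : CoeffMeasurable (noisyInv l A δ) :=
  ((CoeffMeasurable.const A).add ((coeffMeasurable_ser l).smul δ)).inv

lemma measurable_opErr (l : ℕ) (A f : ℝ⟦X⟧) (δ : ℝ) : Measurable (opErr l A f δ) :=
  ((((coeffMeasurable_noisyInv l A δ).mul ((coeffMeasurable_ser l).smul δ)).mul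
    (CoeffMeasurable.const f)) l).neg

lemma measurable_flip {l : ℕ} (k : Fin (l + 1)) : Measurable (flip k) :=
  (measurePreserving_flip k).measurable

lemma measurableSet_boundedNoise (l : ℕ) (a β : ℝ) : MeasurableSet (boundedNoise l a β) := by
  have : boundedNoise l a β = (⋂ k, {b | |b k| ≤ a}) ∩ {b | tzOp l (ser l b) ≤ β} := by
    ext b; simp [boundedNoise]
  rw [this]
  refine MeasurableSet.inter (MeasurableSet.iInter fun k => ?_) ?_
  · exact measurableSet_le (measurable_pi_apply k).abs measurable_const
  · exact measurableSet_le ((coeffMeasurable_ser l).tzOp l) measurable_const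

end Measurability

/-! ### Concentration of the operator error by exchange of signs. -/

section Concentration

open PowerSeries

lemma abs_pow_sub_pow_le (x y : ℝ) (n : ℕ) :
    |x ^ (n + 1) - y ^ (n + 1)| ≤ (n + 1) * |x - y| * (|x| ^ n + |y| ^ n) := by
  have hmax : ∀ i ∈ Finset.range (n + 1), |x ^ i * y ^ (n - i)| ≤ |x| ^ n + |y| ^ n := by
    intro i hi
    have hi' : i ≤ n := Nat.lt_succ_iff.1 (Finset.mem_range.1 hi)
    rw [abs_mul, abs_pow, abs_pow]
    rcases le_total |x| |y| with h | h
    · calc |x| ^ i * |y| ^ (n - i) ≤ |y| ^ i * |y| ^ (n - i) := by gcongr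
        _ = |y| ^ n := by rw [← pow_add]; congr 1; omega
        _ ≤ _ := le_add_of_nonneg_left (by positivity)
    · calc |x| ^ i * |y| ^ (n - i) ≤ |x| ^ i * |x| ^ (n - i) := by gcongr
        _ = |x| ^ n := by rw [← pow_add]; congr 1; omega
        _ ≤ _ := le_add_of_nonneg_right (by positivity)
  have h := Commute.geom_sum₂_mul (Commute.all x y) (n + 1)
  rw [← h, abs_mul]
  have hs : |∑ i ∈ Finset.range (n + 1), x ^ i * y ^ (n + 1 - 1 - i)| ≤
      (n + 1) * (|x| ^ n + |y| ^ n) := by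
    refine (Finset.abs_sum_le_sum_abs _ _).trans ((Finset.sum_le_sum hmax).trans ?_)
    rw [Finset.sum_const, Finset.card_range, nsmul_eq_mul]; push_cast; exact le_rfl
  calc _ ≤ (n + 1) * (|x| ^ n + |y| ^ n) * |x - y| :=
        mul_le_mul_of_nonneg_right hs (abs_nonneg _)
    _ = _ := by ring

/-- Symmetric bound for the increment of `c x ^ q`. -/
lemma abs_mul_pow_sub_le (c c' x x' : ℝ) (n : ℕ) :
    |c * x ^ (n + 1) - c' * x' ^ (n + 1)| ≤
      (1 / 2 * |c - c'| * |x| ^ (n + 1) +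
        1 / 2 * (n + 1) * |x' - x| * (2 * |c| + |c - c'|) * |x| ^ n) +
      (1 / 2 * |c - c'| * |x'| ^ (n + 1) +
        1 / 2 * (n + 1) * |x' - x| * (2 * |c'| + |c - c'|) * |x'| ^ n) := by
  -- A symmetric product rule, so that the bound splits into one term at each of the two points,
  -- exchanged by the sign change.
  have e : c * x ^ (n + 1) - c' * x' ^ (n + 1) =
      1 / 2 * (c - c') * (x ^ (n + 1) + x' ^ (n + 1)) +
        1 / 2 * (c + c') * (x ^ (n + 1) - x' ^ (n + 1)) := by ring
  have h1 := abs_pow_sub_pow_le x x' n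
  have hc1 : |c + c'| ≤ 2 * |c| + |c - c'| := by
    have : c + c' = 2 * c - (c - c') := by ring
    rw [this]; refine (abs_sub _ _).trans ?_; rw [abs_mul, abs_two]
  have hc2 : |c + c'| ≤ 2 * |c'| + |c - c'| := by
    have : c + c' = 2 * c' + (c - c') := by ring
    rw [this]; refine (abs_add_le _ _).trans ?_; rw [abs_mul, abs_two]
  rw [abs_sub_comm x x'] at h1
  rw [e]
  refine (abs_add_le _ _).trans ?_
  have hA : |1 / 2 * (c - c') * (x ^ (n + 1) + x' ^ (n + 1))| ≤
      1 / 2 * |c - c'| * (|x| ^ (n + 1) + |x'| ^ (n + 1)) := by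
    rw [abs_mul, abs_mul, abs_of_pos (show (0 : ℝ) < 1 / 2 by norm_num), ← abs_pow, ← abs_pow]
    exact mul_le_mul_of_nonneg_left (abs_add_le _ _) (by positivity)
  have hB : |1 / 2 * (c + c') * (x ^ (n + 1) - x' ^ (n + 1))| ≤
      1 / 2 * (n + 1) * |x' - x| * (2 * |c| + |c - c'|) * |x| ^ n +
      1 / 2 * (n + 1) * |x' - x| * (2 * |c'| + |c - c'|) * |x'| ^ n := by
    rw [abs_mul, abs_mul, abs_of_pos (show (0 : ℝ) < 1 / 2 by norm_num)]
    calc _ ≤ 1 / 2 * |c + c'| * ((n + 1) * |x' - x| * (|x| ^ n + |x'| ^ n)) :=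
          mul_le_mul_of_nonneg_left h1 (by positivity)
      _ = 1 / 2 * (n + 1) * |x' - x| * |c + c'| * |x| ^ n +
          1 / 2 * (n + 1) * |x' - x| * |c + c'| * |x'| ^ n := by ring
      _ ≤ _ := by gcongr
  linarith

lemma pow_le_one_add_pow {x : ℝ} (hx : 0 ≤ x) {m n : ℕ} (h : m ≤ n) : x ^ m ≤ 1 + x ^ n := by
  rcases le_total x 1 with h1 | h1
  · exact (pow_le_one₀ hx h1).trans (le_add_of_nonneg_right (by positivity))
  · exact (pow_le_pow_right₀ h1 h).trans (le_add_of_nonneg_left zero_le_one)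

/-- The remainder in the exchange of the sign of the coordinate `k`. -/
noncomputable def flipRem {l : ℕ} (k : Fin (l + 1)) (n : ℕ) (X : Set (Fin (l + 1) → ℝ))
    (c x : (Fin (l + 1) → ℝ) → ℝ) (b : Fin (l + 1) → ℝ) : ℝ :=
  1 / 2 * |c b - c (flip k b)| * |x b| ^ (2 * n + 1) +
    1 / 2 * (2 * n + 1) * |x (flip k b) - x b| * (2 * |c b| + |c b - c (flip k b)|) *
      |x b| ^ (2 * n) +
    X.indicator (fun b => |c b| * |x b| ^ (2 * n + 1)) b

lemma measurable_flipRem {l : ℕ} (k : Fin (l + 1)) (n : ℕ) {X : Set (Fin (l + 1) → ℝ)}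
    {c x : (Fin (l + 1) → ℝ) → ℝ} (hX : MeasurableSet X) (hc : Measurable c) (hx : Measurable x) :
    Measurable (flipRem k n X c x) := by
  have h1 : Measurable fun b => |c b - c (flip k b)| := (hc.sub (hc.comp (measurable_flip k))).abs
  have h2 : Measurable fun b => |x (flip k b) - x b| := ((hx.comp (measurable_flip k)).sub hx).abs
  have h3 := hc.abs
  have h4 := hx.abs
  exact Measurable.add (by fun_prop) (Measurable.indicator (by fun_prop) hX)

/-- The exchange of the sign of the coordinate `k`. -/
lemma abs_integral_indicator_le_flipRem {l : ℕ} (k : Fin (l + 1)) (n : ℕ)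
    {E X : Set (Fin (l + 1) → ℝ)} {c x : (Fin (l + 1) → ℝ) → ℝ} {a : ℝ} (ha : 0 ≤ a)
    (hEa : ∀ b ∈ E, |b k| ≤ a) (hEX : ∀ b ∈ E, b ∉ X → flip k b ∈ E)
    (hi : Integrable (E.indicator fun b => b k * (c b * x b ^ (2 * n + 1))) (gaussVec l))
    (hR : Integrable (E.indicator (flipRem k n X c x)) (gaussVec l)) :
    |∫ b, E.indicator (fun b => b k * (c b * x b ^ (2 * n + 1))) b ∂gaussVec l| ≤
      a * ∫ b, E.indicator (flipRem k n X c x) b ∂gaussVec l := by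
  have hflip : ∀ φ : (Fin (l + 1) → ℝ) → ℝ, Integrable φ (gaussVec l) →
      ∫ b, φ (flip k b) ∂gaussVec l = ∫ b, φ b ∂gaussVec l := fun φ hφ => by
    have := integral_map (measurable_flip k).aemeasurable (f := φ) (μ := gaussVec l)
      (by rw [(measurePreserving_flip k).map_eq]; exact hφ.aestronglyMeasurable)
    rw [← this, (measurePreserving_flip k).map_eq]
  have hint : ∀ φ : (Fin (l + 1) → ℝ) → ℝ, Integrable φ (gaussVec l) →
      Integrable (fun b => φ (flip k b)) (gaussVec l) := fun φ hφ =>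
    (measurePreserving_flip k).integrable_comp_of_integrable hφ
  set R := flipRem k n X c x with hRdef
  set h : (Fin (l + 1) → ℝ) → ℝ := E.indicator fun b => b k * (c b * x b ^ (2 * n + 1)) with hh
  -- Averaging over `b` and `flip k b` leaves only a difference, since the factor `b k` changes
  -- sign.
  have e1 : ∫ b, h b ∂gaussVec l = 1 / 2 * ∫ b, (h b + h (flip k b)) ∂gaussVec l := by
    rw [integral_add hi (hint _ hi), hflip _ hi]; ring
  have e2 : a * ∫ b, E.indicator R b ∂gaussVec l =
      1 / 2 * ∫ b, a * (E.indicator R b + E.indicator R (flip k b)) ∂gaussVec l := by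
    rw [integral_const_mul, integral_add hR (hint _ hR), hflip _ hR]; ring
  rw [e1, e2, abs_mul, abs_of_pos (show (0 : ℝ) < 1 / 2 by norm_num)]
  refine mul_le_mul_of_nonneg_left ?_ (by norm_num)
  refine abs_integral_le_integral_abs.trans (integral_mono (hi.add (hint _ hi)).abs
    ((hR.add (hint _ hR)).const_mul a) fun b => ?_)
  -- With no partner in `E`, nothing cancels; the whole term is charged to the indicator of `X` in
  -- the remainder.
  have hout : ∀ b, b ∈ E → flip k b ∉ E → |h b + h (flip k b)| ≤
      a * (E.indicator R b + E.indicator R (flip k b)) := fun b hb hb' => by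
    have hX' : b ∈ X := by by_contra hcon; exact hb' (hEX b hb hcon)
    rw [hh, Set.indicator_of_mem hb, Set.indicator_of_notMem hb', Set.indicator_of_mem hb,
      Set.indicator_of_notMem hb', add_zero, add_zero, hRdef, flipRem, Set.indicator_of_mem hX',
      abs_mul, abs_mul, abs_pow]
    refine mul_le_mul (hEa b hb) ?_ (by positivity) ha
    exact le_add_of_nonneg_left (by positivity)
  by_cases hb : b ∈ E
  · by_cases hb' : flip k b ∈ E
    · show |h b + h (flip k b)| ≤ a * (E.indicator R b + E.indicator R (flip k b))
      rw [hh, Set.indicator_of_mem hb, Set.indicator_of_mem hb', Set.indicator_of_mem hb,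
        Set.indicator_of_mem hb', flip_apply_self]
      have e3 : b k * (c b * x b ^ (2 * n + 1)) + -b k * (c (flip k b) * x (flip k b) ^ (2 * n + 1)) =
          b k * (c b * x b ^ (2 * n + 1) - c (flip k b) * x (flip k b) ^ (2 * n + 1)) := by
        ring
      rw [e3, abs_mul]
      refine mul_le_mul (hEa b hb) ?_ (abs_nonneg _) ha
      refine (abs_mul_pow_sub_le _ _ _ _ _).trans ?_
      have hi0 : ∀ b, 0 ≤ X.indicator (fun b => |c b| * |x b| ^ (2 * n + 1)) b := fun b =>
        Set.indicator_nonneg (fun _ _ => by positivity) b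
      rw [hRdef, flipRem, flipRem, flip_flip, abs_sub_comm (c (flip k b)) (c b),
        abs_sub_comm (x b) (x (flip k b))]
      have q1 := hi0 b; have q2 := hi0 (flip k b)
      push_cast
      linarith
    · exact hout b hb hb'
  · by_cases hb' : flip k b ∈ E
    · have := hout (flip k b) hb' (by rwa [flip_flip])
      rw [flip_flip] at this
      simpa only [add_comm] using this
    · show |h b + h (flip k b)| ≤ a * (E.indicator R b + E.indicator R (flip k b))
      rw [hh, Set.indicator_of_notMem hb, Set.indicator_of_notMem hb', Set.indicator_of_notMem hb,
        Set.indicator_of_notMem hb', add_zero, abs_zero, mul_zero]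

namespace NoiseBounds

variable {l : ℕ} {A f : ℝ⟦X⟧} {δ F a β : ℝ} (S : NoiseBounds l A f δ F a β)
include S

set_option maxHeartbeats 1000000 in
/-- The moment of order `2p` of the truncated error due to the operator noise, by exchanging the
signs of the coordinates of the noise one at a time. -/
lemma moment_le (n : ℕ) {T : ℝ} (hT : T = 16 * Real.sqrt (n + 1) * (δ * a * l2 l A⁻¹ * F)) :
    ∫ b in boundedNoise l a β, (|opErr l A f δ b| / T) ^ (2 * n + 2) ∂gaussVec l ≤
      1 + 2 * ((l + 1) ^ (n + 2) * (gaussVec l).real {b | β < tzOp l (ser l b)}) := by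
  have hu := S.u_pos; have hF := S.F_pos; have ha := S.a_pos; have hδ := S.δ_pos
  set u := l2 l A⁻¹ with hudef
  set D := δ * a * u * F with hD
  have hDpos : 0 < D := by positivity
  set E := boundedNoise l a β with hE
  have hEm : MeasurableSet E := measurableSet_boundedNoise l a β
  set μ := gaussVec l with hμ
  have hn1 : (1 : ℝ) ≤ Real.sqrt (n + 1) := Real.one_le_sqrt.2 (by linarith [n.cast_nonneg (α := ℝ)])
  have hTpos : 0 < T := by rw [hT]; positivity
  -- The normalization `T` contains `√(n + 1)` because the variation of the power of the error
  -- produces a factor of order `n`, paired with `(D / T) ^ 2`.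
  have hTD : D / T ≤ 1 / 16 := by
    rw [div_le_iff₀ hTpos, hT]; nlinarith
  have hTD2 : (n + 1 : ℝ) * (D / T) ^ 2 = 1 / 256 := by
    rw [hT, div_pow, mul_pow _ D, mul_pow 16, Real.sq_sqrt (by positivity)]; field_simp; norm_num
  set x : (Fin (l + 1) → ℝ) → ℝ := fun b => opErr l A f δ b / T with hx
  have hxm : Measurable x := (measurable_opErr l A f δ).div_const T
  set c : Fin (l + 1) → (Fin (l + 1) → ℝ) → ℝ :=
    fun k b => PowerSeries.coeff (l - k) (noisyInv l A δ b * f) with hc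
  have hcm : ∀ k, Measurable (c k) := fun k =>
    ((coeffMeasurable_noisyInv l A δ).mul (CoeffMeasurable.const f)) (l - k)
  have hfm : ∀ k : Fin (l + 1), Measurable (flip k) := fun k => measurable_flip k
  set d : Fin (l + 1) → (Fin (l + 1) → ℝ) → ℝ := fun k b => |c k b - c k (flip k b)| with hd
  set Δ : Fin (l + 1) → (Fin (l + 1) → ℝ) → ℝ := fun k b => |x (flip k b) - x b| with hΔ
  -- A sign change preserves the bounds on the coordinates, so only the bound on the spectral norm
  -- can fail after it.
  set X : Fin (l + 1) → Set (Fin (l + 1) → ℝ) := fun k => {b | β < tzOp l (ser l (flip k b))} with hX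
  have hXm : ∀ k, MeasurableSet (X k) := fun k =>
    measurableSet_lt measurable_const (((coeffMeasurable_ser l).tzOp l).comp (hfm k))
  set R : Fin (l + 1) → (Fin (l + 1) → ℝ) → ℝ := fun k => flipRem k n (X k) (c k) x with hR
  have hRm : ∀ k, Measurable (R k) := fun k => measurable_flipRem k n (hXm k) (hcm k) hxm
  have hcb : ∀ b ∈ E, ∀ k, |c k b| ≤ 2 * u * F := fun b hb k => S.abs_coeff_le (S.mem_two hb) k
  have hcb' : ∀ b ∈ E, ∀ k, |c k (flip k b)| ≤ 2 * u * F := fun b hb k =>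
    S.abs_coeff_le (S.flip_two hb k) k
  have hxb : ∀ b ∈ E, |x b| ≤ Real.sqrt (l + 1) := fun b hb => by
    simp only [hx]
    rw [abs_div, abs_of_pos hTpos, div_le_iff₀ hTpos]
    refine (S.abs_opErr_le hb).trans ?_
    rw [← hudef, ← hD]
    have := (div_le_iff₀ hTpos).1 hTD
    nlinarith [Real.sqrt_nonneg ((l : ℝ) + 1)]
  have hΔb : ∀ b ∈ E, ∀ k, Δ k b ≤ 2 * δ * a / T * |incr l A f δ b k| := fun b hb k => by
    simp only [hΔ, hx]
    rw [← sub_div, S.opErr_flip_sub hb, abs_div, abs_of_pos hTpos, abs_mul, abs_mul, abs_mul,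
      abs_two, abs_of_pos hδ, div_mul_eq_mul_div]
    gcongr
    exact hb.1 k
  have hincr : ∀ b ∈ E, ∀ k, |incr l A f δ b k| ≤ 6 * (u * F) := fun b hb k => by
    refine abs_le_of_sq_le_sq ?_ (by positivity)
    refine (Finset.single_le_sum (f := fun k => incr l A f δ b k ^ 2) (fun _ _ => sq_nonneg _)
      (Finset.mem_univ k)).trans ((S.sum_incr_sq_le hb).trans ?_)
    rw [mul_pow]; nlinarith [sq_nonneg (u * F)]
  have hsumd : ∀ b ∈ E, ∑ k, d k b ≤ u * F := fun b hb => S.sum_abs_coeff_sub_le hb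
  have hsumcd : ∀ b ∈ E, ∑ k, |incr l A f δ b k| * (2 * |c k b| + d k b) ≤ 30 * (u * F) ^ 2 :=
    fun b hb => by
    have h1 : ∑ k, |incr l A f δ b k| * |c k b| ≤ 12 * (u * F) ^ 2 := by
      refine abs_le_of_sq_le_sq' ?_ (by positivity) |>.2
      refine (Finset.sum_mul_sq_le_sq_mul_sq _ _ _).trans ?_
      simp_rw [sq_abs]
      calc _ ≤ (34 * (u * F) ^ 2) * (2 * u * F) ^ 2 :=
            mul_le_mul (S.sum_incr_sq_le hb) (S.sum_coeff_sq_le (S.mem_two hb))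
              (Finset.sum_nonneg fun _ _ => sq_nonneg _) (by positivity)
        _ = 136 * ((u * F) ^ 2) ^ 2 := by ring
        _ ≤ _ := by nlinarith [sq_nonneg ((u * F) ^ 2)]
    have h2 : ∑ k, |incr l A f δ b k| * d k b ≤ 6 * (u * F) ^ 2 := by
      calc _ ≤ ∑ k, 6 * (u * F) * d k b := Finset.sum_le_sum fun k _ =>
            mul_le_mul_of_nonneg_right (hincr b hb k) (abs_nonneg _)
        _ = 6 * (u * F) * ∑ k, d k b := by rw [Finset.mul_sum]
        _ ≤ 6 * (u * F) * (u * F) := mul_le_mul_of_nonneg_left (hsumd b hb) (by positivity)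
        _ = _ := by ring
    have e : ∑ k, |incr l A f δ b k| * (2 * |c k b| + d k b) =
        2 * ∑ k, |incr l A f δ b k| * |c k b| + ∑ k, |incr l A f δ b k| * d k b := by
      rw [Finset.mul_sum, ← Finset.sum_add_distrib]
      exact Finset.sum_congr rfl fun k _ => by ring
    rw [e]; linarith
  -- pointwise bound for the sum of the remainders
  have hRsum : ∀ b ∈ E, δ * a / T * ∑ k, R k b ≤
      1 / 2 * (1 + |x b| ^ (2 * n + 2)) +
        (l + 1 : ℝ) ^ (n + 1) * ∑ k, (X k).indicator (fun _ => (1 : ℝ)) b := fun b hb => by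
    have e : ∑ k, R k b = 1 / 2 * (∑ k, d k b) * |x b| ^ (2 * n + 1) +
        1 / 2 * (2 * n + 1) * (∑ k, Δ k b * (2 * |c k b| + d k b)) * |x b| ^ (2 * n) +
        ∑ k, (X k).indicator (fun b => |c k b| * |x b| ^ (2 * n + 1)) b := by
      simp only [hR, flipRem]
      rw [Finset.sum_add_distrib, Finset.sum_add_distrib, Finset.mul_sum, Finset.mul_sum,
        Finset.sum_mul, Finset.sum_mul]
      congr 2
      exact Finset.sum_congr rfl fun k _ => by ring
    have hs : ∑ k, Δ k b * (2 * |c k b| + d k b) ≤ 2 * δ * a / T * (30 * (u * F) ^ 2) := by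
      calc _ ≤ ∑ k, 2 * δ * a / T * (|incr l A f δ b k| * (2 * |c k b| + d k b)) := by
            refine Finset.sum_le_sum fun k _ => ?_
            rw [← mul_assoc]
            exact mul_le_mul_of_nonneg_right (hΔb b hb k) (by positivity)
        _ = 2 * δ * a / T * ∑ k, |incr l A f δ b k| * (2 * |c k b| + d k b) := by
            rw [Finset.mul_sum]
        _ ≤ _ := mul_le_mul_of_nonneg_left (hsumcd b hb) (by positivity)
    have hind : ∑ k, (X k).indicator (fun b => |c k b| * |x b| ^ (2 * n + 1)) b ≤
        2 * u * F * (l + 1 : ℝ) ^ (n + 1) * ∑ k, (X k).indicator (fun _ => (1 : ℝ)) b := by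
      rw [Finset.mul_sum]
      refine Finset.sum_le_sum fun k _ => ?_
      by_cases hk : b ∈ X k
      · rw [Set.indicator_of_mem hk, Set.indicator_of_mem hk, mul_one]
        refine mul_le_mul (hcb b hb k) ?_ (by positivity) (by positivity)
        have hr1 : 1 ≤ Real.sqrt ((l : ℝ) + 1) :=
          Real.one_le_sqrt.2 (by linarith [l.cast_nonneg (α := ℝ)])
        calc |x b| ^ (2 * n + 1) ≤ Real.sqrt (l + 1) ^ (2 * n + 1) :=
              pow_le_pow_left₀ (abs_nonneg _) (hxb b hb) _
          _ ≤ Real.sqrt (l + 1) ^ (2 * (n + 1)) := pow_le_pow_right₀ hr1 (by omega)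
          _ = _ := by rw [pow_mul, Real.sq_sqrt (by positivity)]
      · rw [Set.indicator_of_notMem hk, Set.indicator_of_notMem hk, mul_zero]
    have hI0 : 0 ≤ ∑ k, (X k).indicator (fun _ => (1 : ℝ)) b :=
      Finset.sum_nonneg fun k _ => Set.indicator_nonneg (fun _ _ => zero_le_one) _
    set I := ∑ k, (X k).indicator (fun _ => (1 : ℝ)) b
    have hp1 := pow_le_one_add_pow (abs_nonneg (x b)) (show 2 * n + 1 ≤ 2 * n + 2 by omega)
    have hp2 := pow_le_one_add_pow (abs_nonneg (x b)) (show 2 * n ≤ 2 * n + 2 by omega)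
    set Y := 1 + |x b| ^ (2 * n + 2)
    have hY : 0 ≤ Y := by positivity
    rw [e]
    calc _ ≤ δ * a / T * (1 / 2 * (u * F) * Y +
          1 / 2 * (2 * n + 1) * (2 * δ * a / T * (30 * (u * F) ^ 2)) * Y +
          2 * u * F * (l + 1 : ℝ) ^ (n + 1) * I) := by
          have := hsumd b hb
          gcongr
      _ = 1 / 2 * (D / T) * Y + 30 * (2 * n + 1) * (D / T) ^ 2 * Y +
          2 * (D / T) * ((l + 1 : ℝ) ^ (n + 1) * I) := by rw [hD]; ring
      _ ≤ 1 / 4 * Y + 1 / 4 * Y + 1 * ((l + 1 : ℝ) ^ (n + 1) * I) := by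
          have h1 : 1 / 2 * (D / T) ≤ 1 / 4 := by linarith
          have h2 : 30 * (2 * n + 1) * (D / T) ^ 2 ≤ 1 / 4 := by nlinarith [sq_nonneg (D / T)]
          have h3 : 2 * (D / T) ≤ 1 := by linarith
          gcongr
      _ = _ := by ring
  -- the moment as a sum
  set h : Fin (l + 1) → (Fin (l + 1) → ℝ) → ℝ := fun k =>
    E.indicator fun b => b k * (c k b * x b ^ (2 * n + 1)) with hh
  have hhm : ∀ k, Measurable (h k) := fun k => by
    have := hcm k
    exact Measurable.indicator (by fun_prop) hEm
  have bdd : ∀ (φ : (Fin (l + 1) → ℝ) → ℝ), Measurable φ → ∀ K : ℝ, (∀ b ∈ E, |φ b| ≤ K) →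
      Integrable (E.indicator φ) μ := fun φ hφ K hK => by
    refine Integrable.of_bound (hφ.indicator hEm).aestronglyMeasurable (max K 0) (ae_of_all _ fun b => ?_)
    by_cases hb : b ∈ E
    · rw [Set.indicator_of_mem hb]; exact (hK b hb).trans (le_max_left _ _)
    · rw [Set.indicator_of_notMem hb, norm_zero]; exact le_max_right _ _
  have hhi : ∀ k, Integrable (h k) μ := fun k => by
    have := hcm k
    refine bdd _ (by fun_prop) (a * (2 * u * F * Real.sqrt (l + 1) ^ (2 * n + 1))) fun b hb => ?_
    rw [abs_mul, abs_mul, abs_pow]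
    have h1 := hcb b hb k; have h2 := hxb b hb; have h3 := hb.1 k
    gcongr
  have hdE : ∀ b ∈ E, ∀ k, d k b ≤ u * F := fun b hb k =>
    (Finset.single_le_sum (f := fun k => d k b) (fun _ _ => abs_nonneg _) (Finset.mem_univ k)).trans
      (hsumd b hb)
  have hRi : ∀ k, Integrable (E.indicator (R k)) μ := fun k => by
    refine bdd _ (hRm k) (1 / 2 * (u * F) * Real.sqrt (l + 1) ^ (2 * n + 1) +
      1 / 2 * (2 * n + 1) * (2 * δ * a / T * (6 * (u * F))) * (2 * (2 * u * F) + u * F) *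
        Real.sqrt (l + 1) ^ (2 * n) + 2 * u * F * Real.sqrt (l + 1) ^ (2 * n + 1)) fun b hb => ?_
    have h1 := hcb b hb k; have h2 := hxb b hb
    have h4 := hdE b hb k
    have h5 : Δ k b ≤ 2 * δ * a / T * (6 * (u * F)) :=
      (hΔb b hb k).trans (mul_le_mul_of_nonneg_left (hincr b hb k) (by positivity))
    have hd0 : 0 ≤ d k b := abs_nonneg _
    have hΔ0 : 0 ≤ Δ k b := abs_nonneg _
    have hi : (X k).indicator (fun b => |c k b| * |x b| ^ (2 * n + 1)) b ≤
        2 * u * F * Real.sqrt (l + 1) ^ (2 * n + 1) :=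
      (Set.indicator_le_self' (fun _ _ => by positivity) b).trans (by gcongr)
    have hi0 : 0 ≤ (X k).indicator (fun b => |c k b| * |x b| ^ (2 * n + 1)) b :=
      Set.indicator_nonneg (fun _ _ => by positivity) b
    have e : R k b = 1 / 2 * d k b * |x b| ^ (2 * n + 1) + 1 / 2 * (2 * n + 1) * Δ k b *
        (2 * |c k b| + d k b) * |x b| ^ (2 * n) +
        (X k).indicator (fun b => |c k b| * |x b| ^ (2 * n + 1)) b := rfl
    rw [e, abs_of_nonneg (by positivity)]
    gcongr
  have hhk : ∀ k, |∫ b, h k b ∂μ| ≤ a * ∫ b, E.indicator (R k) b ∂μ := fun k =>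
    abs_integral_indicator_le_flipRem k n ha.le (fun b hb => hb.1 k) (fun b hb hb' =>
      ⟨fun j => by rw [abs_flip]; exact hb.1 j, not_lt.1 hb'⟩) (hhi k) (hRi k)
  -- A single factor of the power is expanded as a linear form in `b`; the other `2n + 1` factors
  -- are kept.
  have hmom : ∫ b in E, (|opErr l A f δ b| / T) ^ (2 * n + 2) ∂μ =
      -(δ / T * ∑ k, ∫ b, h k b ∂μ) := by
    rw [← integral_finsetSum _ fun k _ => hhi k, ← integral_indicator hEm, ← integral_const_mul,
      ← integral_neg]
    refine integral_congr_ae (ae_of_all _ fun b => ?_)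
    by_cases hb : b ∈ E
    · simp only [hh, Set.indicator_of_mem hb]
      have e4 : (|opErr l A f δ b| / T) ^ (2 * n + 2) = x b * x b ^ (2 * n + 1) := by
        simp only [hx]
        rw [← pow_succ', ← abs_of_pos hTpos, ← abs_div, Even.pow_abs ⟨n + 1, by ring⟩]
        rw [abs_of_pos hTpos]
      have e5 : x b = -(δ / T * ∑ k, b k * c k b) := by
        simp only [hx, hc]; rw [opErr_eq_sum]; ring
      rw [e4]
      conv_lhs => rw [e5]
      simp only [← mul_assoc]
      rw [← Finset.sum_mul, neg_mul]
      congr 1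
      rw [← e5]; ring
    · simp only [hh, Set.indicator_of_notMem hb, Finset.sum_const_zero, mul_zero, neg_zero]
  set m := ∫ b in E, (|opErr l A f δ b| / T) ^ (2 * n + 2) ∂μ with hm
  set PX := μ.real {b | β < tzOp l (ser l b)} with hPX
  have hXk : ∀ k, μ.real (X k) = PX := fun k => by
    have := (measurePreserving_flip k).measureReal_preimage (s := {b | β < tzOp l (ser l b)})
      (measurableSet_lt measurable_const ((coeffMeasurable_ser l).tzOp l)).nullMeasurableSet
    exact this
  have hmi : Integrable (E.indicator fun b => |x b| ^ (2 * n + 2)) μ := by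
    refine bdd _ (by fun_prop) (Real.sqrt (l + 1) ^ (2 * n + 2)) fun b hb => ?_
    rw [abs_of_nonneg (by positivity)]
    have := hxb b hb
    gcongr
  have hm' : m = ∫ b, E.indicator (fun b => |x b| ^ (2 * n + 2)) b ∂μ := by
    rw [hm, integral_indicator hEm]
    simp only [hx, abs_div, abs_of_pos hTpos]
  -- The moment reappears on the right with the factor `1/2` and is absorbed. The remaining term is
  -- the probability that a sign change breaks the norm bound, summed over `l + 1` coordinates.
  have hbound : m ≤ 1 / 2 * (1 + m) + (l + 1 : ℝ) ^ (n + 1) * ((l + 1 : ℝ) * PX) := by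
    calc m ≤ δ / T * ∑ k, a * ∫ b, E.indicator (R k) b ∂μ := by
          rw [hmom, ← mul_neg, ← Finset.sum_neg_distrib]
          refine mul_le_mul_of_nonneg_left (Finset.sum_le_sum fun k _ => ?_) (by positivity)
          exact (neg_le_abs _).trans (hhk k)
      _ = ∫ b, δ * a / T * ∑ k, E.indicator (R k) b ∂μ := by
          rw [integral_const_mul, integral_finsetSum _ fun k _ => hRi k, ← Finset.mul_sum]; ring
      _ ≤ ∫ b, (1 / 2 * (1 + E.indicator (fun b => |x b| ^ (2 * n + 2)) b) +
            (l + 1 : ℝ) ^ (n + 1) * ∑ k, (X k).indicator (fun _ => (1 : ℝ)) b) ∂μ := by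
          refine integral_mono ((integrable_finsetSum _ fun k _ => hRi k).const_mul _) ?_ fun b => ?_
          · refine (((integrable_const 1).add hmi).const_mul _).add
              ((integrable_finsetSum _ fun k _ => ?_).const_mul _)
            exact (integrable_const 1).indicator (hXm k)
          · have hI0 : 0 ≤ ∑ k, (X k).indicator (fun _ => (1 : ℝ)) b :=
              Finset.sum_nonneg fun k _ => Set.indicator_nonneg (fun _ _ => zero_le_one) _
            by_cases hb : b ∈ E
            · simp only [Set.indicator_of_mem hb]; exact hRsum b hb
            · simp only [Set.indicator_of_notMem hb, Finset.sum_const_zero, mul_zero, add_zero]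
              positivity
      _ = _ := by
          rw [integral_add, integral_const_mul, integral_add (integrable_const 1) hmi, ← hm',
            integral_const_mul, integral_finsetSum _ fun k _ =>
              (integrable_const (1 : ℝ)).indicator (hXm k)]
          · simp only [integral_const, probReal_univ, smul_eq_mul, mul_one]
            congr 2
            rw [Finset.sum_congr rfl fun k _ => by
              rw [integral_indicator_const _ (hXm k), hXk, smul_eq_mul, mul_one],
              Finset.sum_const, Finset.card_univ, Fintype.card_fin, nsmul_eq_mul]
            push_cast; ring
          · exact ((integrable_const 1).add hmi).const_mul _
          · exact (integrable_finsetSum _ fun k _ =>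
              (integrable_const (1 : ℝ)).indicator (hXm k)).const_mul _
  have : (l + 1 : ℝ) ^ (n + 1) * ((l + 1 : ℝ) * PX) = (l + 1 : ℝ) ^ (n + 2) * PX := by ring
  linarith

/-- Concentration of the error due to the operator noise. -/
lemma measure_opErr_gt_le (n : ℕ) :
    (gaussVec l).real (boundedNoise l a β ∩ {b | 3 * (16 * Real.sqrt (n + 1) *
      (δ * a * l2 l A⁻¹ * F)) < |opErr l A f δ b|}) ≤
      (1 + 2 * ((l + 1) ^ (n + 2) * (gaussVec l).real {b | β < tzOp l (ser l b)})) *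
        Real.exp (-(2 * n + 2)) := by
  have hu := S.u_pos; have hF := S.F_pos; have ha := S.a_pos; have hδ := S.δ_pos
  set T := 16 * Real.sqrt (n + 1) * (δ * a * l2 l A⁻¹ * F) with hT
  have hTpos : 0 < T := by positivity
  have hm := S.moment_le n hT
  set E := boundedNoise l a β
  have hEm : MeasurableSet E := measurableSet_boundedNoise l a β
  have hmeas := measurable_opErr l A f δ
  set B := E ∩ {b | 3 * T < |opErr l A f δ b|}
  have hBm : MeasurableSet B :=
    hEm.inter (measurableSet_lt measurable_const hmeas.abs)
  have hint : IntegrableOn (fun b => (|opErr l A f δ b| / T) ^ (2 * n + 2)) E (gaussVec l) := by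
    refine Integrable.of_bound (by fun_prop)
      ((2 * Real.sqrt (l + 1) * (δ * a * l2 l A⁻¹ * F) / T) ^ (2 * n + 2)) ?_
    refine (ae_restrict_iff' hEm).2 (ae_of_all _ fun b hb => ?_)
    rw [Real.norm_of_nonneg (by positivity)]
    have := S.abs_opErr_le hb
    gcongr
  -- Markov's inequality for the moment of order `2n + 2` at the level `3T`; `3 ≥ e` turns the gain
  -- into an exponential.
  have h1 : (gaussVec l).real B * 3 ^ (2 * n + 2) ≤
      ∫ b in E, (|opErr l A f δ b| / T) ^ (2 * n + 2) ∂gaussVec l := by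
    calc _ = ∫ b in B, (3 : ℝ) ^ (2 * n + 2) ∂gaussVec l := by simp
      _ ≤ ∫ b in B, (|opErr l A f δ b| / T) ^ (2 * n + 2) ∂gaussVec l := by
          refine setIntegral_mono_on (integrable_const _) (hint.mono_set Set.inter_subset_left) hBm
            fun b hb => ?_
          have : 3 ≤ |opErr l A f δ b| / T := (le_div_iff₀ hTpos).2 (le_of_lt hb.2)
          gcongr
      _ ≤ _ := setIntegral_mono_set hint (ae_of_all _ fun b => by simp only [Pi.zero_apply]; positivity)
          (Set.inter_subset_left.eventuallyLE)
  have h3 : Real.exp (2 * n + 2) ≤ 3 ^ (2 * n + 2) := by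
    have := pow_le_pow_left₀ (Real.exp_pos 1).le (Real.exp_one_lt_d9.le.trans (by norm_num) :
      Real.exp 1 ≤ 3) (2 * n + 2)
    rw [← Real.exp_nat_mul] at this
    refine le_trans (le_of_eq ?_) this
    congr 1; push_cast; ring
  rw [Real.exp_neg, ← div_eq_mul_inv, le_div_iff₀ (Real.exp_pos _)]
  exact (mul_le_mul_of_nonneg_left h3 measureReal_nonneg).trans (h1.trans hm)

end NoiseBounds

end Concentration

/-! ### Moments and truncated moments of real Gaussian variables. -/

section GaussianReal

lemma integral_exp_mul_gaussianReal (w : NNReal) (t : ℝ) :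
    ∫ y, Real.exp (t * y) ∂gaussianReal 0 w = Real.exp (w * t ^ 2 / 2) := by
  have h := congrFun (mgf_fun_id_gaussianReal (μ := 0) (v := w)) t
  simpa [mgf] using h

lemma lintegral_sq_gaussianReal (w : NNReal) :
    ∫⁻ y, ENNReal.ofReal (y ^ 2) ∂gaussianReal 0 w = w := by
  have h2 : MemLp (fun y : ℝ => y) 2 (gaussianReal 0 w) := memLp_id_gaussianReal 2
  rw [← ofReal_integral_eq_lintegral_ofReal h2.integrable_sq (ae_of_all _ fun y => sq_nonneg y)]
  have h := variance_fun_id_gaussianReal (μ := 0) (v := w)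
  rw [variance_eq_integral (by fun_prop), integral_id_gaussianReal] at h
  simp only [sub_zero] at h
  rw [h, ENNReal.ofReal_coe_nnreal]

lemma sq_le_exp {t : ℝ} (ht : 0 < t) (y : ℝ) : y ^ 2 ≤ 2 / t ^ 2 * Real.exp (t * |y|) := by
  have h := Real.quadratic_le_exp_of_nonneg (mul_nonneg ht.le (abs_nonneg y))
  have h1 : (t * |y|) ^ 2 = t ^ 2 * y ^ 2 := by rw [mul_pow, sq_abs]
  rw [div_mul_eq_mul_div, le_div_iff₀ (by positivity)]
  have : 0 ≤ t * |y| := by positivity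
  nlinarith

lemma exp_mul_abs_le (t y : ℝ) : Real.exp (t * |y|) ≤ Real.exp (t * y) + Real.exp (-t * y) := by
  rcases abs_cases y with ⟨h, -⟩ | ⟨h, -⟩ <;> rw [h]
  · exact le_add_of_nonneg_right (Real.exp_pos _).le
  · rw [mul_neg, ← neg_mul]; exact le_add_of_nonneg_left (Real.exp_pos _).le

lemma integrable_exp_add (w : NNReal) (t : ℝ) :
    Integrable (fun y => Real.exp (t * y) + Real.exp (-t * y)) (gaussianReal 0 w) :=
  (integrable_exp_mul_gaussianReal t).add (integrable_exp_mul_gaussianReal (-t))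

/-- The truncated second moment of a centred Gaussian variable. -/
lemma lintegral_sq_tail_gaussianReal_le {w : NNReal} {v : ℝ} (hv : w ≤ v) {x : ℝ} {t : ℝ}
    (ht : 0 < t) :
    ∫⁻ y, ENNReal.ofReal (if x < |y| then y ^ 2 else 0) ∂gaussianReal 0 w ≤
      ENNReal.ofReal (4 / t ^ 2 * Real.exp (2 * t ^ 2 * v - t * x)) := by
  have hpt : ∀ y : ℝ, (if x < |y| then y ^ 2 else 0) ≤
      2 / t ^ 2 * Real.exp (-(t * x)) * (Real.exp (2 * t * y) + Real.exp (-(2 * t) * y)) := by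
    intro y
    split_ifs with h
    · calc y ^ 2 ≤ 2 / t ^ 2 * Real.exp (t * |y|) := sq_le_exp ht y
        _ ≤ 2 / t ^ 2 * (Real.exp (-(t * x)) * Real.exp (2 * t * |y|)) := by
            rw [← Real.exp_add]
            gcongr
            nlinarith
        _ ≤ _ := by
            rw [mul_assoc (2 / t ^ 2)]
            exact mul_le_mul_of_nonneg_left (mul_le_mul_of_nonneg_left (exp_mul_abs_le _ _)
              (Real.exp_pos _).le) (by positivity)
    · positivity
  refine (lintegral_mono fun y => ENNReal.ofReal_le_ofReal (hpt y)).trans ?_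
  rw [← ofReal_integral_eq_lintegral_ofReal ((integrable_exp_add w (2 * t)).const_mul _)
    (ae_of_all _ fun y => by simp only [Pi.zero_apply]; positivity), integral_const_mul,
    integral_add (integrable_exp_mul_gaussianReal _) (integrable_exp_mul_gaussianReal _),
    integral_exp_mul_gaussianReal, integral_exp_mul_gaussianReal]
  refine ENNReal.ofReal_le_ofReal ?_
  have e1 : (w : ℝ) * (2 * t) ^ 2 / 2 = 2 * t ^ 2 * w := by ring
  have e2 : (w : ℝ) * (-(2 * t)) ^ 2 / 2 = 2 * t ^ 2 * w := by ring
  rw [e1, e2]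
  calc _ = 4 / t ^ 2 * (Real.exp (-(t * x)) * Real.exp (2 * t ^ 2 * w)) := by ring
    _ ≤ _ := by
      rw [← Real.exp_add]
      gcongr
      nlinarith [sq_nonneg t]

lemma lintegral_sq_tail_gaussianReal_le' {w : NNReal} {v : ℝ} (hv : w ≤ v) (hv0 : 0 < v) {x : ℝ}
    (hx : 0 < x) :
    ∫⁻ y, ENNReal.ofReal (if x < |y| then y ^ 2 else 0) ∂gaussianReal 0 w ≤
      ENNReal.ofReal (64 * v ^ 2 / x ^ 2 * Real.exp (-(x ^ 2 / (8 * v)))) := by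
  -- This `t` minimizes the exponent `2 t² v - t x`.
  refine (lintegral_sq_tail_gaussianReal_le hv (x := x) (t := x / (4 * v)) (by positivity)).trans
    (le_of_eq ?_)
  congr 2
  · field_simp; norm_num
  · congr 1; field_simp; ring

lemma lintegral_pow_four_gaussianReal_le :
    ∫⁻ y, ENNReal.ofReal (y ^ 4) ∂gaussianReal 0 1 ≤ ENNReal.ofReal 144 := by
  have hpt : ∀ y : ℝ, y ^ 4 ≤ 24 * (Real.exp (1 * y) + Real.exp (-1 * y)) := fun y => by
    have h := Real.pow_div_factorial_le_exp |y| (abs_nonneg y) 4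
    have h2 := exp_mul_abs_le 1 y
    rw [one_mul] at h2
    have h3 : |y| ^ 4 = y ^ 4 := Even.pow_abs ⟨2, rfl⟩ y
    rw [h3, show (Nat.factorial 4 : ℝ) = 24 by norm_num [Nat.factorial]] at h
    linarith
  refine (lintegral_mono fun y => ENNReal.ofReal_le_ofReal (hpt y)).trans ?_
  rw [← ofReal_integral_eq_lintegral_ofReal ((integrable_exp_add 1 1).const_mul _)
    (ae_of_all _ fun y => by simp only [Pi.zero_apply]; positivity), integral_const_mul,
    integral_add (integrable_exp_mul_gaussianReal _) (integrable_exp_mul_gaussianReal _),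
    integral_exp_mul_gaussianReal, integral_exp_mul_gaussianReal]
  refine ENNReal.ofReal_le_ofReal ?_
  have h : Real.exp (1 / 2) ≤ 3 := (Real.exp_le_exp.2 (by norm_num)).trans
    (Real.exp_one_lt_d9.le.trans (by norm_num))
  norm_num at h ⊢
  linarith

end GaussianReal

/-! ### Covariance of the signal noise. -/

section Design

variable {D : Design} {l : ℕ}

lemma Design.posSemidef_gram : (D.gram l).PosSemidef := by
  set B : Matrix (Fin D.n) (Fin (l + 1)) ℝ := Matrix.of fun i k => laguerreFun k (D.t i)
  have : D.gram l = Bᴴ * B := by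
    ext k m
    simp [Design.gram, Matrix.mul_apply, B]
  rw [this]
  exact Matrix.posSemidef_conjTranspose_mul_self B

lemma Design.posSemidef_Omega : (D.Omega l).PosSemidef :=
  (Design.posSemidef_gram.inv).smul (div_nonneg D.n.cast_nonneg D.T_pos.le)

lemma dotProduct_mulVec_le_of_spectrum_le {m : ℕ} {A : Matrix (Fin m) (Fin m) ℝ}
    (hA : A.IsHermitian) {C : ℝ} (hC : ∀ x ∈ spectrum ℝ A, x ≤ C) (v : Fin m → ℝ) :
    v ⬝ᵥ A *ᵥ v ≤ C * ∑ i, v i ^ 2 := by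
  have h : (algebraMap ℝ (Matrix (Fin m) (Fin m) ℝ) C - A).PosSemidef := by
    rw [Matrix.posSemidef_iff_isHermitian_and_spectrum_nonneg]
    constructor
    · refine Matrix.IsHermitian.sub ?_ hA
      rw [Matrix.algebraMap_eq_diagonal]
      exact Matrix.isHermitian_diagonal _
    · intro x hx
      rw [← spectrum.singleton_sub_eq] at hx
      obtain ⟨y, hy, z, hz, rfl⟩ := hx
      rw [Set.mem_singleton_iff] at hy
      simpa [hy] using hC z hz
  have h2 := h.dotProduct_mulVec_nonneg v
  rw [Matrix.sub_mulVec, dotProduct_sub, Algebra.algebraMap_eq_smul_one, Matrix.smul_mulVec,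
    Matrix.one_mulVec, dotProduct_smul, smul_eq_mul] at h2
  simp only [star_trivial] at h2
  have e : v ⬝ᵥ v = ∑ i, v i ^ 2 := Finset.sum_congr rfl fun i _ => (pow_two _).symm
  rw [e] at h2
  linarith

/-- The law of a linear functional of a Gaussian vector. -/
lemma exists_map_linear_multivariateGaussian {m : ℕ} {A : Matrix (Fin m) (Fin m) ℝ}
    (hA : A.PosSemidef) {C : ℝ} (hC : ∀ x ∈ spectrum ℝ A, x ≤ C) (v : Fin m → ℝ) :
    ∃ w : NNReal, (w : ℝ) ≤ C * ∑ i, v i ^ 2 ∧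
      (multivariateGaussian 0 A).map (fun x : EuclideanSpace ℝ (Fin m) => ∑ i, v i * x i) =
        gaussianReal 0 w := by
  set L : StrongDual ℝ (EuclideanSpace ℝ (Fin m)) := innerSL ℝ (WithLp.toLp 2 v) with hL
  have hLa : (fun x : EuclideanSpace ℝ (Fin m) => ∑ i, v i * x i) = L := by
    funext x
    simp [hL, PiLp.inner_apply, mul_comm]
  have h := IsGaussian.map_eq_gaussianReal (μ := multivariateGaussian 0 A) L
  refine ⟨Var[L; multivariateGaussian 0 A].toNNReal, ?_, ?_⟩
  swap
  · rw [hLa, h]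
    congr 1
    exact (L.integral_comp_comm IsGaussian.integrable_id).trans (by simp)
  · rw [Real.coe_toNNReal _ (variance_nonneg _ _)]
    have := covarianceBilin_self (μ := multivariateGaussian 0 A) IsGaussian.memLp_two_id
      (WithLp.toLp 2 v)
    rw [covarianceBilin_multivariateGaussian hA] at this
    have h2 : Var[L; multivariateGaussian 0 A] = v ⬝ᵥ A *ᵥ v := by
      rw [this]; rfl
    rw [h2]
    exact dotProduct_mulVec_le_of_spectrum_le hA.isHermitian hC v

end Design

/-! ### Joint law of the two noises at one level. -/

section JointLaw

variable {D : Design} {L : ℕ} {Ω : Type*} [MeasurableSpace Ω] {P : Measure Ω}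
  [IsProbabilityMeasure P] {b : ℕ → Ω → ℝ} {ξ : (l : ℕ) → Ω → EuclideanSpace ℝ (Fin (l + 1))}

omit [IsProbabilityMeasure P] in
lemma NoiseModel.hasLaw_fin (N : NoiseModel D L P b ξ) (l : ℕ) :
    HasLaw (fun ω (k : Fin (l + 1)) => b k ω) (gaussVec l) P := by
  have hi : iIndepFun (fun (k : Fin (l + 1)) => b k) P :=
    N.b_indep.precomp Fin.val_injective
  exact iIndepFun.hasLaw_pi (fun k => N.b_law k) hi

/-- Independence of `b` and `ξ l` gives a product law at each level. The risk is a sum over levels,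
so no joint law across levels is ever required. -/
lemma NoiseModel.hasLaw_pair (N : NoiseModel D L P b ξ) {l : ℕ} (hl : l ≤ L) :
    HasLaw (fun ω => ((fun k : Fin (l + 1) => b k ω), ξ l ω))
      ((gaussVec l).prod (multivariateGaussian 0 (D.Omega l))) P := by
  have hi : IndepFun (fun ω (k : Fin (l + 1)) => b k ω) (ξ l) P := by
    have := (N.xi_indep l hl).symm
    exact this.comp (φ := fun (c : ℕ → ℝ) (k : Fin (l + 1)) => c k) (ψ := id)
      (by fun_prop) measurable_id
  exact (indepFun_iff_hasLaw_prodMk_prod (N.hasLaw_fin l) (N.xi_law l hl)).1 hi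

end JointLaw

/-! ### The good event and its probability. -/

section GoodNoise

open PowerSeries

/-- The truncation level of the coordinates of the operator noise. -/
noncomputable def noiseTrunc (δ : ℝ) : ℝ := 5 * Real.sqrt |Real.log δ|

/-- The bound for the spectral norm of the operator noise. -/
noncomputable def noiseOp (κ δ : ℝ) (l : ℕ) : ℝ :=
  κ / 8 * Real.sqrt (max (l : ℝ) 1 * Real.log (max (l : ℝ) 2)) * Real.sqrt |Real.log δ|

/-- The order of the moments used in the concentration inequality. -/
noncomputable def momentOrder (δ : ℝ) : ℕ := ⌊5 * |Real.log δ|⌋₊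

/-- The concentration bound for the error due to the operator noise. -/
noncomputable def opErrBound (l : ℕ) (A : ℝ⟦X⟧) (δ F : ℝ) : ℝ :=
  3 * (16 * Real.sqrt (momentOrder δ + 1) * (δ * noiseTrunc δ * l2 l A⁻¹ * F))

/-- The operator noises for which the inverse and the error are controlled. -/
def goodNoise (κ δ F : ℝ) (l : ℕ) (A f : ℝ⟦X⟧) : Set (Fin (l + 1) → ℝ) :=
  boundedNoise l (noiseTrunc δ) (noiseOp κ δ l) ∩
    {b | tzOp l A⁻¹ < 2 * (opLevel κ δ l)⁻¹ → |opErr l A f δ b| ≤ opErrBound l A δ F}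

lemma measurableSet_goodNoise (κ δ F : ℝ) (l : ℕ) (A f : ℝ⟦X⟧) :
    MeasurableSet (goodNoise κ δ F l A f) := by
  refine (measurableSet_boundedNoise _ _ _).inter ?_
  by_cases h : tzOp l A⁻¹ < 2 * (opLevel κ δ l)⁻¹
  · simp only [h, true_imp_iff]
    exact measurableSet_le (measurable_opErr _ _ _ _).abs measurable_const
  · simp only [h, false_imp_iff]
    exact MeasurableSet.univ

/-- The factor `1/8` in `noiseOp` is chosen for this: against an inverse of norm at most twice
`(opLevel κ δ l)⁻¹`, even noise of twice this size is a perturbation of relative size at most `1/2`.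
-/
lemma mul_noiseOp (κ δ : ℝ) (l : ℕ) : δ * noiseOp κ δ l = opLevel κ δ l / 8 := by
  rw [noiseOp, opLevel]; ring

lemma one_le_abs_log {x : ℝ} (hx : 0 < x) (hx1 : x ≤ Real.exp (-1)) : 1 ≤ |Real.log x| := by
  have : Real.log x ≤ -1 := by
    have := Real.log_le_log hx hx1
    rwa [Real.log_exp] at this
  rw [abs_of_nonpos (by linarith)]
  linarith

lemma exp_neg_abs_log {x : ℝ} (hx : 0 < x) (hx1 : x ≤ Real.exp (-1)) :
    Real.exp (-|Real.log x|) = x := by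
  have : Real.log x ≤ -1 := by
    have := Real.log_le_log hx hx1
    rwa [Real.log_exp] at this
  rw [abs_of_nonpos (by linarith), neg_neg, Real.exp_log hx]

lemma log_two_le_log_max (l : ℕ) : Real.log 2 ≤ Real.log (max (l : ℝ) 2) :=
  Real.log_le_log (by norm_num) (le_max_right _ _)

lemma half_le_mul_log (l : ℕ) : 16 / 25 * max (l : ℝ) 1 ≤
    max (l : ℝ) 1 * Real.log (max (l : ℝ) 2) := by
  have h1 := log_two_le_log_max l
  have h2 := Real.log_two_gt_d9
  have h3 : (1 : ℝ) ≤ max (l : ℝ) 1 := le_max_right _ _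
  nlinarith

lemma sqrt_mul_log_ge (l : ℕ) : 4 / 5 * Real.sqrt (max (l : ℝ) 1) ≤
    Real.sqrt (max (l : ℝ) 1 * Real.log (max (l : ℝ) 2)) := by
  have h3 : (1 : ℝ) ≤ max (l : ℝ) 1 := le_max_right _ _
  refine Real.le_sqrt_of_sq_le ?_
  rw [mul_pow, Real.sq_sqrt (by linarith)]
  have := half_le_mul_log l
  norm_num at this ⊢
  linarith

lemma add_one_le_two_mul_max (l : ℕ) : (l : ℝ) + 1 ≤ 2 * max (l : ℝ) 1 := by
  linarith [le_max_left (l : ℝ) 1, le_max_right (l : ℝ) 1]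

lemma add_one_le_max_sq (l : ℕ) : (l : ℝ) + 1 ≤ max (l : ℝ) 2 ^ 2 := by
  nlinarith [le_max_left (l : ℝ) 2, le_max_right (l : ℝ) 2]

variable {κ δ F : ℝ} {l : ℕ} {A f : ℝ⟦X⟧}

lemma opLevel_ge (hκ : 512 ≤ κ) (hδ : 0 < δ) :
    400 * δ * Real.sqrt (max (l : ℝ) 1) * Real.sqrt |Real.log δ| ≤ opLevel κ δ l := by
  have h := sqrt_mul_log_ge l
  have h0 := Real.sqrt_nonneg (max (l : ℝ) 1)
  rw [opLevel]
  calc _ ≤ 512 * (4 / 5 * Real.sqrt (max (l : ℝ) 1)) * δ * Real.sqrt |Real.log δ| := by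
        have := Real.sqrt_nonneg |Real.log δ|
        have h2 : 0 ≤ δ * Real.sqrt (max (l : ℝ) 1) * Real.sqrt |Real.log δ| := by positivity
        nlinarith
    _ ≤ _ := by gcongr

lemma le_opLevel (hκ : 512 ≤ κ) (hδ : 0 < δ) (hδ1 : δ ≤ Real.exp (-1)) : δ ≤ opLevel κ δ l := by
  refine le_trans ?_ (opLevel_ge (l := l) hκ hδ)
  have h1 : 1 ≤ Real.sqrt |Real.log δ| := Real.one_le_sqrt.2 (one_le_abs_log hδ hδ1)
  have h2 : 1 ≤ Real.sqrt (max (l : ℝ) 1) := Real.one_le_sqrt.2 (le_max_right _ _)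
  have h3 : 1 ≤ Real.sqrt (max (l : ℝ) 1) * Real.sqrt |Real.log δ| := one_le_mul_of_one_le_of_one_le h2 h1
  nlinarith

/-- The operator threshold supplies the three smallness conditions of the concentration argument:
its size `√l δ √|log δ|` is exactly what `x_le` asks for once the noise is truncated at a multiple
of `√|log δ|`. -/
lemma noiseBounds_of_lt (hκ : 512 ≤ κ) (hδ : 0 < δ) (hδ1 : δ ≤ Real.exp (-1)) (hF : 0 < F)
    (hA : constantCoeff A ≠ 0)
    (hf : ∑ k ∈ Finset.range (l + 1), |PowerSeries.coeff k f| ≤ F)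
    (h : tzOp l A⁻¹ < 2 * (opLevel κ δ l)⁻¹) :
    NoiseBounds l A f δ F (noiseTrunc δ) (noiseOp κ δ l) := by
  have hO : 0 < opLevel κ δ l := hδ.trans_le (le_opLevel hκ hδ hδ1)
  have hL : 1 ≤ Real.sqrt |Real.log δ| := Real.one_le_sqrt.2 (one_le_abs_log hδ hδ1)
  have h2 : 1 ≤ Real.sqrt (max (l : ℝ) 1) := Real.one_le_sqrt.2 (le_max_right _ _)
  have hNO : tzOp l A⁻¹ * opLevel κ δ l ≤ 2 := by
    have := mul_le_mul_of_nonneg_right h.le hO.le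
    rwa [mul_assoc, inv_mul_cancel₀ hO.ne', mul_one] at this
  have hN := tzOp_nonneg l A⁻¹
  refine ⟨hA, hδ, by unfold noiseTrunc; positivity, hF, hf, ?_, ?_, ?_⟩
  · rw [mul_left_comm δ, mul_noiseOp]; linarith
  · rw [noiseTrunc, noiseOp]
    have := sqrt_mul_log_ge l
    nlinarith [mul_le_mul hκ this (by positivity) (by linarith)]
  · have h3 := opLevel_ge (l := l) hκ hδ
    have h4 : Real.sqrt ((l : ℝ) + 1) ≤ 3 / 2 * Real.sqrt (max (l : ℝ) 1) := by
      refine Real.sqrt_le_iff.2 ⟨by positivity, ?_⟩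
      rw [mul_pow, Real.sq_sqrt (by positivity)]
      have := add_one_le_two_mul_max l
      have : (0 : ℝ) ≤ max (l : ℝ) 1 := by positivity
      linarith
    rw [noiseTrunc]
    calc δ * (5 * Real.sqrt |Real.log δ|) * tzOp l A⁻¹ * Real.sqrt (l + 1)
        ≤ δ * (5 * Real.sqrt |Real.log δ|) * tzOp l A⁻¹ * (3 / 2 * Real.sqrt (max (l : ℝ) 1)) := by
          gcongr
      _ = tzOp l A⁻¹ * (400 * δ * Real.sqrt (max (l : ℝ) 1) * Real.sqrt |Real.log δ|) * (3 / 160) := by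
          ring
      _ ≤ tzOp l A⁻¹ * opLevel κ δ l * (3 / 160) := by gcongr
      _ ≤ 1 / 16 := by linarith

/-- This is the role of the factor `log (l ∨ 2)` in the operator threshold: the Gaussian exponent is
at least `256 |log δ| log (l ∨ 2)`, while a power of `l + 1` of order `10 |log δ|`, together with
the number of frequencies, costs at most `22 |log δ| log (l ∨ 2)`. -/
lemma measure_noiseOp_lt_le (hκ : 512 ≤ κ) (hδ : 0 < δ) (hδ1 : δ ≤ Real.exp (-1)) {j : ℕ}
    (hj : (j : ℝ) ≤ 10 * |Real.log δ|) :
    ((l : ℝ) + 1) ^ j * (gaussVec l).real {b | noiseOp κ δ l < tzOp l (ser l b)} ≤ 8 * δ ^ 10 := by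
  have hL := one_le_abs_log hδ hδ1
  set Λ := |Real.log δ| with hΛ
  have hll := log_two_le_log_max l
  have hl2 := Real.log_two_gt_d9
  have hl1 : (1 : ℝ) ≤ max (l : ℝ) 1 := le_max_right _ _
  set y := Real.log (max (l : ℝ) 2) with hy
  have hy0 : 0 < y := by linarith
  have h1 := gaussVec_tzOp_gt l (x := noiseOp κ δ l) (by unfold noiseOp; positivity)
  have h2 : 256 * y * Λ ≤ noiseOp κ δ l ^ 2 / (4 * (l + 1)) := by
    rw [le_div_iff₀ (by positivity), noiseOp, mul_pow, mul_pow, Real.sq_sqrt (by positivity),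
      Real.sq_sqrt (by positivity)]
    have h3 := add_one_le_two_mul_max l
    have h4 : (4096 : ℝ) ≤ (κ / 8) ^ 2 := by nlinarith
    calc 256 * y * Λ * (4 * ((l : ℝ) + 1)) ≤ 256 * y * Λ * (4 * (2 * max (l : ℝ) 1)) := by gcongr
      _ ≤ 4096 * (max (l : ℝ) 1 * y) * Λ := by
          have : 0 ≤ y * Λ * max (l : ℝ) 1 := by positivity
          nlinarith
      _ ≤ _ := by gcongr
  have h5 : ((l : ℝ) + 1) ^ (j + 1) ≤ Real.exp (22 * Λ * y) := by
    have h6 : (l : ℝ) + 1 ≤ Real.exp (2 * y) := by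
      have := add_one_le_max_sq l
      rwa [two_mul, Real.exp_add, hy, Real.exp_log (by positivity), ← pow_two]
    calc ((l : ℝ) + 1) ^ (j + 1) ≤ Real.exp (2 * y) ^ (j + 1) := by gcongr
      _ = Real.exp ((j + 1 : ℝ) * (2 * y)) := by rw [← Real.exp_nat_mul]; push_cast; rfl
      _ ≤ _ := by
          refine Real.exp_le_exp.2 ?_
          nlinarith
  calc _ ≤ ((l : ℝ) + 1) ^ j * (8 * (l + 1) * Real.exp (-noiseOp κ δ l ^ 2 / (4 * (l + 1)))) :=
        mul_le_mul_of_nonneg_left h1 (by positivity)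
    _ = 8 * (((l : ℝ) + 1) ^ (j + 1) * Real.exp (-(noiseOp κ δ l ^ 2 / (4 * (l + 1))))) := by
        rw [neg_div]; ring
    _ ≤ 8 * (Real.exp (22 * Λ * y) * Real.exp (-(256 * y * Λ))) := by gcongr
    _ = 8 * Real.exp (-(234 * y * Λ)) := by rw [← Real.exp_add]; congr 2; ring
    _ ≤ 8 * Real.exp (-(10 * Λ)) := by
        gcongr
        nlinarith
    _ = 8 * δ ^ 10 := by
        have e : δ ^ 10 = Real.exp (-Λ) ^ 10 := by rw [hΛ, exp_neg_abs_log hδ hδ1]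
        rw [e, ← Real.exp_nat_mul]; push_cast
        congr 2; ring

lemma measure_goodNoise_compl_le (hκ : 512 ≤ κ) (hδ : 0 < δ) (hδ1 : δ ≤ Real.exp (-1)) (hF : 0 < F)
    (hA : constantCoeff A ≠ 0)
    (hf : ∑ k ∈ Finset.range (l + 1), |PowerSeries.coeff k f| ≤ F) {K : ℝ} (hK : (l + 1 : ℝ) ≤ K / δ) :
    (gaussVec l).real (goodNoise κ δ F l A f)ᶜ ≤ (25 + 2 * K) * δ ^ 10 := by
  have hL := one_le_abs_log hδ hδ1
  have hδlt : δ ≤ 1 := hδ1.trans (Real.exp_le_one_iff.2 (by norm_num))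
  have hpow : ∀ c : ℝ, 0 ≤ c → Real.exp (-(c * |Real.log δ|)) = δ ^ c := fun c hc => by
    rw [Real.rpow_def_of_pos hδ]
    have : Real.log δ ≤ 0 := Real.log_nonpos hδ.le hδlt
    rw [abs_of_nonpos this]; congr 1; ring
  have hK0 : 0 ≤ K := by
    have : 0 < K / δ := lt_of_lt_of_le (by positivity) hK
    exact le_of_lt ((div_pos_iff_of_pos_right hδ).1 this)
  -- the coordinates
  have h1 : (gaussVec l).real {b | ∃ k, noiseTrunc δ < |b k|} ≤ 2 * K * δ ^ 10 := by
    refine (gaussVec_abs_apply_gt l (by unfold noiseTrunc; positivity)).trans ?_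
    have e : -noiseTrunc δ ^ 2 / 2 = -((25 / 2) * |Real.log δ|) := by
      rw [noiseTrunc, mul_pow, Real.sq_sqrt (abs_nonneg _)]; ring
    rw [e, hpow _ (by norm_num)]
    -- The spare powers of `δ` pay for the number of coordinates, at most `K / δ`.
    calc 2 * ((l : ℝ) + 1) * δ ^ (25 / 2 : ℝ) ≤ 2 * (K / δ) * δ ^ (11 : ℝ) := by
          refine mul_le_mul (by linarith) ?_ (by positivity) (by positivity)
          exact Real.rpow_le_rpow_of_exponent_ge hδ hδlt (by norm_num)
      _ = 2 * K * δ ^ 10 := by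
          rw [show (11 : ℝ) = ((11 : ℕ) : ℝ) by norm_num, Real.rpow_natCast]
          field_simp
  have h2 : (gaussVec l).real {b | noiseOp κ δ l < tzOp l (ser l b)} ≤ 8 * δ ^ 10 := by
    have := measure_noiseOp_lt_le (l := l) hκ hδ hδ1 (j := 0) (by simp)
    simpa using this
  -- the error
  have h3 : (gaussVec l).real (boundedNoise l (noiseTrunc δ) (noiseOp κ δ l) ∩
      {b | tzOp l A⁻¹ < 2 * (opLevel κ δ l)⁻¹ ∧ opErrBound l A δ F < |opErr l A f δ b|}) ≤
      17 * δ ^ 10 := by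
    by_cases h : tzOp l A⁻¹ < 2 * (opLevel κ δ l)⁻¹
    · simp only [h, true_and]
      have S := noiseBounds_of_lt hκ hδ hδ1 hF hA hf h
      refine (S.measure_opErr_gt_le (momentOrder δ)).trans ?_
      have hm : (momentOrder δ : ℝ) ≤ 5 * |Real.log δ| := Nat.floor_le (by positivity)
      have hm' : 5 * |Real.log δ| < momentOrder δ + 1 := Nat.lt_floor_add_one _
      -- The power of `l + 1` from the moment bound; its exponent is at most `10 |log δ|` because
      -- `|log δ| ≥ 1`.
      have q1 := measure_noiseOp_lt_le (l := l) hκ hδ hδ1 (j := momentOrder δ + 2)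
        (by push_cast; linarith)
      have q2 : Real.exp (-(2 * momentOrder δ + 2)) ≤ δ ^ 10 := by
        calc _ ≤ Real.exp (-(10 * |Real.log δ|)) := Real.exp_le_exp.2 (by linarith)
          _ = δ ^ 10 := by
            rw [hpow _ (by norm_num), show (10 : ℝ) = ((10 : ℕ) : ℝ) by norm_num, Real.rpow_natCast]
      have q3 : δ ^ 10 ≤ 1 := pow_le_one₀ hδ.le hδlt
      refine mul_le_mul ?_ q2 (Real.exp_pos _).le (by norm_num)
      linarith
    · simp only [h, false_and, Set.ofPred_false, Set.inter_empty, measureReal_empty]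
      positivity
  have hsub : (goodNoise κ δ F l A f)ᶜ ⊆ ({b | ∃ k, noiseTrunc δ < |b k|} ∪
      {b | noiseOp κ δ l < tzOp l (ser l b)}) ∪
      (boundedNoise l (noiseTrunc δ) (noiseOp κ δ l) ∩
      {b | tzOp l A⁻¹ < 2 * (opLevel κ δ l)⁻¹ ∧ opErrBound l A δ F < |opErr l A f δ b|}) := by
    intro b hb
    by_cases hb1 : ∃ k, noiseTrunc δ < |b k|
    · exact Or.inl (Or.inl hb1)
    by_cases hb2 : noiseOp κ δ l < tzOp l (ser l b)
    · exact Or.inl (Or.inr hb2)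
    refine Or.inr ?_
    have hb3 : b ∈ boundedNoise l (noiseTrunc δ) (noiseOp κ δ l) := by
      push Not at hb1 hb2
      exact ⟨hb1, hb2⟩
    refine ⟨hb3, ?_⟩
    by_contra hcon
    refine hb ⟨hb3, fun h => ?_⟩
    by_contra h'
    exact hcon ⟨h, not_le.1 h'⟩
  refine (measureReal_mono hsub (measure_ne_top _ _)).trans ((measureReal_union_le _ _).trans ?_)
  have := measureReal_union_le (μ := gaussVec l) {b | ∃ k, noiseTrunc δ < |b k|}
    {b | noiseOp κ δ l < tzOp l (ser l b)}
  linarith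

/-- One factor `√|log δ|` comes from truncating the coordinates and one from the order of the
moment; together they give the `δ |log δ|` of the signal threshold. -/
lemma opErrBound_le (hδ : 0 < δ) (hδ1 : δ ≤ Real.exp (-1)) (hF : 0 < F) :
    opErrBound l A δ F ≤ 600 * F * (δ * |Real.log δ|) * l2 l A⁻¹ := by
  have hL := one_le_abs_log hδ hδ1
  have hu := l2_nonneg l A⁻¹
  have hm : (momentOrder δ : ℝ) ≤ 5 * |Real.log δ| := Nat.floor_le (by positivity)
  have h1 : Real.sqrt (momentOrder δ + 1) ≤ 5 / 2 * Real.sqrt |Real.log δ| := by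
    refine Real.sqrt_le_iff.2 ⟨by positivity, ?_⟩
    rw [mul_pow, Real.sq_sqrt (abs_nonneg _)]; linarith
  rw [opErrBound, noiseTrunc]
  calc _ ≤ 3 * (16 * (5 / 2 * Real.sqrt |Real.log δ|) *
        (δ * (5 * Real.sqrt |Real.log δ|) * l2 l A⁻¹ * F)) := by gcongr
    _ = 600 * F * (δ * Real.sqrt |Real.log δ| ^ 2) * l2 l A⁻¹ := by ring
    _ = _ := by rw [Real.sq_sqrt (abs_nonneg _)]

end GoodNoise

/-! ### Pointwise error of the thresholded coefficient. -/

section LevelEstimate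

open PowerSeries

/-- The error due to the signal noise, `∑_j p_{l-j} ξ_j`. -/
noncomputable def xiErr (l : ℕ) (p : ℝ⟦X⟧) (ξ : EuclideanSpace ℝ (Fin (l + 1))) : ℝ :=
  ∑ j : Fin (l + 1), PowerSeries.coeff (l - j) p * ξ j

/-- The last coordinate of the noisy inverse applied to the noisy signal. -/
noncomputable def rawEst (ε δ : ℝ) (A f : ℝ⟦X⟧) (l : ℕ) (b : Fin (l + 1) → ℝ)
    (ξ : EuclideanSpace ℝ (Fin (l + 1))) : ℝ :=
  PowerSeries.coeff l (noisyInv l A δ b * (A * f)) + ε * xiErr l (noisyInv l A δ b) ξ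

/-- The finite part of the signal threshold. -/
noncomputable def sigThr (τsig τop ε δ : ℝ) (A : ℝ⟦X⟧) (l : ℕ) (b : Fin (l + 1) → ℝ) : ℝ :=
  tzHS l (noisyInv l A δ b) * (max (l : ℝ) 1) ^ (-(1 / 2) : ℝ) *
    max (τsig * (ε * Real.sqrt |Real.log ε|)) (τop * (δ * |Real.log δ|))

open Classical in
/-- The estimator of the coefficient of index `l`. -/
noncomputable def levelEst (κ τsig τop ε δ : ℝ) (A f : ℝ⟦X⟧) (l : ℕ) (b : Fin (l + 1) → ℝ)
    (ξ : EuclideanSpace ℝ (Fin (l + 1))) : ℝ :=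
  if tzOp l (noisyInv l A δ b) < (opLevel κ δ l)⁻¹ ∧
    sigThr τsig τop ε δ A l b < |rawEst ε δ A f l b ξ| then rawEst ε δ A f l b ξ else 0

variable {κ τsig τop ε δ F q : ℝ} {l : ℕ} {A f : ℝ⟦X⟧} {b : Fin (l + 1) → ℝ}
  {ξ : EuclideanSpace ℝ (Fin (l + 1))}

lemma rawEst_eq (h : constantCoeff (A + δ • ser l b) ≠ 0) :
    rawEst ε δ A f l b ξ = PowerSeries.coeff l f + opErr l A f δ b +
      ε * xiErr l (noisyInv l A δ b) ξ := by
  have h1 : noisyInv l A δ b * (A + δ • ser l b) = 1 := PowerSeries.inv_mul_cancel _ h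
  have h2 : noisyInv l A δ b * (A * f) = f - noisyInv l A δ b * (δ • ser l b) * f := by
    calc _ = (noisyInv l A δ b * (A + δ • ser l b)) * f - noisyInv l A δ b * (δ • ser l b) * f := by
          ring
      _ = _ := by rw [h1, one_mul]
  rw [rawEst, h2, map_sub, opErr]; ring

/-- A singular noisy operator has inverse `0`, which passes the operator test; but then the raw
statistic is `0` and so is the estimator. -/
lemma levelEst_eq_zero_of_singular (h : constantCoeff (A + δ • ser l b) = 0) :
    levelEst κ τsig τop ε δ A f l b ξ = 0 := by
  have h0 : noisyInv l A δ b = 0 := PowerSeries.inv_eq_zero.2 h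
  have : rawEst ε δ A f l b ξ = 0 := by simp [rawEst, h0, xiErr]
  rw [levelEst, this]; simp

/-- The error of thresholding. -/
lemma threshold_sq_le {f G n S : ℝ} (hG : |G| ≤ S / 4) :
    ((if S < |f + G + n| then f + G + n else 0) - f) ^ 2 ≤
      min (f ^ 2) (9 / 4 * S ^ 2) + if S / 4 < |n| then 36 * n ^ 2 else 0 := by
  have hS : 0 ≤ S := by linarith [abs_nonneg G]
  have hm : 0 ≤ min (f ^ 2) (9 / 4 * S ^ 2) := le_min (sq_nonneg _) (by positivity)
  have key : ∀ {x y : ℝ}, |x| ≤ y → x ^ 2 ≤ y ^ 2 := fun h => by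
    rw [← sq_abs]; exact pow_le_pow_left₀ (abs_nonneg _) h 2
  have a1 := abs_add_le G n
  have a2 : |f| ≤ |f + G + n| + |G + n| := by
    have := abs_sub (f + G + n) (G + n)
    rwa [show f + G + n - (G + n) = f by ring] at this
  have a3 : |f + G + n| ≤ |f| + |G + n| := by
    have := abs_add_le f (G + n)
    rwa [show f + (G + n) = f + G + n by ring] at this
  -- If `|n| ≤ S/4`, then `|G + n| ≤ S/2`: a kept value forces `|f| ≥ S/2`, a killed one forces `|f|
  -- ≤ 3S/2`. If `|n| > S/4`, every quantity, including the threshold, is a multiple of `|n|`, and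
  -- the error is at most `6|n|`.
  split_ifs with h1 h2 h2
  · rw [show f + G + n - f = G + n by ring]
    have : (G + n) ^ 2 ≤ (6 * |n|) ^ 2 := key (by linarith)
    rw [mul_pow, sq_abs] at this
    linarith
  · rw [show f + G + n - f = G + n by ring, add_zero]
    refine le_min ?_ ?_
    · rw [← sq_abs f]; exact key (by linarith)
    · have := key (x := G + n) (y := 3 / 2 * S) (by linarith)
      linarith
  · have := key (x := f) (y := 6 * |n|) (by linarith)
    rw [mul_pow, sq_abs] at this
    rw [zero_sub, neg_sq]; linarith
  · rw [zero_sub, neg_sq, add_zero]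
    refine le_min le_rfl ?_
    have := key (x := f) (y := 3 / 2 * S) (by linarith)
    linarith

/-- The error at the level `l` when the operator noise is good. -/
lemma levelEst_sub_sq_le_of_good (hκ : 512 ≤ κ) (hδ : 0 < δ) (hδ1 : δ ≤ Real.exp (-1)) (hε : 0 < ε)
    (hF : 0 < F) (hA : constantCoeff A ≠ 0) (hq : 0 < q)
    (hqA : l2 l A⁻¹ ≤ q * (tzHS l A⁻¹ * (max (l : ℝ) 1) ^ (-(1 / 2) : ℝ)))
    (hsig : 0 < τsig) (hop : 3600 * F * q ≤ τop) (hb : b ∈ goodNoise κ δ F l A f) :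
    (levelEst κ τsig τop ε δ A f l b ξ - PowerSeries.coeff l f) ^ 2 ≤
      (if 2 * tzOp l A⁻¹ < (opLevel κ δ l)⁻¹ then min (PowerSeries.coeff l f ^ 2)
        (9 * (tzHS l A⁻¹ * (max (l : ℝ) 1) ^ (-(1 / 2) : ℝ) * (max τsig τop *
          max (ε * Real.sqrt |Real.log ε|) (δ * |Real.log δ|))) ^ 2)
        else PowerSeries.coeff l f ^ 2) +
      if tzOp l A⁻¹ < 2 * (opLevel κ δ l)⁻¹ ∧ tzOp l (ser l b) ≤ noiseOp κ δ l then
        36 * ε ^ 2 * (if τsig / (6 * q) * l2 l A⁻¹ * Real.sqrt |Real.log ε| <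
          |xiErr l (noisyInv l A δ b) ξ| then xiErr l (noisyInv l A δ b) ξ ^ 2 else 0) else 0 := by
  have hτop : 0 < τop := lt_of_lt_of_le (by positivity) hop
  have hO : 0 < opLevel κ δ l := hδ.trans_le (le_opLevel hκ hδ hδ1)
  have hbn := hb.1.2
  have hδW : tzOp l (δ • ser l b) ≤ opLevel κ δ l / 8 := by
    rw [tzOp_smul, abs_of_pos hδ, ← mul_noiseOp]
    exact mul_le_mul_of_nonneg_left hbn hδ.le
  set f0 := PowerSeries.coeff l f
  set y := xiErr l (noisyInv l A δ b) ξ with hy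
  set u := l2 l A⁻¹ with hu
  have hu0 : 0 ≤ u := l2_nonneg _ _
  set h := tzHS l A⁻¹ * (max (l : ℝ) 1) ^ (-(1 / 2) : ℝ) with hh
  have hl0 : (0 : ℝ) < max (l : ℝ) 1 := lt_max_of_lt_right one_pos
  have hh0 : 0 ≤ h := mul_nonneg (tzHS_nonneg _ _) (Real.rpow_nonneg hl0.le _)
  have hN := tzOp_nonneg l A⁻¹
  set ρε := ε * Real.sqrt |Real.log ε| with hρε
  have hρε0 : 0 ≤ ρε := by positivity
  set ρδ := δ * |Real.log δ| with hρδ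
  have hρδ0 : 0 ≤ ρδ := by positivity
  have hsecond : 0 ≤ (if tzOp l A⁻¹ < 2 * (opLevel κ δ l)⁻¹ ∧ tzOp l (ser l b) ≤ noiseOp κ δ l then
        36 * ε ^ 2 * (if τsig / (6 * q) * u * Real.sqrt |Real.log ε| <
          |y| then y ^ 2 else 0) else 0) := by
    split_ifs <;> positivity
  -- Acceptance forces the true inverse below twice the limit, so the noisy and true norms are
  -- comparable. Rejection forces it above half the limit, where the bound is the full squared
  -- coefficient.
  by_cases hacc : constantCoeff (A + δ • ser l b) ≠ 0 ∧
      tzOp l (noisyInv l A δ b) < (opLevel κ δ l)⁻¹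
  · obtain ⟨hne, hacc⟩ := hacc
    have hsm : tzOp l (noisyInv l A δ b) * tzOp l (δ • ser l b) ≤ 1 / 2 := by
      calc _ ≤ (opLevel κ δ l)⁻¹ * (opLevel κ δ l / 8) :=
            mul_le_mul hacc.le hδW (tzOp_nonneg _ _) (by positivity)
        _ = 1 / 8 := by field_simp
        _ ≤ _ := by norm_num
    have hN2 : tzOp l A⁻¹ < 2 * (opLevel κ δ l)⁻¹ :=
      (tzOp_inv_le_of_perturbed l hne hsm).trans_lt (by
        have : tzOp l (A + δ • ser l b)⁻¹ < (opLevel κ δ l)⁻¹ := hacc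
        linarith)
    have hI : InvPerturb l A (δ • ser l b) := by
      refine ⟨hA, ?_⟩
      calc _ ≤ 2 * (opLevel κ δ l)⁻¹ * (opLevel κ δ l / 8) :=
            mul_le_mul hN2.le hδW (tzOp_nonneg _ _) (by positivity)
        _ = 1 / 4 := by field_simp; norm_num
        _ ≤ _ := by norm_num
    have hHSup : tzHS l (noisyInv l A δ b) ≤ 2 * tzHS l A⁻¹ := hI.tzHS_inv_le
    have hHSlo : tzHS l A⁻¹ ≤ 3 / 2 * tzHS l (noisyInv l A δ b) := hI.tzHS_le
    set S := sigThr τsig τop ε δ A l b with hS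
    have hw := Real.rpow_nonneg hl0.le (-(1 / 2))
    set w := (max (l : ℝ) 1) ^ (-(1 / 2) : ℝ) with hwdef
    set mx := max (τsig * ρε) (τop * ρδ) with hmx
    have hmx0 : 0 ≤ mx := le_max_of_le_left (by positivity)
    have hSlo : 2 / 3 * h * mx ≤ S := by
      rw [hS, sigThr, hh]
      refine mul_le_mul_of_nonneg_right ?_ hmx0
      rw [← mul_assoc]
      exact mul_le_mul_of_nonneg_right (by linarith) hw
    have hSup : S ≤ 2 * (h * (max τsig τop * max ρε ρδ)) := by
      have hmx2 : mx ≤ max τsig τop * max ρε ρδ := by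
        refine max_le ?_ ?_
        · exact mul_le_mul (le_max_left _ _) (le_max_left _ _) hρε0 (le_max_of_le_left hsig.le)
        · exact mul_le_mul (le_max_right _ _) (le_max_right _ _) hρδ0 (le_max_of_le_left hsig.le)
      rw [hS, sigThr, hh]
      calc _ ≤ 2 * tzHS l A⁻¹ * w * (max τsig τop * max ρε ρδ) := by
            refine mul_le_mul (mul_le_mul_of_nonneg_right hHSup hw) hmx2 hmx0 ?_
            exact mul_nonneg (mul_nonneg two_pos.le (tzHS_nonneg _ _)) hw
        _ = _ := by ring
    have hS0 : 0 ≤ S := le_trans (by positivity) hSlo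
    -- The constant `3600` is `600 · 4 · 3/2`: the constant of `opErrBound_le`, the quarter of the
    -- threshold, and the comparison of Hilbert-Schmidt norms.
    have hG : |opErr l A f δ b| ≤ S / 4 := by
      refine (hb.2 hN2).trans ((opErrBound_le hδ hδ1 hF).trans ?_)
      have h1 : 600 * F * ρδ * u ≤ 600 * F * ρδ * (q * h) :=
        mul_le_mul_of_nonneg_left hqA (by positivity)
      have h2 : 3600 * F * q * ρδ ≤ mx :=
        (mul_le_mul_of_nonneg_right hop hρδ0).trans (le_max_right _ _)
      have h3 := mul_le_mul_of_nonneg_left h2 hh0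
      nlinarith
    -- The divisor `6 q` comes from `S / 4 ≥ h * mx / 6` and `u ≤ q * h`.
    have hx : ε * (τsig / (6 * q) * u * Real.sqrt |Real.log ε|) ≤ S / 4 := by
      have h1 : u / q ≤ h := by rw [div_le_iff₀ hq]; linarith
      have h2 : τsig * ρε ≤ mx := le_max_left _ _
      have h3 : u / q * (τsig * ρε) ≤ h * mx := mul_le_mul h1 h2 (by positivity) hh0
      have e : ε * (τsig / (6 * q) * u * Real.sqrt |Real.log ε|) = 1 / 6 * (u / q * (τsig * ρε)) := by
        rw [hρε]; field_simp
      rw [e]; linarith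
    have hest : levelEst κ τsig τop ε δ A f l b ξ =
        if S < |f0 + opErr l A f δ b + ε * y| then f0 + opErr l A f δ b + ε * y else 0 := by
      rw [levelEst, rawEst_eq hne]
      simp only [hacc, true_and]
      rfl
    rw [hest]
    refine (threshold_sq_le hG).trans (add_le_add ?_ ?_)
    · have h4 : 9 / 4 * S ^ 2 ≤ 9 * (h * (max τsig τop * max ρε ρδ)) ^ 2 := by
        have := pow_le_pow_left₀ hS0 hSup 2
        rw [mul_pow] at this; linarith
      split_ifs
      · exact min_le_min le_rfl h4
      · exact min_le_left _ _
    · have hP : tzOp l A⁻¹ < 2 * (opLevel κ δ l)⁻¹ ∧ tzOp l (ser l b) ≤ noiseOp κ δ l := ⟨hN2, hbn⟩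
      rw [if_pos hP]
      have hy2 : |ε * y| = ε * |y| := by rw [abs_mul, abs_of_pos hε]
      by_cases h5 : S / 4 < |ε * y|
      · have h6 : τsig / (6 * q) * u * Real.sqrt |Real.log ε| < |y| := by
          rw [hy2] at h5
          exact lt_of_mul_lt_mul_left (hx.trans_lt h5) hε.le
        rw [if_pos h5, if_pos h6, mul_pow]; exact le_of_eq (by ring)
      · rw [if_neg h5]; split_ifs <;> positivity
  · have h0 : levelEst κ τsig τop ε δ A f l b ξ = 0 := by
      by_cases hne : constantCoeff (A + δ • ser l b) = 0
      · exact levelEst_eq_zero_of_singular hne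
      · have : ¬ tzOp l (noisyInv l A δ b) < (opLevel κ δ l)⁻¹ := fun h => hacc ⟨hne, h⟩
        rw [levelEst, if_neg fun h => this h.1]
    have hno : ¬ 2 * tzOp l A⁻¹ < (opLevel κ δ l)⁻¹ := fun hlt => by
      have hI : InvPerturb l A (δ • ser l b) := by
        refine ⟨hA, ?_⟩
        calc _ ≤ (opLevel κ δ l)⁻¹ * (opLevel κ δ l / 8) :=
              mul_le_mul (by linarith) hδW (tzOp_nonneg _ _) (by positivity)
          _ = 1 / 8 := by field_simp
          _ ≤ _ := by norm_num
      exact hacc ⟨hI.const_add_ne, lt_of_le_of_lt hI.tzOp_inv_le hlt⟩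
    rw [h0, zero_sub, neg_sq, if_neg hno]
    exact le_add_of_nonneg_right hsecond

/-- The error at the level `l` without any assumption on the operator noise. -/
lemma levelEst_sub_sq_le (hκ : 512 ≤ κ) (hδ : 0 < δ) (hδ1 : δ ≤ Real.exp (-1))
    (hF : 0 < F) (hf : ∑ k ∈ Finset.range (l + 1), |PowerSeries.coeff k f| ≤ F) :
    (levelEst κ τsig τop ε δ A f l b ξ - PowerSeries.coeff l f) ^ 2 ≤
      PowerSeries.coeff l f ^ 2 + 2 * F ^ 2 * tzOp l (ser l b) ^ 2 +
      if tzOp l (noisyInv l A δ b) < (opLevel κ δ l)⁻¹ then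
        2 * ε ^ 2 * xiErr l (noisyInv l A δ b) ξ ^ 2 else 0 := by
  have hO : 0 < opLevel κ δ l := hδ.trans_le (le_opLevel hκ hδ hδ1)
  have hO1 : δ * (opLevel κ δ l)⁻¹ ≤ 1 := by
    rw [← div_eq_mul_inv, div_le_one hO]; exact le_opLevel hκ hδ hδ1
  set f0 := PowerSeries.coeff l f
  have hnn : 0 ≤ if tzOp l (noisyInv l A δ b) < (opLevel κ δ l)⁻¹ then
        2 * ε ^ 2 * xiErr l (noisyInv l A δ b) ξ ^ 2 else 0 := by split_ifs <;> positivity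
  by_cases h0 : levelEst κ τsig τop ε δ A f l b ξ = 0
  · rw [h0, zero_sub, neg_sq]
    have : 0 ≤ 2 * F ^ 2 * tzOp l (ser l b) ^ 2 := by positivity
    linarith
  · have hne : constantCoeff (A + δ • ser l b) ≠ 0 := fun h => h0 (levelEst_eq_zero_of_singular h)
    have hacc : tzOp l (noisyInv l A δ b) < (opLevel κ δ l)⁻¹ := by
      by_contra h
      exact h0 (by rw [levelEst, if_neg fun h' => h h'.1])
    have hr : levelEst κ τsig τop ε δ A f l b ξ = rawEst ε δ A f l b ξ := by
      rw [levelEst] at h0 ⊢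
      split_ifs with h
      · rfl
      · rw [if_neg h] at h0; exact absurd rfl h0
    rw [hr, rawEst_eq hne, if_pos hacc]
    -- Acceptance bounds the noisy inverse by `δ⁻¹`, which cancels the factor `δ` of the noise.
    have hG : |opErr l A f δ b| ≤ tzOp l (ser l b) * F := by
      rw [opErr, abs_neg]
      refine (abs_coeff_le_l2 l _ le_rfl).trans ((l2_le_tzOp _ _).trans ?_)
      refine (tzOp_mul_le _ _ _).trans (mul_le_mul ?_ ((tzOp_le_sum_abs l f).trans hf)
        (tzOp_nonneg _ _) (tzOp_nonneg _ _))
      refine (tzOp_mul_le _ _ _).trans ?_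
      rw [tzOp_smul, abs_of_pos hδ]
      have hW := tzOp_nonneg l (ser l b)
      calc _ ≤ (opLevel κ δ l)⁻¹ * (δ * tzOp l (ser l b)) :=
            mul_le_mul_of_nonneg_right hacc.le (by positivity)
        _ = δ * (opLevel κ δ l)⁻¹ * tzOp l (ser l b) := by ring
        _ ≤ _ := mul_le_of_le_one_left hW hO1
    have hG2 : opErr l A f δ b ^ 2 ≤ F ^ 2 * tzOp l (ser l b) ^ 2 := by
      rw [← sq_abs, ← mul_pow, mul_comm F]
      exact pow_le_pow_left₀ (abs_nonneg _) hG 2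
    set G := opErr l A f δ b
    set n := ε * xiErr l (noisyInv l A δ b) ξ with hn
    have e : 2 * ε ^ 2 * xiErr l (noisyInv l A δ b) ξ ^ 2 = 2 * n ^ 2 := by rw [hn]; ring
    rw [e]
    have : f0 + G + n - f0 = G + n := by ring
    rw [this]
    nlinarith [sq_nonneg (G - n), sq_nonneg f0]

end LevelEstimate

/-! ### Expected squared error at one level. -/

section LevelIntegral

open PowerSeries

lemma CoeffMeasurable.tzHS {Ω : Type*} [MeasurableSpace Ω] {p : Ω → ℝ⟦X⟧} (hp : CoeffMeasurable p)
    (l : ℕ) : Measurable fun ω => tzHS l (p ω) := by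
  have : (fun ω => LaplaceDeconv.tzHS l (p ω)) = fun ω => Real.sqrt (∑ k ∈ Finset.range (l + 1),
      ∑ n ∈ Finset.range (k + 1), PowerSeries.coeff n (p ω) ^ 2) := by
    funext ω; rw [← tzHS_sq, Real.sqrt_sq (tzHS_nonneg _ _)]
  rw [this]
  exact (Finset.measurable_sum _ fun k _ => Finset.measurable_sum _ fun n _ =>
    (hp n).pow_const 2).sqrt

lemma measurable_rawEst (ε δ : ℝ) (A f : ℝ⟦X⟧) (l : ℕ) :
    Measurable fun z : (Fin (l + 1) → ℝ) × EuclideanSpace ℝ (Fin (l + 1)) =>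
      rawEst ε δ A f l z.1 z.2 := by
  have h1 := coeffMeasurable_noisyInv l A δ
  refine Measurable.add ?_ (Measurable.const_mul (Finset.measurable_sum _ fun j _ => ?_) _)
  · exact ((h1.mul (CoeffMeasurable.const (A * f))) l).comp measurable_fst
  · exact ((h1 (l - j)).comp measurable_fst).mul (by fun_prop)

lemma measurable_levelEst (κ τsig τop ε δ : ℝ) (A f : ℝ⟦X⟧) (l : ℕ) :
    Measurable fun z : (Fin (l + 1) → ℝ) × EuclideanSpace ℝ (Fin (l + 1)) =>
      levelEst κ τsig τop ε δ A f l z.1 z.2 := by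
  have h1 := coeffMeasurable_noisyInv l A δ
  refine Measurable.ite (MeasurableSet.inter ?_ ?_) (measurable_rawEst ε δ A f l) measurable_const
  · exact measurableSet_lt ((h1.tzOp l).comp measurable_fst) measurable_const
  · refine measurableSet_lt ?_ (measurable_rawEst ε δ A f l).abs
    exact (((h1.tzHS l).mul_const _).mul_const _).comp measurable_fst

variable {κ τsig τop ε δ F q C θ : ℝ} {l : ℕ} {A f : ℝ⟦X⟧}
  {μ : Measure (EuclideanSpace ℝ (Fin (l + 1)))} [IsProbabilityMeasure μ]

/-- Every linear functional is a centred Gaussian variable whose variance is at most `C` times the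
squared norm. -/
def SubGaussianLaw (l : ℕ) (μ : Measure (EuclideanSpace ℝ (Fin (l + 1)))) (C : ℝ) : Prop :=
  ∀ v : Fin (l + 1) → ℝ, ∃ w : NNReal, (w : ℝ) ≤ C * ∑ i, v i ^ 2 ∧
    μ.map (fun x : EuclideanSpace ℝ (Fin (l + 1)) => ∑ i, v i * x i) = gaussianReal 0 w

omit [IsProbabilityMeasure μ] in
lemma exists_map_xiErr (hμ : SubGaussianLaw l μ C) (p : ℝ⟦X⟧) :
    ∃ w : NNReal, (w : ℝ) ≤ C * l2 l p ^ 2 ∧ μ.map (xiErr l p) = gaussianReal 0 w := by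
  have := hμ fun j => PowerSeries.coeff (l - j) p
  rw [sum_coeff_rev_sq] at this
  exact this

lemma measurable_xiErr (l : ℕ) (p : ℝ⟦X⟧) : Measurable (xiErr l p) := by
  unfold xiErr; fun_prop

omit [IsProbabilityMeasure μ] in
lemma lintegral_xiErr_sq_le (hμ : SubGaussianLaw l μ C) (p : ℝ⟦X⟧) :
    ∫⁻ x, ENNReal.ofReal (xiErr l p x ^ 2) ∂μ ≤ ENNReal.ofReal (C * l2 l p ^ 2) := by
  obtain ⟨w, hw, hmap⟩ := exists_map_xiErr hμ p
  rw [← lintegral_map (f := fun y : ℝ => ENNReal.ofReal (y ^ 2)) (by fun_prop) (measurable_xiErr l p),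
    hmap, lintegral_sq_gaussianReal, ← ENNReal.ofReal_coe_nnreal]
  exact ENNReal.ofReal_le_ofReal hw

omit [IsProbabilityMeasure μ] in
lemma lintegral_xiErr_tail_le (hμ : SubGaussianLaw l μ C) (p : ℝ⟦X⟧) {v x : ℝ}
    (hv : C * l2 l p ^ 2 ≤ v) (hv0 : 0 < v) (hx : 0 < x) :
    ∫⁻ y, ENNReal.ofReal (if x < |xiErr l p y| then xiErr l p y ^ 2 else 0) ∂μ ≤
      ENNReal.ofReal (64 * v ^ 2 / x ^ 2 * Real.exp (-(x ^ 2 / (8 * v)))) := by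
  obtain ⟨w, hw, hmap⟩ := exists_map_xiErr hμ p
  have hm : Measurable fun y : ℝ => ENNReal.ofReal (if x < |y| then y ^ 2 else 0) := by
    refine ENNReal.measurable_ofReal.comp (Measurable.ite ?_ (by fun_prop) measurable_const)
    exact measurableSet_lt measurable_const (by fun_prop)
  rw [← lintegral_map (f := fun y : ℝ => ENNReal.ofReal (if x < |y| then y ^ 2 else 0)) hm
    (measurable_xiErr l p), hmap]
  exact lintegral_sq_tail_gaussianReal_le' (hw.trans hv) hv0 hx

/-- The condition on `τsig` makes the Gaussian exponent at least `θ |log ε|`, which gives `ε ^ θ`.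
As this exponent is also at least one, the prefactor is at most eight times the variance bound. -/
lemma tail_bound_le (hε : 0 < ε) (hε1 : ε ≤ Real.exp (-1)) (hq : 0 < q) (hC : 0 ≤ C) (hθ : 1 ≤ θ)
    (hsig0 : 0 < τsig) (hsig : 1152 * θ * q ^ 2 * (C + 1) ≤ τsig ^ 2) {u : ℝ} (hu : 0 < u) :
    64 * (4 * (C + 1) * u ^ 2) ^ 2 / (τsig / (6 * q) * u * Real.sqrt |Real.log ε|) ^ 2 *
      Real.exp (-((τsig / (6 * q) * u * Real.sqrt |Real.log ε|) ^ 2 / (8 * (4 * (C + 1) * u ^ 2)))) ≤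
      32 * (C + 1) * u ^ 2 * ε ^ θ := by
  have hL := one_le_abs_log hε hε1
  set v := 4 * (C + 1) * u ^ 2 with hv
  have hv0 : 0 < v := by positivity
  set Λ := |Real.log ε| with hΛ
  set x := τsig / (6 * q) * u * Real.sqrt Λ with hx
  have hx0 : 0 < x := by positivity
  have hx2 : x ^ 2 / (8 * v) = τsig ^ 2 * Λ / (1152 * q ^ 2 * (C + 1)) := by
    rw [hx, mul_pow, mul_pow, div_pow, Real.sq_sqrt (by positivity), hv]; field_simp; norm_num
  have h1 : θ * Λ ≤ x ^ 2 / (8 * v) := by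
    rw [hx2, le_div_iff₀ (by positivity)]
    nlinarith
  have h2 : 64 * v ^ 2 / x ^ 2 ≤ 8 * v := by
    rw [div_le_iff₀ (by positivity)]
    have h3 : 1 ≤ x ^ 2 / (8 * v) := by nlinarith
    rw [le_div_iff₀ (by positivity)] at h3
    nlinarith
  have h4 : Real.exp (-(x ^ 2 / (8 * v))) ≤ ε ^ θ := by
    have : ε ^ θ = Real.exp (-(θ * Λ)) := by
      rw [Real.rpow_def_of_pos hε, hΛ, abs_of_nonpos
        (Real.log_nonpos hε.le (hε1.trans (Real.exp_le_one_iff.2 (by norm_num))))]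
      congr 1; ring
    rw [this]
    exact Real.exp_le_exp.2 (by linarith)
  calc _ ≤ 8 * v * ε ^ θ := mul_le_mul h2 h4 (Real.exp_pos _).le (by positivity)
    _ = _ := by rw [hv]; ring

/-- The squared operator norm of the noise on a small event. -/
lemma lintegral_indicator_tzOp_sq_le {B : Set (Fin (l + 1) → ℝ)} (hB : MeasurableSet B) {π t : ℝ}
    (hπ : (gaussVec l).real B ≤ π) (ht : 0 < t) :
    ∫⁻ b, B.indicator (fun b => ENNReal.ofReal (tzOp l (ser l b) ^ 2)) b ∂gaussVec l ≤
      ENNReal.ofReal ((l + 1) ^ 2 * (144 * t + π / (4 * t))) := by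
  have hπ0 : 0 ≤ π := measureReal_nonneg.trans hπ
  have hpt : ∀ b, B.indicator (fun b => ENNReal.ofReal (tzOp l (ser l b) ^ 2)) b ≤
      ∑ k : Fin (l + 1), (ENNReal.ofReal ((l + 1) * t) * ENNReal.ofReal (b k ^ 4) +
        ENNReal.ofReal ((l + 1) / (4 * t)) * B.indicator (fun _ => 1) b) := fun b => by
    by_cases hb : b ∈ B
    · simp only [Set.indicator_of_mem hb, mul_one]
      have h1 : tzOp l (ser l b) ≤ ∑ k : Fin (l + 1), |b k| := by
        refine (tzOp_le_sum_abs l _).trans (le_of_eq ?_)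
        rw [← Fin.sum_univ_eq_sum_range (fun k => |PowerSeries.coeff k (ser l b)|)]
        simp_rw [coeff_ser]
      have h2 : tzOp l (ser l b) ^ 2 ≤ ∑ k : Fin (l + 1), ((l + 1) * t * b k ^ 4 + (l + 1) / (4 * t)) := by
        calc _ ≤ (∑ k : Fin (l + 1), |b k|) ^ 2 := pow_le_pow_left₀ (tzOp_nonneg _ _) h1 2
          _ ≤ (l + 1) * ∑ k : Fin (l + 1), |b k| ^ 2 := by
            have := sq_sum_le_card_mul_sum_sq (s := (Finset.univ : Finset (Fin (l + 1))))
              (f := fun k : Fin (l + 1) => |b k|)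
            rwa [Finset.card_univ, Fintype.card_fin, Nat.cast_add, Nat.cast_one] at this
          _ ≤ _ := by
            rw [Finset.mul_sum]
            refine Finset.sum_le_sum fun k _ => ?_
            rw [sq_abs]
            -- Young's inequality, in place of Cauchy-Schwarz between the noise and the indicator of
            -- the event; `t` is chosen later.
            have h3 : b k ^ 2 ≤ t * b k ^ 4 + 1 / (4 * t) := by
              have e : t * b k ^ 4 + 1 / (4 * t) - b k ^ 2 = (2 * t * b k ^ 2 - 1) ^ 2 / (4 * t) := by
                field_simp; ring
              have : 0 ≤ (2 * t * b k ^ 2 - 1) ^ 2 / (4 * t) := by positivity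
              linarith
            calc ((l : ℝ) + 1) * b k ^ 2 ≤ (l + 1) * (t * b k ^ 4 + 1 / (4 * t)) := by gcongr
              _ = _ := by ring
      refine (ENNReal.ofReal_le_ofReal h2).trans ?_
      rw [ENNReal.ofReal_sum_of_nonneg fun k _ => by positivity]
      refine Finset.sum_le_sum fun k _ => ?_
      rw [ENNReal.ofReal_add (by positivity) (by positivity), ENNReal.ofReal_mul (by positivity)]
    · rw [Set.indicator_of_notMem hb]; exact bot_le
  refine (lintegral_mono hpt).trans ?_
  have hmeas : ∀ k : Fin (l + 1), Measurable fun b : Fin (l + 1) → ℝ =>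
      ENNReal.ofReal ((l + 1) * t) * ENNReal.ofReal (b k ^ 4) +
        ENNReal.ofReal ((l + 1) / (4 * t)) * B.indicator (fun _ => 1) b := fun k =>
    have hm4 : Measurable fun b : Fin (l + 1) → ℝ => ENNReal.ofReal (b k ^ 4) := by fun_prop
    (hm4.const_mul _).add ((measurable_const.indicator hB).const_mul _)
  rw [lintegral_finsetSum _ fun k _ => hmeas k]
  have hk : ∀ k : Fin (l + 1), ∫⁻ b, (ENNReal.ofReal ((l + 1) * t) * ENNReal.ofReal (b k ^ 4) +
        ENNReal.ofReal ((l + 1) / (4 * t)) * B.indicator (fun _ => 1) b) ∂gaussVec l ≤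
      ENNReal.ofReal ((l + 1) * (144 * t + π / (4 * t))) := fun k => by
    have hm4 : Measurable fun b : Fin (l + 1) → ℝ => ENNReal.ofReal (b k ^ 4) := by fun_prop
    rw [lintegral_add_left (hm4.const_mul _), lintegral_const_mul _ hm4,
      lintegral_const_mul _ (measurable_const.indicator hB), lintegral_indicator_const hB, one_mul]
    have hmk : (gaussVec l).map (fun b : Fin (l + 1) → ℝ => b k) = gaussianReal 0 1 :=
      (measurePreserving_eval (fun _ => gaussianReal 0 1) k).map_eq
    have h4 : ∫⁻ b : Fin (l + 1) → ℝ, ENNReal.ofReal (b k ^ 4) ∂gaussVec l ≤ ENNReal.ofReal 144 := by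
      rw [← lintegral_map (f := fun y : ℝ => ENNReal.ofReal (y ^ 4)) (by fun_prop)
        (measurable_pi_apply k), hmk]
      exact lintegral_pow_four_gaussianReal_le
    have h5 : gaussVec l B ≤ ENNReal.ofReal π := by
      rw [← ofReal_measureReal (measure_ne_top _ _)]
      exact ENNReal.ofReal_le_ofReal hπ
    calc _ ≤ ENNReal.ofReal ((l + 1) * t) * ENNReal.ofReal 144 +
          ENNReal.ofReal ((l + 1) / (4 * t)) * ENNReal.ofReal π := by gcongr
      _ = _ := by
        rw [← ENNReal.ofReal_mul (by positivity), ← ENNReal.ofReal_mul (by positivity),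
          ← ENNReal.ofReal_add (by positivity) (by positivity)]
        congr 1; ring
  refine (Finset.sum_le_sum fun k _ => hk k).trans ?_
  rw [Finset.sum_const, Finset.card_univ, Fintype.card_fin, nsmul_eq_mul,
    ← ENNReal.ofReal_natCast, ← ENNReal.ofReal_mul (by positivity)]
  refine ENNReal.ofReal_le_ofReal (le_of_eq ?_)
  push_cast; ring

/-- The main term of the risk at the level `l`. -/
noncomputable def mainTerm (κ τsig τop ε δ : ℝ) (l : ℕ) (A f : ℝ⟦X⟧) : ℝ :=
  if 2 * tzOp l A⁻¹ < (opLevel κ δ l)⁻¹ then min (PowerSeries.coeff l f ^ 2)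
    (9 * (tzHS l A⁻¹ * (max (l : ℝ) 1) ^ (-(1 / 2) : ℝ) * (max τsig τop *
      max (ε * Real.sqrt |Real.log ε|) (δ * |Real.log δ|))) ^ 2)
  else PowerSeries.coeff l f ^ 2

lemma mainTerm_nonneg (κ τsig τop ε δ : ℝ) (l : ℕ) (A f : ℝ⟦X⟧) :
    0 ≤ mainTerm κ τsig τop ε δ l A f := by
  unfold mainTerm
  split_ifs
  · exact le_min (sq_nonneg _) (by positivity)
  · exact sq_nonneg _

/-- The risk at the level `l`. -/
lemma lintegral_levelEst_le (hκ : 512 ≤ κ) (hδ : 0 < δ) (hδ1 : δ ≤ Real.exp (-1)) (hε : 0 < ε)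
    (hε1 : ε ≤ Real.exp (-1)) (hF : 0 < F) (hA : constantCoeff A ≠ 0) (hq : 0 < q)
    (hqA : l2 l A⁻¹ ≤ q * (tzHS l A⁻¹ * (max (l : ℝ) 1) ^ (-(1 / 2) : ℝ)))
    (hf : ∑ k ∈ Finset.range (l + 1), |PowerSeries.coeff k f| ≤ F) (hC : 0 ≤ C) (hθ : 1 ≤ θ)
    (hsig0 : 0 < τsig) (hsig : 1152 * θ * q ^ 2 * (C + 1) ≤ τsig ^ 2) (hop : 3600 * F * q ≤ τop)
    (hμ : SubGaussianLaw l μ C) {π t : ℝ} (ht : 0 < t)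
    (hπ : (gaussVec l).real (goodNoise κ δ F l A f)ᶜ ≤ π) :
    ∫⁻ z, ENNReal.ofReal ((levelEst κ τsig τop ε δ A f l z.1 z.2 - PowerSeries.coeff l f) ^ 2)
      ∂((gaussVec l).prod μ) ≤ ENNReal.ofReal (mainTerm κ τsig τop ε δ l A f +
        1152 * (C + 1) * l2 l A⁻¹ ^ 2 * ε ^ 2 * ε ^ θ +
        ((PowerSeries.coeff l f ^ 2 + 2 * ε ^ 2 * (C / δ ^ 2)) * π +
        2 * F ^ 2 * ((l + 1) ^ 2 * (144 * t + π / (4 * t))))) := by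
  have hπ0 : 0 ≤ π := measureReal_nonneg.trans hπ
  have hO := le_opLevel (l := l) hκ hδ hδ1
  have hO0 : 0 < opLevel κ δ l := hδ.trans_le hO
  have hL := one_le_abs_log hε hε1
  have hu : 0 < l2 l A⁻¹ := by
    have h0 : PowerSeries.coeff 0 A⁻¹ ≠ 0 := by
      rw [PowerSeries.coeff_zero_eq_constantCoeff_apply, PowerSeries.constantCoeff_inv]
      exact inv_ne_zero hA
    exact (abs_pos.2 h0).trans_le (abs_coeff_le_l2 l _ (Nat.zero_le _))
  set B := (goodNoise κ δ F l A f)ᶜ with hBdef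
  have hB : MeasurableSet B := (measurableSet_goodNoise κ δ F l A f).compl
  set f0 := PowerSeries.coeff l f
  set Φ := mainTerm κ τsig τop ε δ l A f with hΦ
  have hΦ0 : 0 ≤ Φ := mainTerm_nonneg _ _ _ _ _ _ _ _
  set T := 1152 * (C + 1) * l2 l A⁻¹ ^ 2 * ε ^ 2 * ε ^ θ with hT
  have hT0 : 0 ≤ T := by positivity
  have hm := measurable_levelEst κ τsig τop ε δ A f l
  rw [lintegral_prod _ (by fun_prop)]
  have hgood : ∀ b ∉ B, ∫⁻ x, ENNReal.ofReal ((levelEst κ τsig τop ε δ A f l b x - f0) ^ 2) ∂μ ≤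
      ENNReal.ofReal (Φ + T) := fun b hb => by
    have hb' : b ∈ goodNoise κ δ F l A f := not_not.1 hb
    have hpt := fun x => levelEst_sub_sq_le_of_good (ξ := x) hκ hδ hδ1 hε hF hA hq hqA hsig0 hop hb'
    refine (lintegral_mono fun x => ENNReal.ofReal_le_ofReal (hpt x)).trans ?_
    rw [ENNReal.ofReal_add hΦ0 hT0]
    -- Only here does the signal noise contribute, and here the noisy inverse is at most twice the
    -- true one, so the conditional variance is at most `4 C u²`.
    by_cases hadm : tzOp l A⁻¹ < 2 * (opLevel κ δ l)⁻¹ ∧ tzOp l (ser l b) ≤ noiseOp κ δ l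
    · simp only [if_pos hadm]
      have hI := (noiseBounds_of_lt hκ hδ hδ1 hF hA hf hadm.1).invPerturb (b := b) (by
        have : 0 ≤ noiseOp κ δ l := (tzOp_nonneg _ _).trans hadm.2
        linarith [hadm.2])
      have h2 : l2 l (noisyInv l A δ b) ≤ 2 * l2 l A⁻¹ := hI.l2_inv_le
      have hv : C * l2 l (noisyInv l A δ b) ^ 2 ≤ 4 * (C + 1) * l2 l A⁻¹ ^ 2 := by
        have := pow_le_pow_left₀ (l2_nonneg _ _) h2 2
        rw [mul_pow] at this
        calc _ ≤ C * (2 ^ 2 * l2 l A⁻¹ ^ 2) := mul_le_mul_of_nonneg_left this hC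
          _ ≤ _ := by nlinarith [sq_nonneg (l2 l A⁻¹)]
      have htail := (lintegral_xiErr_tail_le hμ (noisyInv l A δ b) hv (by positivity)
        (x := τsig / (6 * q) * l2 l A⁻¹ * Real.sqrt |Real.log ε|) (by positivity)).trans
        (ENNReal.ofReal_le_ofReal (tail_bound_le hε hε1 hq hC hθ hsig0 hsig hu))
      have hnn : ∀ x, 0 ≤ if τsig / (6 * q) * l2 l A⁻¹ * Real.sqrt |Real.log ε| <
          |xiErr l (noisyInv l A δ b) x| then xiErr l (noisyInv l A δ b) x ^ 2 else 0 := fun x => by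
        split_ifs <;> positivity
      have e : ∀ x, ENNReal.ofReal (Φ + 36 * ε ^ 2 *
          (if τsig / (6 * q) * l2 l A⁻¹ * Real.sqrt |Real.log ε| <
          |xiErr l (noisyInv l A δ b) x| then xiErr l (noisyInv l A δ b) x ^ 2 else 0)) =
          ENNReal.ofReal Φ + ENNReal.ofReal (36 * ε ^ 2) * ENNReal.ofReal
          (if τsig / (6 * q) * l2 l A⁻¹ * Real.sqrt |Real.log ε| <
          |xiErr l (noisyInv l A δ b) x| then xiErr l (noisyInv l A δ b) x ^ 2 else 0) := fun x => by
        rw [ENNReal.ofReal_add hΦ0 (mul_nonneg (by positivity) (hnn x)),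
          ENNReal.ofReal_mul (by positivity)]
      refine (le_of_eq (lintegral_congr e)).trans ?_
      rw [lintegral_add_left measurable_const, lintegral_const, measure_univ, mul_one,
        lintegral_const_mul' _ _ ENNReal.ofReal_ne_top]
      refine add_le_add le_rfl ((mul_le_mul_right htail _).trans ?_)
      rw [← ENNReal.ofReal_mul (by positivity)]
      refine ENNReal.ofReal_le_ofReal (le_of_eq ?_)
      rw [hT]; ring
    · simp only [if_neg hadm, add_zero]
      rw [lintegral_const, measure_univ, mul_one]
      exact le_self_add
  -- A bound for every `b`, however bad; it is integrated only over the exceptional event.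
  have hall : ∀ b, ∫⁻ x, ENNReal.ofReal ((levelEst κ τsig τop ε δ A f l b x - f0) ^ 2) ∂μ ≤
      ENNReal.ofReal (f0 ^ 2 + 2 * ε ^ 2 * (C / δ ^ 2)) +
        ENNReal.ofReal (2 * F ^ 2) * ENNReal.ofReal (tzOp l (ser l b) ^ 2) := fun b => by
    have hpt := fun x => levelEst_sub_sq_le (ε := ε) (τsig := τsig) (τop := τop) (A := A) (b := b)
      (ξ := x) hκ hδ hδ1 hF hf
    refine (lintegral_mono fun x => ENNReal.ofReal_le_ofReal (hpt x)).trans ?_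
    have e1 : ENNReal.ofReal (f0 ^ 2 + 2 * ε ^ 2 * (C / δ ^ 2)) +
        ENNReal.ofReal (2 * F ^ 2) * ENNReal.ofReal (tzOp l (ser l b) ^ 2) =
        ENNReal.ofReal (f0 ^ 2 + 2 * F ^ 2 * tzOp l (ser l b) ^ 2) +
        ENNReal.ofReal (2 * ε ^ 2) * ENNReal.ofReal (C / δ ^ 2) := by
      rw [← ENNReal.ofReal_mul (by positivity), ← ENNReal.ofReal_mul (by positivity),
        ← ENNReal.ofReal_add (by positivity) (by positivity),
        ← ENNReal.ofReal_add (by positivity) (by positivity)]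
      congr 1; ring
    rw [e1]
    by_cases hacc : tzOp l (noisyInv l A δ b) < (opLevel κ δ l)⁻¹
    · simp only [if_pos hacc]
      have e : ∀ x, ENNReal.ofReal (f0 ^ 2 + 2 * F ^ 2 * tzOp l (ser l b) ^ 2 +
          2 * ε ^ 2 * xiErr l (noisyInv l A δ b) x ^ 2) =
          ENNReal.ofReal (f0 ^ 2 + 2 * F ^ 2 * tzOp l (ser l b) ^ 2) +
          ENNReal.ofReal (2 * ε ^ 2) * ENNReal.ofReal (xiErr l (noisyInv l A δ b) x ^ 2) := fun x => by
        rw [ENNReal.ofReal_add (by positivity) (by positivity), ENNReal.ofReal_mul (by positivity)]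
      refine (le_of_eq (lintegral_congr e)).trans ?_
      rw [lintegral_add_left measurable_const, lintegral_const, measure_univ, mul_one,
        lintegral_const_mul' _ _ ENNReal.ofReal_ne_top]
      refine add_le_add le_rfl (mul_le_mul_right
        ((lintegral_xiErr_sq_le hμ _).trans (ENNReal.ofReal_le_ofReal ?_)) _)
      rw [div_eq_mul_inv]
      refine mul_le_mul_of_nonneg_left ?_ hC
      rw [← inv_pow]
      refine pow_le_pow_left₀ (l2_nonneg _ _) ((l2_le_tzOp _ _).trans (hacc.le.trans ?_)) 2
      exact inv_anti₀ hδ hO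
    · simp only [if_neg hacc, add_zero]
      rw [lintegral_const, measure_univ, mul_one]
      exact le_self_add
  have hcomb : ∀ b, ∫⁻ x, ENNReal.ofReal ((levelEst κ τsig τop ε δ A f l b x - f0) ^ 2) ∂μ ≤
      ENNReal.ofReal (Φ + T) + (ENNReal.ofReal (f0 ^ 2 + 2 * ε ^ 2 * (C / δ ^ 2)) *
        B.indicator (fun _ => 1) b + ENNReal.ofReal (2 * F ^ 2) *
        B.indicator (fun b => ENNReal.ofReal (tzOp l (ser l b) ^ 2)) b) := fun b => by
    by_cases hb : b ∈ B
    · rw [Set.indicator_of_mem hb, Set.indicator_of_mem hb, mul_one]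
      exact (hall b).trans le_add_self
    · exact (hgood b hb).trans le_self_add
  refine (lintegral_mono hcomb).trans ?_
  have hmW : Measurable fun b => ENNReal.ofReal (tzOp l (ser l b) ^ 2) :=
    ENNReal.measurable_ofReal.comp (((coeffMeasurable_ser l).tzOp l).pow_const 2)
  rw [lintegral_add_left measurable_const, lintegral_const, measure_univ, mul_one,
    lintegral_add_left ((measurable_const.indicator hB).const_mul _),
    lintegral_const_mul _ (measurable_const.indicator hB), lintegral_indicator_const hB, one_mul,
    lintegral_const_mul _ (hmW.indicator hB)]
  have h5 : gaussVec l B ≤ ENNReal.ofReal π := by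
    rw [← ofReal_measureReal (measure_ne_top _ _)]
    exact ENNReal.ofReal_le_ofReal hπ
  have h6 := lintegral_indicator_tzOp_sq_le hB hπ ht
  calc _ ≤ ENNReal.ofReal (Φ + T) + (ENNReal.ofReal (f0 ^ 2 + 2 * ε ^ 2 * (C / δ ^ 2)) *
        ENNReal.ofReal π + ENNReal.ofReal (2 * F ^ 2) *
        ENNReal.ofReal ((l + 1) ^ 2 * (144 * t + π / (4 * t)))) := by gcongr
    _ = _ := by
      rw [← ENNReal.ofReal_mul (by positivity), ← ENNReal.ofReal_mul (by positivity),
        ← ENNReal.ofReal_add (by positivity) (by positivity),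
        ← ENNReal.ofReal_add (by positivity) (by positivity)]

end LevelIntegral

/-! ### The algorithm in terms of power series. -/

section Link

open PowerSeries

/-- The power series of the operator. -/
noncomputable def opSeries (g : ℝ → ℝ) : ℝ⟦X⟧ := PowerSeries.mk (dotCoeff g)

/-- The power series of the signal. -/
noncomputable def sigSeries (f : ℝ → ℝ) : ℝ⟦X⟧ := PowerSeries.mk (coeff f)

variable {Ω : Type*} {f g : ℝ → ℝ}

lemma coeff_sigSeries (f : ℝ → ℝ) (k : ℕ) : PowerSeries.coeff k (sigSeries f) = coeff f k :=
  PowerSeries.coeff_mk _ _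

lemma galerkin_eq_tz (hg : MemLp g 2 halfLine) (l : ℕ) : galerkin g l = tz l (opSeries g) := by
  rw [galerkin_eq_toeplitz hg]
  ext i j
  simp only [tz, toeplitz, Matrix.of_apply, opSeries, PowerSeries.coeff_mk]

lemma tz_ser (l : ℕ) (c : ℕ → ℝ) : tz l (ser l fun k => c k) = toeplitz c l := by
  ext i j
  simp only [tz, toeplitz, Matrix.of_apply]
  split_ifs with h
  · exact coeff_ser (fun k : Fin (l + 1) => c k) ⟨i - j, by omega⟩
  · rfl

lemma obsOperator_eq_tz (hg : MemLp g 2 halfLine) (δ : ℝ) (b : ℕ → Ω → ℝ) (ω : Ω) (l : ℕ) :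
    obsOperator g δ b ω l = tz l (opSeries g + δ • ser l fun k => b k ω) := by
  rw [obsOperator, galerkin_eq_tz hg, tz_add, tz_smul, tz_ser l fun k => b k ω]

lemma tz_mulVec_last (l : ℕ) (p : ℝ⟦X⟧) (y : Fin (l + 1) → ℝ) :
    (tz l p *ᵥ y) (Fin.last l) = ∑ j : Fin (l + 1), PowerSeries.coeff (l - j) p * y j := by
  simp only [Matrix.mulVec, dotProduct, tz, toeplitz, Matrix.of_apply, Fin.val_last]
  refine Finset.sum_congr rfl fun j _ => ?_
  rw [if_pos (Nat.lt_succ_iff.1 j.2)]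

lemma inv_mulVec_obsSignal_last (hg : MemLp g 2 halfLine) (ε δ : ℝ) (b : ℕ → Ω → ℝ)
    (ξ : (l : ℕ) → Ω → EuclideanSpace ℝ (Fin (l + 1))) (ω : Ω) (l : ℕ) :
    ((obsOperator g δ b ω l)⁻¹ *ᵥ obsSignal g f ε ξ ω l) (Fin.last l) =
      rawEst ε δ (opSeries g) (sigSeries f) l (fun k => b k ω) (ξ l ω) := by
  have hc : coeffVec f l = fun k : Fin (l + 1) => PowerSeries.coeff (k : ℕ) (sigSeries f) := by
    funext k; rw [coeff_sigSeries]; rfl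
  have hy : obsSignal g f ε ξ ω l =
      (tz l (opSeries g) *ᵥ coeffVec f l) + ε • fun i => ξ l ω i := by
    funext i
    simp [obsSignal, galerkin_eq_tz hg]
  rw [obsOperator_eq_tz hg, tz_inv, hy, Matrix.mulVec_add, Matrix.mulVec_smul, Pi.add_apply,
    Pi.smul_apply, hc, Matrix.mulVec_mulVec, ← tz_mul, tz_mulVec, tz_mulVec_last, rawEst, xiErr,
    noisyInv, mul_assoc, smul_eq_mul]
  rfl

/-- Matrix inverses become series inverses. When the operator test fails, the infinite threshold on
one side and the failed conjunction on the other both give `0`. -/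
lemma threshold_zeta_eq (hg : MemLp g 2 halfLine) (κ τsig τop ε δ : ℝ) (b : ℕ → Ω → ℝ)
    (ξ : (l : ℕ) → Ω → EuclideanSpace ℝ (Fin (l + 1))) (ω : Ω) (l : ℕ) :
    (if signalLevel κ τsig τop ε δ (obsOperator g δ b ω) l <
      ((|zeta κ δ (obsOperator g δ b ω) (obsSignal g f ε ξ ω) l| : ℝ) : EReal) then
      zeta κ δ (obsOperator g δ b ω) (obsSignal g f ε ξ ω) l else 0) =
    levelEst κ τsig τop ε δ (opSeries g) (sigSeries f) l (fun k => b k ω) (ξ l ω) := by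
  have hop : opNorm (obsOperator g δ b ω l)⁻¹ =
      tzOp l (noisyInv l (opSeries g) δ fun k => b k ω) := by
    rw [obsOperator_eq_tz hg, tz_inv]; rfl
  have hhs : hsNorm (obsOperator g δ b ω l)⁻¹ =
      tzHS l (noisyInv l (opSeries g) δ fun k => b k ω) := by
    rw [obsOperator_eq_tz hg, tz_inv]; rfl
  rw [levelEst, signalLevel, zeta, hop, hhs, inv_mulVec_obsSignal_last hg]
  by_cases h : tzOp l (noisyInv l (opSeries g) δ fun k => b k ω) < (opLevel κ δ l)⁻¹
  · simp only [h, if_true, true_and, EReal.coe_lt_coe_iff]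
    rfl
  · simp only [h, if_false, false_and, not_top_lt]

lemma estimatorII_eq (hg : MemLp g 2 halfLine) (lam κ τsig τop ε δ : ℝ) (b : ℕ → Ω → ℝ)
    (ξ : (l : ℕ) → Ω → EuclideanSpace ℝ (Fin (l + 1))) (ω : Ω) (x : ℝ) :
    estimatorII lam κ τsig τop ε δ (obsOperator g δ b ω) (obsSignal g f ε ξ ω) x =
      ∑ l ∈ Finset.range (⌊maxLevel lam ε δ⌋₊ + 1),
        levelEst κ τsig τop ε δ (opSeries g) (sigSeries f) l (fun k => b k ω) (ξ l ω) *
          laguerreFun l x :=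
  Finset.sum_congr rfl fun l _ => by rw [threshold_zeta_eq hg]

/-- Parseval's identity for the error of a projection estimator. -/
lemma eLpNorm_sum_sub_sq (hf : MemLp f 2 halfLine) (c : ℕ → ℝ) (N : ℕ) :
    (eLpNorm (fun x => ∑ l ∈ Finset.range N, c l * laguerreFun l x - f x) 2 halfLine).toReal ^ 2 =
      ∑ l ∈ Finset.range N, (c l - coeff f l) ^ 2 + ∑' l, coeff f (l + N) ^ 2 := by
  have hs : MemLp (fun x => ∑ l ∈ Finset.range N, c l * laguerreFun l x) 2 halfLine :=
    memLp_finsetSum _ fun l _ => (memLp_laguerreFun l).const_mul (c l)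
  have hcoef : ∀ k, coeff (fun x => ∑ l ∈ Finset.range N, c l * laguerreFun l x - f x) k =
      (if k < N then c k else 0) - coeff f k := fun k => by
    simp only [coeff, sub_mul, Finset.sum_mul]
    rw [integral_sub (integrable_finsetSum _ fun l _ => ?_) (integrable_mul_laguerreFun hf k),
      integral_finsetSum _ fun l _ => ?_]
    · congr 1
      simp_rw [mul_assoc, integral_const_mul, integral_laguerreFun_mul]
      simp [eq_comm]
    · simp_rw [mul_assoc]; exact (integrable_laguerreFun_mul l k).const_mul _
    · simp_rw [mul_assoc]; exact (integrable_laguerreFun_mul l k).const_mul _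
  have h := hasSum_coeff_sq (hs.sub hf)
  have h' : HasSum (fun k => ((if k < N then c k else 0) - coeff f k) ^ 2)
      ((eLpNorm (fun x => ∑ l ∈ Finset.range N, c l * laguerreFun l x - f x) 2 halfLine).toReal ^ 2) := by
    simp_rw [← hcoef]; exact h
  rw [← h'.tsum_eq, ← h'.summable.sum_add_tsum_nat_add N]
  congr 1
  · exact Finset.sum_congr rfl fun k hk => by rw [if_pos (Finset.mem_range.1 hk)]
  · refine tsum_congr fun k => ?_
    rw [if_neg (by omega), zero_sub, neg_sq]

end Link

/-! ### From the levels to the risk. -/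

section Risk

variable {D : Design} {Ω : Type*} [MeasurableSpace Ω] {P : Measure Ω}
  [IsProbabilityMeasure P] {b : ℕ → Ω → ℝ} {ξ : (l : ℕ) → Ω → EuclideanSpace ℝ (Fin (l + 1))}
  {f g : ℝ → ℝ} {lam κ τsig τop ε δ : ℝ}

/-- The risk is bounded by means of the risks at the levels. -/
lemma riskII_le (hg : MemLp g 2 halfLine) (hf : MemLp f 2 halfLine)
    (N : NoiseModel D ⌊maxLevel lam ε δ⌋₊ P b ξ) (ψ : ℕ → ℝ) (hψ0 : ∀ l, 0 ≤ ψ l)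
    (hψ : ∀ l ≤ ⌊maxLevel lam ε δ⌋₊, ∫⁻ z, ENNReal.ofReal ((levelEst κ τsig τop ε δ (opSeries g)
      (sigSeries f) l z.1 z.2 - coeff f l) ^ 2)
      ∂((gaussVec l).prod (multivariateGaussian 0 (D.Omega l))) ≤ ENNReal.ofReal (ψ l))
    {R : ℝ} (hR : 0 < R) :
    riskII lam κ τsig τop ε δ f g P b ξ ≤
      ENNReal.ofReal (1 / 2 * R + 1 / (2 * R) *
        (∑ l ∈ Finset.range (⌊maxLevel lam ε δ⌋₊ + 1), ψ l +
          ∑' l, coeff f (l + (⌊maxLevel lam ε δ⌋₊ + 1)) ^ 2)) := by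
  set L := ⌊maxLevel lam ε δ⌋₊
  set tl := ∑' l, coeff f (l + (L + 1)) ^ 2 with htl
  have htl0 : 0 ≤ tl := tsum_nonneg fun _ => sq_nonneg _
  set e : ℕ → Ω → ℝ := fun l ω => (levelEst κ τsig τop ε δ (opSeries g) (sigSeries f) l
    (fun k => b k ω) (ξ l ω) - coeff f l) ^ 2 with he
  have hpt : ∀ ω, eLpNorm (fun x => estimatorII lam κ τsig τop ε δ (obsOperator g δ b ω)
      (obsSignal g f ε ξ ω) x - f x) 2 halfLine ≤
      ENNReal.ofReal (1 / 2 * R + 1 / (2 * R) * tl) +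
        ENNReal.ofReal (1 / (2 * R)) * ∑ l ∈ Finset.range (L + 1), ENNReal.ofReal (e l ω) := fun ω => by
    simp_rw [estimatorII_eq hg]
    have hs : MemLp (fun x => ∑ l ∈ Finset.range (L + 1), levelEst κ τsig τop ε δ (opSeries g)
        (sigSeries f) l (fun k => b k ω) (ξ l ω) * laguerreFun l x - f x) 2 halfLine :=
      (memLp_finsetSum _ fun l _ => (memLp_laguerreFun l).const_mul _).sub hf
    have hsq := eLpNorm_sum_sub_sq hf (fun l => levelEst κ τsig τop ε δ (opSeries g)
        (sigSeries f) l (fun k => b k ω) (ξ l ω)) (L + 1)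
    rw [← ENNReal.ofReal_toReal hs.eLpNorm_ne_top]
    set x := (eLpNorm (fun x => ∑ l ∈ Finset.range (L + 1), levelEst κ τsig τop ε δ (opSeries g)
        (sigSeries f) l (fun k => b k ω) (ξ l ω) * laguerreFun l x - f x) 2 halfLine).toReal
    -- The arithmetic-geometric inequality at the target rate `R` replaces Jensen's: the bound is
    -- affine in the squared norm, which is integrated level by level.
    have hx : x ≤ 1 / 2 * R + 1 / (2 * R) * x ^ 2 := by
      have : 1 / 2 * R + 1 / (2 * R) * x ^ 2 - x = (x - R) ^ 2 / (2 * R) := by field_simp; ring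
      have h2 : 0 ≤ (x - R) ^ 2 / (2 * R) := by positivity
      linarith
    rw [hsq] at hx
    rw [← ENNReal.ofReal_sum_of_nonneg fun l _ => sq_nonneg _, ← ENNReal.ofReal_mul (by positivity),
      ← ENNReal.ofReal_add (by positivity)
        (mul_nonneg (by positivity) (Finset.sum_nonneg fun l _ => sq_nonneg _))]
    exact ENNReal.ofReal_le_ofReal (hx.trans (le_of_eq (by ring)))
  have hm : ∀ l, Measurable fun z : (Fin (l + 1) → ℝ) × EuclideanSpace ℝ (Fin (l + 1)) =>
      ENNReal.ofReal ((levelEst κ τsig τop ε δ (opSeries g) (sigSeries f) l z.1 z.2 -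
        coeff f l) ^ 2) := fun l =>
    (((measurable_levelEst κ τsig τop ε δ (opSeries g) (sigSeries f) l).sub_const _).pow_const
      2).ennreal_ofReal
  generalize hH : (fun (l : ℕ) (z : (Fin (l + 1) → ℝ) × EuclideanSpace ℝ (Fin (l + 1))) =>
      ENNReal.ofReal ((levelEst κ τsig τop ε δ (opSeries g) (sigSeries f) l z.1 z.2 -
        coeff f l) ^ 2)) = H
  have hm' : ∀ l, Measurable (H l) := fun l => by rw [← hH]; exact hm l
  have hψ' : ∀ l ≤ L, ∫⁻ z, H l z ∂((gaussVec l).prod (multivariateGaussian 0 (D.Omega l))) ≤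
      ENNReal.ofReal (ψ l) := fun l hl => by rw [← hH]; exact hψ l hl
  have heH : ∀ l ω, ENNReal.ofReal (e l ω) = H l (fun k => b k ω, ξ l ω) := fun l ω => by rw [← hH]
  have hme : ∀ l ∈ Finset.range (L + 1), AEMeasurable (fun ω => H l (fun k => b k ω, ξ l ω)) P :=
    fun l hl => by
    have hlaw := N.hasLaw_pair (Nat.lt_succ_iff.1 (Finset.mem_range.1 hl))
    exact (hm' l).comp_aemeasurable hlaw.aemeasurable
  simp_rw [heH] at hpt
  rw [riskII]
  refine (lintegral_mono hpt).trans ?_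
  rw [lintegral_add_left measurable_const, lintegral_const, measure_univ, mul_one,
    lintegral_const_mul' _ _ ENNReal.ofReal_ne_top, lintegral_finsetSum' _ hme]
  have hsum : ∑ l ∈ Finset.range (L + 1), ∫⁻ ω, H l (fun k => b k ω, ξ l ω) ∂P ≤
      ∑ l ∈ Finset.range (L + 1), ENNReal.ofReal (ψ l) := by
    refine Finset.sum_le_sum fun l hl => ?_
    have hl' := Nat.lt_succ_iff.1 (Finset.mem_range.1 hl)
    have := (N.hasLaw_pair hl').lintegral_comp (hm' l).aemeasurable
    exact this.le.trans (hψ' l hl')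
  refine (add_le_add le_rfl (mul_le_mul_right hsum _)).trans ?_
  rw [← ENNReal.ofReal_sum_of_nonneg fun l _ => hψ0 l, ← ENNReal.ofReal_mul (by positivity),
    ← ENNReal.ofReal_add (by positivity)
      (mul_nonneg (by positivity) (Finset.sum_nonneg fun l _ => hψ0 l))]
  exact ENNReal.ofReal_le_ofReal (le_of_eq (by ring))

end Risk

/-! ### Consequences of membership in the two classes. -/

section Classes

open PowerSeries

variable {ν Q₁ Q₂ : ℝ} {g : ℝ → ℝ}

lemma constantCoeff_opSeries_ne (hg : g ∈ illPosedClass ν Q₁ Q₂) :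
    constantCoeff (opSeries g) ≠ 0 := by
  rw [← PowerSeries.coeff_zero_eq_constantCoeff_apply, opSeries, PowerSeries.coeff_mk]
  exact hg.2.1

lemma l2_inv_sq_le (hg : g ∈ illPosedClass ν Q₁ Q₂) (l : ℕ) :
    l2 l (opSeries g)⁻¹ ^ 2 ≤ Q₂ * (max (l : ℝ) 1) ^ (2 * ν - 1) := by
  rw [l2_sq]; exact (hg.2.2 l).1

lemma le_tzHS_inv_sq (hg : g ∈ illPosedClass ν Q₁ Q₂) (l : ℕ) :
    Q₁ * (max (l : ℝ) 1) ^ (2 * ν) ≤ tzHS l (opSeries g)⁻¹ ^ 2 := by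
  rw [tzHS_sq]; exact (hg.2.2 l).2

lemma tzHS_sq_le (l : ℕ) (p : ℝ⟦X⟧) : tzHS l p ^ 2 ≤ (l + 1) * l2 l p ^ 2 := by
  rw [tzHS_sq, l2_sq]
  calc _ ≤ ∑ k ∈ Finset.range (l + 1), ∑ n ∈ Finset.range (l + 1), PowerSeries.coeff n p ^ 2 :=
        Finset.sum_le_sum fun k hk => Finset.sum_le_sum_of_subset_of_nonneg
          (Finset.range_subset_range.2 (by have := Finset.mem_range.1 hk; omega))
          fun _ _ _ => sq_nonneg _
    _ = _ := by rw [Finset.sum_const, Finset.card_range, nsmul_eq_mul]; push_cast; rfl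

lemma tzHS_inv_sq_le (hg : g ∈ illPosedClass ν Q₁ Q₂) (l : ℕ) :
    tzHS l (opSeries g)⁻¹ ^ 2 ≤ 2 * Q₂ * (max (l : ℝ) 1) ^ (2 * ν) := by
  have hl : (0 : ℝ) < max (l : ℝ) 1 := lt_max_of_lt_right one_pos
  have h1 := l2_inv_sq_le hg l
  have h2 := add_one_le_two_mul_max l
  calc _ ≤ ((l : ℝ) + 1) * l2 l (opSeries g)⁻¹ ^ 2 := tzHS_sq_le _ _
    _ ≤ 2 * max (l : ℝ) 1 * (Q₂ * (max (l : ℝ) 1) ^ (2 * ν - 1)) :=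
        mul_le_mul h2 h1 (sq_nonneg _) (by positivity)
    _ = 2 * Q₂ * ((max (l : ℝ) 1) ^ (2 * ν - 1) * max (l : ℝ) 1) := by ring
    _ = _ := by rw [← Real.rpow_add_one hl.ne']; congr 2; ring

lemma sq_mul_rpow_neg_half (x : ℝ) {y : ℝ} (hy : 0 < y) :
    (x * y ^ (-(1 / 2) : ℝ)) ^ 2 = x ^ 2 * y⁻¹ := by
  rw [mul_pow, ← Real.rpow_natCast (y ^ (-(1 / 2) : ℝ)), ← Real.rpow_mul hy.le,
    ← Real.rpow_neg_one]
  norm_num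

lemma rpow_mul_inv {y : ℝ} (hy : 0 < y) (ν : ℝ) : y ^ (2 * ν) * y⁻¹ = y ^ (2 * ν - 1) := by
  rw [Real.rpow_sub hy, Real.rpow_one, div_eq_mul_inv]

lemma normalized_tzHS_sq_le (hg : g ∈ illPosedClass ν Q₁ Q₂) (l : ℕ) :
    (tzHS l (opSeries g)⁻¹ * (max (l : ℝ) 1) ^ (-(1 / 2) : ℝ)) ^ 2 ≤
      2 * Q₂ * (max (l : ℝ) 1) ^ (2 * ν - 1) := by
  have hl : (0 : ℝ) < max (l : ℝ) 1 := lt_max_of_lt_right one_pos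
  rw [sq_mul_rpow_neg_half _ hl, ← rpow_mul_inv hl, ← mul_assoc]
  exact mul_le_mul_of_nonneg_right (tzHS_inv_sq_le hg l) (inv_nonneg.2 hl.le)

/-- The lower bound of the class says that the coefficients of the inverse, averaged over rows, are
as large as the upper bound allows, up to `Q₂ / Q₁`. So the observable Hilbert-Schmidt norm can
calibrate the threshold. -/
lemma l2_inv_le_normalized_tzHS (hQ₁ : 0 < Q₁) (hQ₂ : 0 < Q₂) (hg : g ∈ illPosedClass ν Q₁ Q₂)
    (l : ℕ) : l2 l (opSeries g)⁻¹ ≤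
      Real.sqrt (Q₂ / Q₁) * (tzHS l (opSeries g)⁻¹ * (max (l : ℝ) 1) ^ (-(1 / 2) : ℝ)) := by
  have hl : (0 : ℝ) < max (l : ℝ) 1 := lt_max_of_lt_right one_pos
  refine abs_le_of_sq_le_sq' ?_ (mul_nonneg (Real.sqrt_nonneg _)
    (mul_nonneg (tzHS_nonneg _ _) (Real.rpow_nonneg hl.le _))) |>.2
  rw [mul_pow, Real.sq_sqrt (by positivity), sq_mul_rpow_neg_half _ hl]
  have h := mul_le_mul_of_nonneg_right (le_tzHS_inv_sq hg l) (inv_nonneg.2 hl.le)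
  rw [mul_assoc, rpow_mul_inv hl] at h
  calc _ ≤ Q₂ * (max (l : ℝ) 1) ^ (2 * ν - 1) := l2_inv_sq_le hg l
    _ = Q₂ / Q₁ * (Q₁ * (max (l : ℝ) 1) ^ (2 * ν - 1)) := by field_simp
    _ ≤ _ := by gcongr

lemma tzOp_inv_le_rpow (hQ₂ : 0 < Q₂) (hg : g ∈ illPosedClass ν Q₁ Q₂) (l : ℕ) :
    tzOp l (opSeries g)⁻¹ ≤ Real.sqrt (2 * Q₂) * (max (l : ℝ) 1) ^ ν := by
  have hl : (0 : ℝ) < max (l : ℝ) 1 := lt_max_of_lt_right one_pos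
  refine (tzOp_le_tzHS _ _).trans (abs_le_of_sq_le_sq' ?_ (by positivity) |>.2)
  rw [mul_pow, Real.sq_sqrt (by positivity), ← Real.rpow_natCast (_ ^ ν), ← Real.rpow_mul hl.le]
  refine (tzHS_inv_sq_le hg l).trans (le_of_eq ?_)
  congr 2; push_cast; ring

/-- The degree of ill-posedness of a kernel is at least `1 / 2`. -/
lemma half_le_of_mem (hg : g ∈ illPosedClass ν Q₁ Q₂) : 1 / 2 ≤ ν := by
  by_contra hν
  -- This nonzero coefficient bounds every truncated norm from below, while for `ν < 1/2` the upper
  -- bound of the class would tend to zero.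
  have h0 : PowerSeries.coeff 0 (opSeries g)⁻¹ ≠ 0 := by
    rw [PowerSeries.coeff_zero_eq_constantCoeff_apply, PowerSeries.constantCoeff_inv]
    exact inv_ne_zero (constantCoeff_opSeries_ne hg)
  have hc : 0 < PowerSeries.coeff 0 (opSeries g)⁻¹ ^ 2 := by positivity
  have hle : ∀ l : ℕ, PowerSeries.coeff 0 (opSeries g)⁻¹ ^ 2 ≤ Q₂ * (max (l : ℝ) 1) ^ (2 * ν - 1) :=
    fun l => by
    refine le_trans ?_ (l2_inv_sq_le hg l)
    rw [← sq_abs]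
    exact pow_le_pow_left₀ (abs_nonneg _) (abs_coeff_le_l2 l _ (Nat.zero_le _)) 2
  have hlim : Filter.Tendsto (fun l : ℕ => Q₂ * (max (l : ℝ) 1) ^ (2 * ν - 1)) Filter.atTop
      (nhds (Q₂ * 0)) := by
    refine Filter.Tendsto.const_mul _ ?_
    have h1 := tendsto_rpow_neg_atTop (y := 1 - 2 * ν) (by linarith)
    rw [show -(1 - 2 * ν) = 2 * ν - 1 by ring] at h1
    exact h1.comp (Filter.tendsto_atTop_mono (fun l => le_max_left _ _) tendsto_natCast_atTop_atTop)
  rw [mul_zero] at hlim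
  exact absurd (ge_of_tendsto' hlim hle) (not_le.2 hc)

variable {s M : ℝ} {f : ℝ → ℝ}

lemma coeff_sq_le_rpow {X : ℝ} (hX : 0 < X) (hs : 0 < s) {l : ℕ} (hl : X ≤ (l : ℝ) + 1 / 2) :
    coeff f l ^ 2 ≤ X ^ (-(2 * s)) * (((l : ℝ) + 1 / 2) ^ s * coeff f l) ^ 2 := by
  have h1 : X ^ (2 * s) ≤ (((l : ℝ) + 1 / 2) ^ s) ^ 2 := by
    rw [← Real.rpow_natCast (_ ^ s), ← Real.rpow_mul (by positivity)]
    refine (Real.rpow_le_rpow hX.le hl (by linarith)).trans (le_of_eq ?_)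
    congr 1; push_cast; ring
  rw [Real.rpow_neg hX.le, mul_pow, inv_mul_eq_div, le_div_iff₀ (by positivity), mul_comm]
  exact mul_le_mul_of_nonneg_right h1 (sq_nonneg _)

/-- The constant in the embedding of the Sobolev ball into `ℓ¹`. -/
noncomputable def ellOneConst (s : ℝ) : ℝ :=
  Real.sqrt (∑' k : ℕ, (((k : ℝ) + 1 / 2) ^ (-s)) ^ 2)

lemma summable_rpow_neg_sq (hs : 1 / 2 < s) : Summable fun k : ℕ => (((k : ℝ) + 1 / 2) ^ (-s)) ^ 2 := by
  have h := (Real.summable_one_div_nat_add_rpow (1 / 2) (2 * s)).2 (by linarith)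
  refine h.congr fun k => ?_
  have hk : (0 : ℝ) < (k : ℝ) + 1 / 2 := by positivity
  rw [abs_of_pos hk, ← Real.rpow_natCast (_ ^ (-s)), ← Real.rpow_mul hk.le, one_div,
    ← Real.rpow_neg hk.le]
  congr 1; push_cast; ring

/-- Cauchy-Schwarz against the weights, whose inverses are square summable because `2 s > 1`. -/
lemma sum_abs_coeff_le (hs : 1 / 2 < s) (hM : 0 ≤ M) (hf : f ∈ sobolevBall s M) (n : ℕ) :
    ∑ k ∈ Finset.range n, |coeff f k| ≤ M * ellOneConst s := by
  have hZ := summable_rpow_neg_sq hs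
  refine abs_le_of_sq_le_sq' ?_ (mul_nonneg hM (Real.sqrt_nonneg _)) |>.2
  rw [mul_pow, Real.sq_sqrt (tsum_nonneg fun _ => sq_nonneg _)]
  have e : ∀ k : ℕ, |coeff f k| = |((k : ℝ) + 1 / 2) ^ s * coeff f k| * ((k : ℝ) + 1 / 2) ^ (-s) := by
    intro k
    have hk : (0 : ℝ) < (k : ℝ) + 1 / 2 := by positivity
    rw [abs_mul, abs_of_pos (Real.rpow_pos_of_pos hk s), Real.rpow_neg hk.le]
    field_simp
  simp_rw [e]
  refine (Finset.sum_mul_sq_le_sq_mul_sq _ _ _).trans ?_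
  simp_rw [sq_abs]
  refine mul_le_mul ?_ (hZ.sum_le_tsum _ fun _ _ => sq_nonneg _)
    (Finset.sum_nonneg fun _ _ => sq_nonneg _) (sq_nonneg _)
  exact (hf.2.1.sum_le_tsum _ fun _ _ => sq_nonneg _).trans hf.2.2

lemma sum_weighted_le (hf : f ∈ sobolevBall s M) (n : ℕ) :
    ∑ k ∈ Finset.range n, (((k : ℝ) + 1 / 2) ^ s * coeff f k) ^ 2 ≤ M ^ 2 :=
  (hf.2.1.sum_le_tsum _ fun _ _ => sq_nonneg _).trans hf.2.2

lemma tsum_coeff_sq_tail_le (hs : 0 < s) (hf : f ∈ sobolevBall s M) {X : ℝ} (hX : 0 < X) {N : ℕ}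
    (hN : X ≤ N) : ∑' l, coeff f (l + N) ^ 2 ≤ X ^ (-(2 * s)) * M ^ 2 := by
  set w : ℕ → ℝ := fun l => (((l : ℝ) + 1 / 2) ^ s * coeff f l) ^ 2 with hw
  have hws : Summable fun l => w (l + N) := (summable_nat_add_iff N).2 hf.2.1
  have hpt : ∀ l, coeff f (l + N) ^ 2 ≤ X ^ (-(2 * s)) * w (l + N) := fun l =>
    coeff_sq_le_rpow hX hs (by push_cast; linarith [l.cast_nonneg (α := ℝ)])
  have hsum : Summable fun l => coeff f (l + N) ^ 2 :=
    Summable.of_nonneg_of_le (fun _ => sq_nonneg _) hpt (hws.mul_left _)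
  have h1 : ∑' l, w (l + N) ≤ M ^ 2 := by
    refine le_trans ?_ hf.2.2
    rw [← hf.2.1.sum_add_tsum_nat_add N]
    exact le_add_of_nonneg_left (Finset.sum_nonneg fun _ _ => sq_nonneg _)
  calc _ ≤ ∑' l, X ^ (-(2 * s)) * w (l + N) := hsum.tsum_le_tsum hpt (hws.mul_left _)
    _ = X ^ (-(2 * s)) * ∑' l, w (l + N) := tsum_mul_left
    _ ≤ _ := mul_le_mul_of_nonneg_left h1 (Real.rpow_nonneg hX.le _)

end Classes

/-! ### The total noise level and acceptance at low levels. -/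

section Rates

/-- The noise level `ε √|log ε| ∨ δ |log δ|`. -/
noncomputable def totalNoise (ε δ : ℝ) : ℝ :=
  max (ε * Real.sqrt |Real.log ε|) (δ * |Real.log δ|)

variable {ε δ s ν : ℝ}

lemma mul_abs_log_le {x : ℝ} (hx : 0 < x) (hx1 : x ≤ 1) : x * |Real.log x| ≤ 2 * Real.sqrt x := by
  have h := Real.abs_log_mul_self_rpow_lt x (1 / 2) hx hx1 (by norm_num)
  rw [← Real.sqrt_eq_rpow, abs_mul, abs_of_nonneg (Real.sqrt_nonneg x)] at h
  have h2 := Real.mul_self_sqrt hx.le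
  have h3 := Real.sqrt_nonneg x
  calc x * |Real.log x| = Real.sqrt x * (|Real.log x| * Real.sqrt x) := by
        nth_rewrite 1 [← h2]; ring
    _ ≤ Real.sqrt x * 2 := by gcongr; norm_num at h; exact h.le
    _ = _ := mul_comm _ _

lemma totalNoise_le {y : ℝ} (hε : 0 < ε) (hδ : 0 < δ) (hε1 : ε ≤ Real.exp (-1))
    (hδ1 : δ ≤ Real.exp (-1)) (hy : 0 ≤ y) (hεy : ε ≤ (y / 2) ^ 2) (hδy : δ ≤ (y / 2) ^ 2) :
    totalNoise ε δ ≤ y := by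
  have he : Real.exp (-1) ≤ 1 := Real.exp_le_one_iff.2 (by norm_num)
  have key : ∀ x : ℝ, 0 < x → x ≤ Real.exp (-1) → x ≤ (y / 2) ^ 2 → x * |Real.log x| ≤ y := by
    intro x hx hx1 hxy
    have h1 := mul_abs_log_le hx (hx1.trans he)
    have h2 : Real.sqrt x ≤ y / 2 := Real.sqrt_le_iff.2 ⟨by positivity, hxy⟩
    linarith
  refine max_le ?_ (key δ hδ hδ1 hδy)
  refine le_trans ?_ (key ε hε hε1 hεy)
  have h1 := one_le_abs_log hε hε1
  refine mul_le_mul_of_nonneg_left ?_ hε.le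
  exact Real.sqrt_le_iff.2 ⟨by positivity, by nlinarith⟩

lemma le_totalNoise_left (hε : 0 < ε) (hε1 : ε ≤ Real.exp (-1)) : ε ≤ totalNoise ε δ :=
  le_max_of_le_left (le_mul_of_one_le_right hε.le (Real.one_le_sqrt.2 (one_le_abs_log hε hε1)))

lemma le_totalNoise_right (hδ : 0 < δ) (hδ1 : δ ≤ Real.exp (-1)) : δ ≤ totalNoise ε δ :=
  le_max_of_le_right (le_mul_of_one_le_right hδ.le (one_le_abs_log hδ hδ1))

/-- At low levels, the operator is accepted. -/
lemma two_mul_tzOp_lt {Q₁ Q₂ κ : ℝ} {g : ℝ → ℝ} (hQ₂ : 0 < Q₂) (hg : g ∈ illPosedClass ν Q₁ Q₂)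
    (hs : 1 / 2 < s) (hκ : 512 ≤ κ) (hδ : 0 < δ) (hδ1 : δ ≤ Real.exp (-1)) {l : ℕ}
    (hr1 : totalNoise ε δ ≤ 1)
    (hl : max (l : ℝ) 1 ≤ totalNoise ε δ ^ (-(1 / (s + ν))))
    (hr : 4 * κ * Real.sqrt (2 * Q₂) * totalNoise ε δ ^ ((s - 1 / 2) / (s + ν)) < 1) :
    2 * tzOp l (opSeries g)⁻¹ < (opLevel κ δ l)⁻¹ := by
  have hν := half_le_of_mem hg
  have hsν : 0 < s + ν := by linarith
  have hO0 : 0 < opLevel κ δ l := hδ.trans_le (le_opLevel hκ hδ hδ1)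
  have hδr : δ ≤ totalNoise ε δ := le_totalNoise_right hδ hδ1
  have hδr' : δ * |Real.log δ| ≤ totalNoise ε δ := le_max_right _ _
  set r := totalNoise ε δ
  have hr0 : 0 < r := hδ.trans_le hδr
  have hL := one_le_abs_log hδ hδ1
  set Λ := |Real.log δ| with hΛ
  have hΛ' : Λ = -Real.log δ := abs_of_nonpos (Real.log_nonpos hδ.le
    (hδ1.trans (Real.exp_le_one_iff.2 (by norm_num))))
  set y := max (l : ℝ) 1 with hy
  have hy1 : 1 ≤ y := le_max_right _ _
  have hlog : Real.log (max (l : ℝ) 2) ≤ 2 * Λ := by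
    have h1 : max (l : ℝ) 2 ≤ 2 * y := max_le (by linarith [le_max_left (l : ℝ) 1]) (by linarith)
    have h2 : Real.log (max (l : ℝ) 2) ≤ Real.log (2 * y) := Real.log_le_log (by positivity) h1
    rw [Real.log_mul two_ne_zero (by positivity)] at h2
    -- The level is at most `r ^ (-1/(s+ν))`, with `r ≥ δ` and `s + ν ≥ 1` since `ν ≥ 1/2`; hence
    -- the logarithm of the level costs no more than `|log δ|`.
    have h3 : Real.log y ≤ Λ := by
      have h4 := Real.log_le_log (by positivity) hl
      rw [Real.log_rpow hr0] at h4
      have h5 : -Real.log r ≤ Λ := by rw [hΛ']; exact neg_le_neg (Real.log_le_log hδ hδr)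
      have h6 : 1 / (s + ν) ≤ 1 := by rw [div_le_one hsν]; linarith
      have h7 : 0 ≤ 1 / (s + ν) := by positivity
      have h8 : 0 ≤ -Real.log r := by linarith [Real.log_nonpos hr0.le hr1]
      nlinarith
    have := Real.log_two_lt_d9
    linarith
  have hO : opLevel κ δ l ≤ 2 * κ * Real.sqrt y * r := by
    rw [opLevel]
    have h1 : Real.sqrt (y * Real.log (max (l : ℝ) 2)) ≤ 2 * Real.sqrt y * Real.sqrt Λ := by
      refine Real.sqrt_le_iff.2 ⟨by positivity, ?_⟩
      rw [mul_pow, mul_pow, Real.sq_sqrt (by positivity), Real.sq_sqrt (by positivity)]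
      nlinarith [mul_le_mul_of_nonneg_left hlog (zero_le_one.trans hy1)]
    calc _ ≤ κ * (2 * Real.sqrt y * Real.sqrt Λ) * δ * Real.sqrt Λ := by gcongr
      _ = 2 * κ * Real.sqrt y * (δ * Real.sqrt Λ ^ 2) := by ring
      _ = 2 * κ * Real.sqrt y * (δ * Λ) := by rw [Real.sq_sqrt (by positivity)]
      _ ≤ _ := by gcongr
  have hN := tzOp_inv_le_rpow hQ₂ hg l
  -- The exponent is `1 - (ν + 1/2)/(s + ν)`, positive exactly when `s > 1/2`.
  have hyr : Real.sqrt y * y ^ ν * r ≤ r ^ ((s - 1 / 2) / (s + ν)) := by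
    rw [Real.sqrt_eq_rpow, ← Real.rpow_add (by positivity)]
    calc y ^ (1 / 2 + ν) * r ≤ (r ^ (-(1 / (s + ν)))) ^ (1 / 2 + ν) * r ^ (1 : ℝ) := by
          rw [Real.rpow_one]
          gcongr
      _ = _ := by
          rw [← Real.rpow_mul hr0.le, ← Real.rpow_add hr0]
          congr 1; field_simp; ring
  rw [← one_div, lt_div_iff₀ hO0]
  calc _ ≤ 2 * (Real.sqrt (2 * Q₂) * y ^ ν) * (2 * κ * Real.sqrt y * r) := by gcongr
    _ = 4 * κ * Real.sqrt (2 * Q₂) * (Real.sqrt y * y ^ ν * r) := by ring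
    _ ≤ 4 * κ * Real.sqrt (2 * Q₂) * r ^ ((s - 1 / 2) / (s + ν)) := by gcongr
    _ < 1 := hr

end Rates

/-! ### Summation over the levels. -/

section Sums

variable {s ν M Q₁ Q₂ lam κ τsig τop ε δ F C K : ℝ} {f g : ℝ → ℝ}

/-- The bound for the risk at the level `l`. -/
noncomputable def levelBound (κ τsig τop ε δ F ν C K : ℝ) (g f : ℝ → ℝ) (l : ℕ) : ℝ :=
  mainTerm κ τsig τop ε δ l (opSeries g) (sigSeries f) +
    1152 * (C + 1) * l2 l (opSeries g)⁻¹ ^ 2 * ε ^ 2 * ε ^ (2 * ν + 1) +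
    ((coeff f l ^ 2 + 2 * ε ^ 2 * (C / δ ^ 2)) * ((25 + 2 * K) * δ ^ 10) +
    2 * F ^ 2 * ((l + 1) ^ 2 * (144 * δ ^ 5 + (25 + 2 * K) * δ ^ 10 / (4 * δ ^ 5))))

lemma levelBound_nonneg (hε : 0 < ε) (hδ : 0 < δ) (hC : 0 ≤ C) (hK : 0 ≤ K) (l : ℕ) :
    0 ≤ levelBound κ τsig τop ε δ F ν C K g f l := by
  have := mainTerm_nonneg κ τsig τop ε δ l (opSeries g) (sigSeries f)
  unfold levelBound
  positivity

/-- The number of levels at which the noise dominates. -/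
noncomputable def cutoff (s ν r : ℝ) : ℕ := ⌊r ^ (-(1 / (s + ν)))⌋₊

/-- Up to the cutoff the level is accepted and the squared threshold is used, with its growth `l ^
(2ν-1)` bounded by its value at `r ^ (-1/(s+ν))`. Beyond it the squared coefficient is used, and the
Sobolev weight gives the squared rate. -/
lemma mainTerm_le (hs : 1 / 2 < s) (hQ₂ : 0 < Q₂) (hg : g ∈ illPosedClass ν Q₁ Q₂)
    (hκ : 512 ≤ κ) (hδ : 0 < δ) (hδ1 : δ ≤ Real.exp (-1)) (hr1 : totalNoise ε δ ≤ 1)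
    (hr : 4 * κ * Real.sqrt (2 * Q₂) * totalNoise ε δ ^ ((s - 1 / 2) / (s + ν)) < 1) (l : ℕ) :
    mainTerm κ τsig τop ε δ l (opSeries g) (sigSeries f) ≤
      (if l ∈ Finset.range (cutoff s ν (totalNoise ε δ) + 1) then 18 * Q₂ * max τsig τop ^ 2 *
        ((totalNoise ε δ ^ (-(1 / (s + ν)))) ^ (2 * ν - 1) * totalNoise ε δ ^ 2) else 0) +
      (totalNoise ε δ ^ (s / (s + ν))) ^ 2 * (((l : ℝ) + 1 / 2) ^ s * coeff f l) ^ 2 := by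
  have hν := half_le_of_mem hg
  have hsν : 0 < s + ν := by linarith
  have hδr : δ ≤ totalNoise ε δ := le_totalNoise_right hδ hδ1
  have hr0 : 0 < totalNoise ε δ := hδ.trans_le hδr
  have hRm1 : 1 ≤ totalNoise ε δ ^ (-(1 / (s + ν))) :=
    Real.one_le_rpow_of_pos_of_le_one_of_nonpos hr0 hr1 (by rw [neg_nonpos]; positivity)
  have hw : 0 ≤ (totalNoise ε δ ^ (s / (s + ν))) ^ 2 * (((l : ℝ) + 1 / 2) ^ s * coeff f l) ^ 2 := by
    positivity
  split_ifs with hl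
  · have hl' : (l : ℝ) ≤ totalNoise ε δ ^ (-(1 / (s + ν))) := by
      have h1 : l ≤ cutoff s ν (totalNoise ε δ) := Nat.lt_succ_iff.1 (Finset.mem_range.1 hl)
      exact (Nat.cast_le.2 h1).trans (Nat.floor_le (by positivity))
    have hy := max_le hl' hRm1
    rw [mainTerm, if_pos (two_mul_tzOp_lt hQ₂ hg hs hκ hδ hδ1 hr1 hy hr)]
    refine (min_le_right _ _).trans (le_add_of_le_of_nonneg ?_ hw)
    have h2 := normalized_tzHS_sq_le hg l
    have h3 : (max (l : ℝ) 1) ^ (2 * ν - 1) ≤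
        (totalNoise ε δ ^ (-(1 / (s + ν)))) ^ (2 * ν - 1) :=
      Real.rpow_le_rpow (by positivity) hy (by linarith)
    calc 9 * (tzHS l (opSeries g)⁻¹ * (max (l : ℝ) 1) ^ (-(1 / 2) : ℝ) *
          (max τsig τop * totalNoise ε δ)) ^ 2
        = 9 * (max τsig τop * totalNoise ε δ) ^ 2 *
          (tzHS l (opSeries g)⁻¹ * (max (l : ℝ) 1) ^ (-(1 / 2) : ℝ)) ^ 2 := by ring
      _ ≤ 9 * (max τsig τop * totalNoise ε δ) ^ 2 *
          (2 * Q₂ * (totalNoise ε δ ^ (-(1 / (s + ν)))) ^ (2 * ν - 1)) :=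
          mul_le_mul_of_nonneg_left (h2.trans (mul_le_mul_of_nonneg_left h3 (by positivity)))
            (by positivity)
      _ = _ := by ring
  · have hm : mainTerm κ τsig τop ε δ l (opSeries g) (sigSeries f) ≤ coeff f l ^ 2 := by
      rw [mainTerm, coeff_sigSeries]
      split_ifs
      · exact min_le_left _ _
      · exact le_rfl
    rw [zero_add]
    have hl' : totalNoise ε δ ^ (-(1 / (s + ν))) ≤ l := by
      have h1 : cutoff s ν (totalNoise ε δ) + 1 ≤ l := by
        by_contra h; exact hl (Finset.mem_range.2 (not_le.1 h))
      refine (Nat.lt_floor_add_one _).le.trans ?_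
      exact_mod_cast h1
    refine hm.trans ((coeff_sq_le_rpow (zero_lt_one.trans_le hRm1) (show 0 < s by linarith)
      (hl'.trans (by linarith : (l : ℝ) ≤ (l : ℝ) + 1 / 2))).trans (le_of_eq ?_))
    congr 1
    rw [← Real.rpow_mul hr0.le, ← Real.rpow_natCast (_ ^ (s / (s + ν))), ← Real.rpow_mul hr0.le]
    congr 1; push_cast; field_simp

/-- The residual terms are `r²` times `ε` or `δ`, so that summing over at most a multiple of `1 / r`
levels leaves `r²`. The constant `C` is replaced by `κ`, which makes the final constant independent
of the design. -/
lemma levelBound_le (hs : 1 / 2 < s) (hQ₂ : 0 < Q₂) (hg : g ∈ illPosedClass ν Q₁ Q₂)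
    (hκ : 512 ≤ κ) (hε : 0 < ε) (hε1 : ε ≤ Real.exp (-1)) (hδ : 0 < δ) (hδ1 : δ ≤ Real.exp (-1))
    (hr1 : totalNoise ε δ ≤ 1)
    (hr : 4 * κ * Real.sqrt (2 * Q₂) * totalNoise ε δ ^ ((s - 1 / 2) / (s + ν)) < 1)
    (hC : 0 ≤ C) (hCκ : C ≤ κ) (hK : 0 < K) {l : ℕ} (hlε : ((l : ℝ) + 1) * ε ≤ K)
    (hlδ : ((l : ℝ) + 1) * δ ≤ K) :
    levelBound κ τsig τop ε δ F ν C K g f l ≤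
      (if l ∈ Finset.range (cutoff s ν (totalNoise ε δ) + 1) then 18 * Q₂ * max τsig τop ^ 2 *
        ((totalNoise ε δ ^ (-(1 / (s + ν)))) ^ (2 * ν - 1) * totalNoise ε δ ^ 2) else 0) +
      ((totalNoise ε δ ^ (s / (s + ν))) ^ 2 + (1 / 2) ^ (-(2 * s)) * (25 + 2 * K) *
        totalNoise ε δ ^ 2) * (((l : ℝ) + 1 / 2) ^ s * coeff f l) ^ 2 +
      totalNoise ε δ ^ 2 * (1152 * (κ + 1) * Q₂ * K ^ (2 * ν - 1) * ε +
        (2 * κ * (25 + 2 * K) + 2 * F ^ 2 * K ^ 2 * (144 + (25 + 2 * K) / 4)) * δ) := by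
  have hν := half_le_of_mem hg
  have he : Real.exp (-1) ≤ 1 := Real.exp_le_one_iff.2 (by norm_num)
  have hε2 : ε ≤ 1 := hε1.trans he
  have hδ2 : δ ≤ 1 := hδ1.trans he
  have hεr : ε ^ 2 ≤ totalNoise ε δ ^ 2 := pow_le_pow_left₀ hε.le (le_totalNoise_left hε hε1) 2
  have hδr : δ ^ 2 ≤ totalNoise ε δ ^ 2 := pow_le_pow_left₀ hδ.le (le_totalNoise_right hδ hδ1) 2
  have hmain := mainTerm_le (f := f) (τsig := τsig) (τop := τop) hs hQ₂ hg hκ hδ hδ1 hr1 hr l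
  set r := totalNoise ε δ
  set w := (((l : ℝ) + 1 / 2) ^ s * coeff f l) ^ 2 with hw
  have hw0 : 0 ≤ w := sq_nonneg _
  have hxi : 1152 * (C + 1) * l2 l (opSeries g)⁻¹ ^ 2 * ε ^ 2 * ε ^ (2 * ν + 1) ≤
      r ^ 2 * (1152 * (κ + 1) * Q₂ * K ^ (2 * ν - 1) * ε) := by
    have h1 : (max (l : ℝ) 1) * ε ≤ K := by
      refine le_trans (mul_le_mul_of_nonneg_right ?_ hε.le) hlε
      exact max_le (by linarith) (by linarith [l.cast_nonneg (α := ℝ)])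
    have h2 : (max (l : ℝ) 1) ^ (2 * ν - 1) * ε ^ (2 * ν - 1) ≤ K ^ (2 * ν - 1) := by
      rw [← Real.mul_rpow (by positivity) hε.le]
      exact Real.rpow_le_rpow (by positivity) h1 (by linarith)
    -- The first factor offsets the growth of the inverse over levels at most `K / ε`; the second
    -- pays for the summation over levels.
    have h3 : ε ^ (2 * ν + 1) = ε ^ (2 * ν - 1) * ε ^ 2 := by
      rw [← Real.rpow_natCast ε 2, ← Real.rpow_add hε]; congr 1; push_cast; ring
    calc _ ≤ 1152 * (κ + 1) * (Q₂ * (max (l : ℝ) 1) ^ (2 * ν - 1)) * ε ^ 2 * ε ^ (2 * ν + 1) := by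
          gcongr; exact l2_inv_sq_le hg l
      _ = 1152 * (κ + 1) * Q₂ * ((max (l : ℝ) 1) ^ (2 * ν - 1) * ε ^ (2 * ν - 1)) * ε ^ 2 * ε ^ 2 := by
          rw [h3]; ring
      _ ≤ 1152 * (κ + 1) * Q₂ * K ^ (2 * ν - 1) * r ^ 2 * ε := by
          have : ε ^ 2 ≤ ε := by nlinarith
          gcongr
      _ = _ := by ring
  have hfl : coeff f l ^ 2 * ((25 + 2 * K) * δ ^ 10) ≤
      (1 / 2) ^ (-(2 * s)) * (25 + 2 * K) * r ^ 2 * w := by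
    have h1 : coeff f l ^ 2 ≤ (1 / 2) ^ (-(2 * s)) * w :=
      coeff_sq_le_rpow (by norm_num) (by linarith) (by linarith [l.cast_nonneg (α := ℝ)])
    have h2 : δ ^ 10 ≤ r ^ 2 := (pow_le_pow_of_le_one hδ.le hδ2 (by norm_num)).trans hδr
    calc _ ≤ (1 / 2) ^ (-(2 * s)) * w * ((25 + 2 * K) * r ^ 2) := by gcongr
      _ = _ := by ring
  have hbad : 2 * ε ^ 2 * (C / δ ^ 2) * ((25 + 2 * K) * δ ^ 10) ≤
      r ^ 2 * (2 * κ * (25 + 2 * K) * δ) := by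
    have e : 2 * ε ^ 2 * (C / δ ^ 2) * ((25 + 2 * K) * δ ^ 10) =
        2 * ε ^ 2 * C * (25 + 2 * K) * δ ^ 8 := by field_simp
    have h1 : δ ^ 8 ≤ δ := by
      calc δ ^ 8 ≤ δ ^ 1 := pow_le_pow_of_le_one hδ.le hδ2 (by norm_num)
        _ = δ := pow_one δ
    rw [e]
    calc _ ≤ 2 * r ^ 2 * κ * (25 + 2 * K) * δ := by gcongr
      _ = _ := by ring
  have hop : 2 * F ^ 2 * (((l : ℝ) + 1) ^ 2 * (144 * δ ^ 5 + (25 + 2 * K) * δ ^ 10 / (4 * δ ^ 5))) ≤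
      r ^ 2 * (2 * F ^ 2 * K ^ 2 * (144 + (25 + 2 * K) / 4) * δ) := by
    have e : ((l : ℝ) + 1) ^ 2 * (144 * δ ^ 5 + (25 + 2 * K) * δ ^ 10 / (4 * δ ^ 5)) =
        (((l : ℝ) + 1) * δ) ^ 2 * (144 + (25 + 2 * K) / 4) * (δ ^ 2 * δ) := by field_simp
    rw [e]
    calc _ ≤ 2 * F ^ 2 * (K ^ 2 * (144 + (25 + 2 * K) / 4) * (r ^ 2 * δ)) := by gcongr
      _ = _ := by ring
  rw [levelBound]
  linarith

/-- The constant in the bound for the squared risk. -/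
noncomputable def riskConst (s ν M Q₂ lam κ τsig τop F : ℝ) : ℝ :=
  36 * Q₂ * max τsig τop ^ 2 + (1 + (1 / 2) ^ (-(2 * s)) * (25 + 2 * (lam + 1))) * M ^ 2 +
    lam ^ (-(2 * s)) * M ^ 2 +
    (lam + 1) * (1152 * (κ + 1) * Q₂ * (lam + 1) ^ (2 * ν - 1) +
      (2 * κ * (25 + 2 * (lam + 1)) +
        2 * F ^ 2 * (lam + 1) ^ 2 * (144 + (25 + 2 * (lam + 1)) / 4)))

lemma sum_levelBound_le (hs : 1 / 2 < s) (hQ₂ : 0 < Q₂) (hlam : 0 < lam)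
    (hf : f ∈ sobolevBall s M) (hg : g ∈ illPosedClass ν Q₁ Q₂)
    (hκ : 512 ≤ κ) (hε : 0 < ε) (hε1 : ε ≤ Real.exp (-1)) (hδ : 0 < δ) (hδ1 : δ ≤ Real.exp (-1))
    (hr1 : totalNoise ε δ ≤ 1)
    (hr : 4 * κ * Real.sqrt (2 * Q₂) * totalNoise ε δ ^ ((s - 1 / 2) / (s + ν)) < 1)
    (hC : 0 ≤ C) (hCκ : C ≤ κ) :
    ∑ l ∈ Finset.range (⌊maxLevel lam ε δ⌋₊ + 1),
        levelBound κ τsig τop ε δ F ν C (lam + 1) g f l +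
      ∑' l, coeff f (l + (⌊maxLevel lam ε δ⌋₊ + 1)) ^ 2 ≤
      riskConst s ν M Q₂ lam κ τsig τop F * (totalNoise ε δ ^ (s / (s + ν))) ^ 2 := by
  have hν := half_le_of_mem hg
  have hsν : 0 < s + ν := by linarith
  have he : Real.exp (-1) ≤ 1 := Real.exp_le_one_iff.2 (by norm_num)
  have hεr := le_totalNoise_left (δ := δ) hε hε1
  have hδr := le_totalNoise_right (ε := ε) hδ hδ1
  have hlevel := fun (l : ℕ) => levelBound_le (f := f) (τsig := τsig) (τop := τop) (F := F) (l := l)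
    hs hQ₂ hg hκ hε hε1 hδ hδ1 hr1 hr hC hCκ (K := lam + 1) (by linarith)
  have hmax : maxLevel lam ε δ = lam * (totalNoise ε δ)⁻¹ := rfl
  set r := totalNoise ε δ
  have hr0 : 0 < r := hδ.trans_le hδr
  set L := ⌊maxLevel lam ε δ⌋₊ with hL
  have hLr : (L : ℝ) * r ≤ lam := by
    have : (L : ℝ) ≤ lam * r⁻¹ := by rw [← hmax]; exact Nat.floor_le (by rw [hmax]; positivity)
    calc (L : ℝ) * r ≤ lam * r⁻¹ * r := by gcongr
      _ = lam := by field_simp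
  have hLx : ∀ x : ℝ, 0 < x → x ≤ r → ((L : ℝ) + 1) * x ≤ lam + 1 := fun x hx hxr => by
    have : (L : ℝ) * x ≤ L * r := by gcongr
    linarith
  set R := r ^ (s / (s + ν)) with hR
  have hR0 : 0 < R := Real.rpow_pos_of_pos hr0 _
  have hrR : r ^ 2 ≤ R ^ 2 := by
    refine pow_le_pow_left₀ hr0.le ?_ 2
    have := Real.rpow_le_rpow_of_exponent_ge hr0 hr1
      (show s / (s + ν) ≤ 1 by rw [div_le_one hsν]; linarith)
    rwa [Real.rpow_one] at this
  have htail : ∑' l, coeff f (l + (L + 1)) ^ 2 ≤ lam ^ (-(2 * s)) * M ^ 2 * R ^ 2 := by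
    have hN : lam * r⁻¹ ≤ ((L + 1 : ℕ) : ℝ) := by
      push_cast; rw [← hmax]; exact (Nat.lt_floor_add_one _).le
    refine (tsum_coeff_sq_tail_le (by linarith) hf (by positivity) hN).trans ?_
    rw [Real.mul_rpow hlam.le (by positivity), Real.inv_rpow hr0.le, ← Real.rpow_neg hr0.le, neg_neg]
    have h1 : r ^ (2 * s) ≤ R ^ 2 := by
      rw [hR, ← Real.rpow_natCast (_ ^ (s / (s + ν))), ← Real.rpow_mul hr0.le]
      refine Real.rpow_le_rpow_of_exponent_ge hr0 hr1 ?_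
      -- The bias beyond the maximal level is of order `r ^ (2s)`, no worse than the rate because `s
      -- + ν ≥ 1`.
      have : s / (s + ν) ≤ s := div_le_self (by linarith) (by linarith)
      push_cast; linarith
    calc _ ≤ lam ^ (-(2 * s)) * R ^ 2 * M ^ 2 := by gcongr
      _ = _ := by ring
  set Rm := r ^ (-(1 / (s + ν))) with hRm
  have hRm1 : 1 ≤ Rm :=
    Real.one_le_rpow_of_pos_of_le_one_of_nonpos hr0 hr1 (by rw [neg_nonpos]; positivity)
  set c0 := 18 * Q₂ * max τsig τop ^ 2 * (Rm ^ (2 * ν - 1) * r ^ 2) with hc0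
  have hc00 : 0 ≤ c0 := by positivity
  have hvar : ∑ l ∈ Finset.range (L + 1),
      (if l ∈ Finset.range (cutoff s ν r + 1) then c0 else 0) ≤ 36 * Q₂ * max τsig τop ^ 2 * R ^ 2 := by
    rw [← Finset.sum_filter, Finset.sum_const, nsmul_eq_mul]
    have h1 : ((Finset.filter (fun l => l ∈ Finset.range (cutoff s ν r + 1))
        (Finset.range (L + 1))).card : ℝ) ≤ 2 * Rm := by
      have h2 : (Finset.filter (fun l => l ∈ Finset.range (cutoff s ν r + 1))
          (Finset.range (L + 1))).card ≤ cutoff s ν r + 1 := by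
        refine (Finset.card_le_card fun l hl => (Finset.mem_filter.1 hl).2).trans ?_
        rw [Finset.card_range]
      have h3 : (cutoff s ν r : ℝ) ≤ Rm := Nat.floor_le (by positivity)
      have h4 : (((Finset.filter (fun l => l ∈ Finset.range (cutoff s ν r + 1))
        (Finset.range (L + 1))).card : ℕ) : ℝ) ≤ cutoff s ν r + 1 := by exact_mod_cast h2
      linarith
    -- Bias and variance balance: about `Rm` levels, each with variance of order `Rm ^ (2ν-1) r²`.
    have h5 : Rm * Rm ^ (2 * ν - 1) * r ^ 2 = R ^ 2 := by
      have h6 : Rm * Rm ^ (2 * ν - 1) = Rm ^ (2 * ν) := by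
        rw [mul_comm, ← Real.rpow_add_one (by positivity)]; congr 1; ring
      rw [h6, hRm, hR, ← Real.rpow_mul hr0.le, ← Real.rpow_natCast r 2, ← Real.rpow_add hr0,
        ← Real.rpow_natCast (_ ^ (s / (s + ν))), ← Real.rpow_mul hr0.le]
      congr 1; push_cast; field_simp; ring
    calc _ ≤ 2 * Rm * c0 := by gcongr
      _ = 36 * Q₂ * max τsig τop ^ 2 * (Rm * Rm ^ (2 * ν - 1) * r ^ 2) := by rw [hc0]; ring
      _ = _ := by rw [h5]
  set cb := (1 / 2 : ℝ) ^ (-(2 * s)) * (25 + 2 * (lam + 1)) with hcb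
  have hcb0 : 0 ≤ cb := by positivity
  set c1 := 1152 * (κ + 1) * Q₂ * (lam + 1) ^ (2 * ν - 1) with hc1
  have hc10 : 0 ≤ c1 := by
    have : 0 ≤ κ + 1 := by linarith
    positivity
  set c2 := 2 * κ * (25 + 2 * (lam + 1)) + 2 * F ^ 2 * (lam + 1) ^ 2 * (144 + (25 + 2 * (lam + 1)) / 4)
    with hc2
  have hc20 : 0 ≤ c2 := by
    have : 0 ≤ κ := by linarith
    positivity
  have hsum : ∑ l ∈ Finset.range (L + 1), levelBound κ τsig τop ε δ F ν C (lam + 1) g f l ≤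
      36 * Q₂ * max τsig τop ^ 2 * R ^ 2 + (R ^ 2 + cb * r ^ 2) * M ^ 2 +
        r ^ 2 * ((lam + 1) * (c1 + c2)) := by
    calc _ ≤ ∑ l ∈ Finset.range (L + 1), ((if l ∈ Finset.range (cutoff s ν r + 1) then c0 else 0) +
          (R ^ 2 + cb * r ^ 2) * (((l : ℝ) + 1 / 2) ^ s * coeff f l) ^ 2 +
          r ^ 2 * (c1 * ε + c2 * δ)) := by
          refine Finset.sum_le_sum fun l hl => ?_
          have hl' : (l : ℝ) + 1 ≤ L + 1 := by
            have := Nat.lt_succ_iff.1 (Finset.mem_range.1 hl)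
            have h2 : (l : ℝ) ≤ L := Nat.cast_le.2 this
            linarith
          refine hlevel l ?_ ?_
          · exact (mul_le_mul_of_nonneg_right hl' hε.le).trans (hLx ε hε hεr)
          · exact (mul_le_mul_of_nonneg_right hl' hδ.le).trans (hLx δ hδ hδr)
      _ = ∑ l ∈ Finset.range (L + 1), (if l ∈ Finset.range (cutoff s ν r + 1) then c0 else 0) +
          (R ^ 2 + cb * r ^ 2) *
            ∑ l ∈ Finset.range (L + 1), (((l : ℝ) + 1 / 2) ^ s * coeff f l) ^ 2 +
          r ^ 2 * (c1 * (((L : ℝ) + 1) * ε) + c2 * (((L : ℝ) + 1) * δ)) := by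
          rw [Finset.sum_add_distrib, Finset.sum_add_distrib, ← Finset.mul_sum, Finset.sum_const,
            Finset.card_range, nsmul_eq_mul]
          push_cast; ring
      _ ≤ 36 * Q₂ * max τsig τop ^ 2 * R ^ 2 + (R ^ 2 + cb * r ^ 2) * M ^ 2 +
          r ^ 2 * (c1 * (lam + 1) + c2 * (lam + 1)) := by
          have h1 := hLx ε hε hεr
          have h2 := hLx δ hδ hδr
          have h3 := sum_weighted_le hf (L + 1)
          gcongr
      _ = _ := by ring
  calc _ ≤ 36 * Q₂ * max τsig τop ^ 2 * R ^ 2 + (R ^ 2 + cb * r ^ 2) * M ^ 2 +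
        r ^ 2 * ((lam + 1) * (c1 + c2)) + lam ^ (-(2 * s)) * M ^ 2 * R ^ 2 := add_le_add hsum htail
    _ ≤ 36 * Q₂ * max τsig τop ^ 2 * R ^ 2 + (R ^ 2 + cb * R ^ 2) * M ^ 2 +
        R ^ 2 * ((lam + 1) * (c1 + c2)) + lam ^ (-(2 * s)) * M ^ 2 * R ^ 2 := by gcongr
    _ = _ := by rw [riskConst]; ring

lemma riskConst_nonneg (hQ₂ : 0 < Q₂) (hlam : 0 < lam) (hκ : 512 ≤ κ) :
    0 ≤ riskConst s ν M Q₂ lam κ τsig τop F := by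
  have : 0 ≤ κ + 1 := by linarith
  have : 0 ≤ κ := by linarith
  unfold riskConst
  positivity

end Sums

end LaplaceDeconv

/-! ### Choice of the constants and conclusion. -/

theorem theorem2 (s ν M Q₁ Q₂ lam : ℝ) (hs : 1 / 2 < s) (hν : 0 < ν) (hM : 0 ≤ M)
    (hQ₁ : 0 < Q₁) (hQ₂ : 0 < Q₂) (hlam : 0 < lam) :
    -- `thr C`: how large the thresholding constants must be, for designs with constant `C`
    ∃ thr : ℝ → ℝ, ∀ κ τsig τop : ℝ,
      -- the constant in the bound and the range of the noise levels do not depend on `C`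
      ∃ A ε₀ : ℝ, 0 < A ∧ 0 < ε₀ ∧ ∀ C : ℝ, 0 ≤ C → thr C ≤ κ → thr C ≤ τsig → thr C ≤ τop →
        ∀ (D : Design) (σ ε δ : ℝ), 0 < σ → ε = D.noiseLevel σ → 0 < δ → ε ≤ ε₀ → δ ≤ ε₀ →
          D.WellConditioned ⌊maxLevel lam ε δ⌋₊ C →
          ∀ f ∈ sobolevBall s M, ∀ g ∈ illPosedClass ν Q₁ Q₂,
            ∀ (Ω : Type*) [MeasurableSpace Ω] (P : Measure Ω) [IsProbabilityMeasure P]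
              (b : ℕ → Ω → ℝ) (ξ : (l : ℕ) → Ω → EuclideanSpace ℝ (Fin (l + 1))),
              NoiseModel D ⌊maxLevel lam ε δ⌋₊ P b ξ →
              riskII lam κ τsig τop ε δ f g P b ξ ≤
                ENNReal.ofReal (A * max ((δ * |Real.log δ|) ^ (s / (s + ν)))
                  ((ε * Real.sqrt |Real.log ε|) ^ (s / (s + ν)))) := by
  set F := M * ellOneConst s + 1 with hF
  have hF0 : 0 < F := by
    have : 0 ≤ ellOneConst s := Real.sqrt_nonneg _
    positivity
  set q := Real.sqrt (Q₂ / Q₁) with hq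
  have hq0 : 0 < q := Real.sqrt_pos.2 (by positivity)
  -- The summands serve in turn the bounds on the operator noise, the domination of `C` by `κ`, the
  -- operator error against `τop`, and the Gaussian tail against `τsig`.
  refine ⟨fun C => 512 + C + 3600 * F * q + 1152 * (2 * ν + 1) * q ^ 2 * (C + 1),
    fun κ τsig τop => ?_⟩
  -- The constants are chosen before `C`; a smaller `κ` never reaches the threshold, so any values
  -- do.
  by_cases hκ : 512 ≤ κ
  swap
  · refine ⟨1, 1, one_pos, one_pos, fun C hC h => absurd (le_trans ?_ h) hκ⟩
    have : 0 ≤ 3600 * F * q := by positivity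
    have : 0 ≤ 1152 * (2 * ν + 1) * q ^ 2 * (C + 1) := by positivity
    linarith
  have hκ0 : 0 < κ := by linarith
  have hsν : 0 < s + ν := by linarith
  set η := (s - 1 / 2) / (s + ν) with hη
  have hη0 : 0 < η := div_pos (by linarith) hsν
  set c := 4 * κ * Real.sqrt (2 * Q₂) with hc
  have hc0 : 0 ≤ c := by positivity
  -- A total noise at most `y` gives `c * r ^ η ≤ c / (c + 1) < 1`, the acceptance condition at low
  -- levels. It is ensured by noise levels at most `(y / 2) ^ 2`, as `x |log x| ≤ 2 √x`.
  set y := min 1 ((1 / (c + 1)) ^ (1 / η)) with hy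
  have hy0 : 0 < y := lt_min one_pos (by positivity)
  have hRC := riskConst_nonneg (s := s) (ν := ν) (M := M) (τsig := τsig) (τop := τop) (F := F)
    hQ₂ hlam hκ
  refine ⟨1 / 2 * (1 + riskConst s ν M Q₂ lam κ τsig τop F), min (Real.exp (-1)) ((y / 2) ^ 2),
    by positivity, lt_min (Real.exp_pos _) (by positivity), ?_⟩
  intro C hC hthκ hthsig hthop D σ ε δ hσ hεD hδ hεs hδs hW f hf g hg Ω _ P _ b ξ N
  have hε : 0 < ε := by
    have h1 := D.n_pos; have h2 := D.T_pos
    rw [hεD, Design.noiseLevel]; positivity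
  have hε1 := hεs.trans (min_le_left _ _)
  have hδ1 := hδs.trans (min_le_left _ _)
  have hry : totalNoise ε δ ≤ y := totalNoise_le hε hδ hε1 hδ1 hy0.le
    (hεs.trans (min_le_right _ _)) (hδs.trans (min_le_right _ _))
  have hr1 : totalNoise ε δ ≤ 1 := hry.trans (min_le_left _ _)
  have hr0 : 0 < totalNoise ε δ := hδ.trans_le (le_totalNoise_right hδ hδ1)
  have hr : c * totalNoise ε δ ^ η < 1 := by
    have h1 : totalNoise ε δ ^ η ≤ 1 / (c + 1) := by
      refine (Real.rpow_le_rpow hr0.le (hry.trans (min_le_right _ _)) hη0.le).trans (le_of_eq ?_)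
      rw [← Real.rpow_mul (by positivity), one_div_mul_cancel hη0.ne', Real.rpow_one]
    calc _ ≤ c * (1 / (c + 1)) := by gcongr
      _ < 1 := by rw [mul_one_div, div_lt_one (by positivity)]; linarith
  have t1 : 0 ≤ 3600 * F * q := by positivity
  have t2 : 0 ≤ 1152 * (2 * ν + 1) * q ^ 2 * (C + 1) := by positivity
  simp only at hthκ hthsig hthop
  have hsig : 1152 * (2 * ν + 1) * q ^ 2 * (C + 1) ≤ τsig ^ 2 := by nlinarith
  have hg2 : MemLp g 2 halfLine := hg.1
  have hlev : ∀ l ≤ ⌊maxLevel lam ε δ⌋₊, ∫⁻ z, ENNReal.ofReal ((levelEst κ τsig τop ε δ (opSeries g)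
      (sigSeries f) l z.1 z.2 - coeff f l) ^ 2)
      ∂((gaussVec l).prod (multivariateGaussian 0 (D.Omega l))) ≤
      ENNReal.ofReal (levelBound κ τsig τop ε δ F ν C (lam + 1) g f l) := fun l hl => by
    have hfs : ∑ k ∈ Finset.range (l + 1), |PowerSeries.coeff k (sigSeries f)| ≤ F := by
      simp_rw [coeff_sigSeries]
      linarith [sum_abs_coeff_le hs hM hf (l + 1)]
    have hlK : (l + 1 : ℝ) ≤ (lam + 1) / δ := by
      rw [le_div_iff₀ hδ]
      have hl' : (l : ℝ) ≤ lam * (totalNoise ε δ)⁻¹ :=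
        (Nat.cast_le.2 hl).trans (Nat.floor_le (by
          show 0 ≤ lam * (totalNoise ε δ)⁻¹
          positivity))
      have h1 : (l : ℝ) * δ ≤ lam := by
        calc (l : ℝ) * δ ≤ lam * (totalNoise ε δ)⁻¹ * totalNoise ε δ := by
              gcongr; exact le_totalNoise_right hδ hδ1
          _ = lam := by field_simp
      have h2 : δ ≤ 1 := (le_totalNoise_right (ε := ε) hδ hδ1).trans hr1
      linarith
    have hA := constantCoeff_opSeries_ne hg
    have h := lintegral_levelEst_le (τsig := τsig) (τop := τop) (μ := multivariateGaussian 0 (D.Omega l))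
      (θ := 2 * ν + 1) hκ hδ hδ1 hε hε1 hF0 hA hq0 (l2_inv_le_normalized_tzHS hQ₁ hQ₂ hg l) hfs hC
      (by linarith) (by linarith) hsig (by linarith)
      (fun v => exists_map_linear_multivariateGaussian Design.posSemidef_Omega (hW l hl).2 v)
      -- The Young parameter `δ ^ 5` balances the probability of order `δ ^ 10` of the exceptional
      -- event.
      (show 0 < δ ^ 5 by positivity) (measure_goodNoise_compl_le hκ hδ hδ1 hF0 hA hfs hlK)
    simp only [coeff_sigSeries] at h
    exact h
  set R := totalNoise ε δ ^ (s / (s + ν)) with hR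
  have hR0 : 0 < R := Real.rpow_pos_of_pos hr0 _
  have hrisk := riskII_le hg2 hf.1 N (levelBound κ τsig τop ε δ F ν C (lam + 1) g f)
    (fun l => levelBound_nonneg hε hδ hC (by linarith) l) hlev hR0
  have hsum := sum_levelBound_le (τsig := τsig) (τop := τop) (F := F) hs hQ₂ hlam hf hg hκ hε hε1
    hδ hδ1 hr1 hr hC (by linarith)
  refine hrisk.trans (ENNReal.ofReal_le_ofReal ?_)
  have hRmax : R ≤ max ((δ * |Real.log δ|) ^ (s / (s + ν)))
      ((ε * Real.sqrt |Real.log ε|) ^ (s / (s + ν))) := by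
    rw [hR, totalNoise]
    rcases max_choice (ε * Real.sqrt |Real.log ε|) (δ * |Real.log δ|) with h | h <;> rw [h]
    · exact le_max_right _ _
    · exact le_max_left _ _
  calc _ ≤ 1 / 2 * R + 1 / (2 * R) * (riskConst s ν M Q₂ lam κ τsig τop F * R ^ 2) := by gcongr
    _ = 1 / 2 * (1 + riskConst s ν M Q₂ lam κ τsig τop F) * R := by field_simp
    _ ≤ _ := by gcongr
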